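/- Let $S$ be an inverse semigroup with unit $1$ (every $s\in S$ has a unique $s^*\in S$ with $ss^*s=s$ and $s^*ss^*=s^*$). A partial action of $S$ on a set $X$ consists of subsets $X_s\subseteq X$ and bijections $\theta_s:X_{s^*}\to X_s$ ($s\in S$) such that $X_1=X$, $\theta_1=\mathrm{id}$ and, for all $s,t\in S$, $\theta_{s^*}(X_s\cap X_{t^*})\subseteq X_{(ts)^*}$ and $\theta_{ts}$ extends $\theta_t\theta_s$ on $\theta_{s^*}(X_s\cap X_{t^*})$. For a partial action on a $C^*$-algebra $A$ the $A_s$ are required to be closed two-sided ideals and the $\theta_s$ to be $*$-isomorphisms. A partial representation of $S$ on a Hilbert space $H$ is a partial action on $H$ by closed subspaces $H_s$ and surjective linear isometries $v_s:H_{s^*}\to H_s$; extended by $0$ on $H_{s^*}^{\perp}$, the $v_s$ are partial isometries in $\mathcal B(H)$. A covariant representation of $(A,S,\theta)$ on $H$ is a pair $(\pi,v)$ of a $*$-homomorphism $\pi:A\to\mathcal B(H)$ and a partial representation $v$ of $S$ on $H$ such that, for all $s\in S$, $\overline{\operatorname{span}}\,\pi(A_s)H=v_sv_{s^*}H$ $(=H_s)$,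 and $\pi(\theta_s(a))=v_s\pi(a)v_{s^*}$ for all $a\in A_{s^*}$. Let $C_c(S,A)$ be the space of finite formal sums $\sum_s a_su_s$ with $a_s\in A_s$, with product and involution given by $(au_s)(bu_t)=\theta_s(\theta_{s^*}(a)b)u_{st}$ and $(au_s)^*=\theta_{s^*}(a^*)u_{s^*}$. The crossed product $A\rtimes S$ is the Hausdorff completion of $C_c(S,A)$ with respect to the seminorm $\|\sum_s a_su_s\|=\sup_{(\pi,v)}\|\sum_s\pi(a_s)v_s\|$, where $(\pi,v)$ runs over all covariant representations. For a $C^*$-algebra $B$, let $B^{**}$ denote its enveloping von Neumann algebra (the bicommutant of its universal representation), with canonical inclusion $j_B:B\to B^{**}$. Let $\theta$ be a partial action of $S$ on a $C^*$-algebra $A$. Then: 1. There is a unique partial action $\theta^{**}$ of $S$ on $A^{**}$ with the following properties, for all $s\in S$: the ideal $(A^{**})_s$ is the ultraweak closure of $j_A(A_s)$ in $A^{**}$; this ideal is the enveloping von Neumann algebra $(A_s)^{**}$, i.e. there is an ultraweakly bicontinuous $*$-isomorphism $(A_s)^{**}\cong (A^{**})_s$ compatible with the inclusions of $A_s$; and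 $\theta^{**}_s:(A^{**})_{s^*}\to(A^{**})_s$ is ultraweakly continuous (normal) and satisfies $\theta^{**}_s(j_A(a))=j_A(\theta_s(a))$ for $a\in A_{s^*}$. 2. There is a $*$-homomorphism $\iota:A\rtimes S\to A^{**}\rtimes S$ (crossed product by $\theta^{**}$) with $\iota(au_s)=j_A(a)u_s$ for all $s\in S$, $a\in A_s$, and there is a $*$-homomorphism $\Phi:A^{**}\rtimes S\to(A\rtimes S)^{**}$ such that $\Phi\circ\iota=j_{A\rtimes S}$ is the canonical inclusion. -/

import Mathlib

open scoped ENNReal Topology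

universe u v w

/-! ### Inverse semigroups with unit -/

/-- An inverse semigroup with unit: a monoid in which every `s` has exactly one generalized
inverse, written `s⁻¹` (the `s^*` of the literature). -/
class InverseMonoid (S : Type v) extends Monoid S, Inv S where
  mul_inv_mul : ∀ s : S, s * s⁻¹ * s = s
  inv_mul_inv : ∀ s : S, s⁻¹ * s * s⁻¹ = s⁻¹
  eq_inv_of : ∀ s t : S, s * t * s = s → t * s * t = t → t = s⁻¹

namespace InverseMonoid

variable {S : Type v} [InverseMonoid S]

theorem inv_inv' (s : S) : (s⁻¹)⁻¹ = s :=
  (eq_inv_of s⁻¹ s (inv_mul_inv s) (mul_inv_mul s)).symm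

theorem inv_one' : (1 : S)⁻¹ = 1 :=
  (eq_inv_of (1 : S) 1 (by simp) (by simp)).symm

theorem idem_inv {e : S} (he : e * e = e) : e⁻¹ = e :=
  (eq_inv_of e e (by rw [he, he]) (by rw [he, he])).symm

theorem idem_mul {e f : S} (he : e * e = e) (hf : f * f = f) : (e * f) * (e * f) = e * f := by
  set x := (e * f)⁻¹ with hx
  have h1 : e * f * x * (e * f) = e * f := mul_inv_mul _
  have h2 : x * (e * f) * x = x := inv_mul_inv _
  have hy : f * x * e = x := by
    refine eq_inv_of (e * f) (f * x * e) ?_ ?_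
    · calc e * f * (f * x * e) * (e * f) = e * (f * f) * x * (e * e) * f := by
            simp only [mul_assoc]
        _ = e * f * x * (e * f) := by rw [he, hf]; simp only [mul_assoc]
        _ = e * f := h1
    · calc f * x * e * (e * f) * (f * x * e) = f * (x * ((e * e) * (f * f)) * x) * e := by
            simp only [mul_assoc]
        _ = f * x * e := by rw [he, hf, h2]
  have hxx : x * x = x := by
    calc x * x = (f * x * e) * (f * x * e) := by rw [hy]
      _ = f * (x * (e * f) * x) * e := by simp only [mul_assoc]
      _ = x := by rw [h2, hy]
  have h3 : e * f = x := by
    have := idem_inv hxx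
    rw [hx, inv_inv'] at this
    exact this
  rw [h3, hxx]

theorem idem_comm {e f : S} (he : e * e = e) (hf : f * f = f) : e * f = f * e := by
  have hef := idem_mul he hf
  have hfe := idem_mul hf he
  have h : f * e = (e * f)⁻¹ := by
    refine eq_inv_of (e * f) (f * e) ?_ ?_
    · calc e * f * (f * e) * (e * f) = e * (f * f) * (e * e) * f := by simp only [mul_assoc]
        _ = (e * f) * (e * f) := by rw [he, hf]; simp only [mul_assoc]
        _ = e * f := hef
    · calc f * e * (e * f) * (f * e) = f * (e * e) * (f * f) * e := by simp only [mul_assoc]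
        _ = (f * e) * (f * e) := by rw [he, hf]; simp only [mul_assoc]
        _ = f * e := hfe
  rw [h, idem_inv hef]

theorem idem_left (s : S) : (s * s⁻¹) * (s * s⁻¹) = s * s⁻¹ := by
  rw [← mul_assoc, mul_inv_mul]

theorem idem_right (s : S) : (s⁻¹ * s) * (s⁻¹ * s) = s⁻¹ * s := by
  rw [← mul_assoc, inv_mul_inv]

theorem mul_inv_rev' (s t : S) : (s * t)⁻¹ = t⁻¹ * s⁻¹ := by
  have hc : (s⁻¹ * s) * (t * t⁻¹) = (t * t⁻¹) * (s⁻¹ * s) :=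
    idem_comm (idem_right s) (idem_left t)
  refine (eq_inv_of (s * t) (t⁻¹ * s⁻¹) ?_ ?_).symm
  · calc s * t * (t⁻¹ * s⁻¹) * (s * t) = s * ((t * t⁻¹) * (s⁻¹ * s)) * t := by
          simp only [mul_assoc]
      _ = (s * s⁻¹ * s) * (t * t⁻¹ * t) := by rw [← hc]; simp only [mul_assoc]
      _ = s * t := by rw [mul_inv_mul, mul_inv_mul]
  · calc t⁻¹ * s⁻¹ * (s * t) * (t⁻¹ * s⁻¹) = t⁻¹ * ((s⁻¹ * s) * (t * t⁻¹)) * s⁻¹ := by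
          simp only [mul_assoc]
      _ = (t⁻¹ * t * t⁻¹) * (s⁻¹ * s * s⁻¹) := by rw [hc]; simp only [mul_assoc]
      _ = t⁻¹ * s⁻¹ := by rw [inv_mul_inv, inv_mul_inv]

end InverseMonoid

/-! ### Partial actions -/

/-- A partial action of `S` on a set `α`: subsets `X s` and maps `θ s` restricting to bijections
`X s⁻¹ → X s` (the values of `θ s` outside `X s⁻¹` play no role), such that `X 1` is everything
and `θ 1` the identity, and `θ (t * s)` extends `θ t ∘ θ s` on `θ s⁻¹ (X s ∩ X t⁻¹)`. -/
structure IsPartialAction {S : Type v} [InverseMonoid S] {α : Type w}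
    (X : S → Set α) (θ : S → α → α) : Prop where
  bijOn : ∀ s, Set.BijOn (θ s) (X s⁻¹) (X s)
  dom_one : X 1 = Set.univ
  map_one : ∀ x, θ 1 x = x
  dom_mul : ∀ s t, θ s⁻¹ '' (X s ∩ X t⁻¹) ⊆ X (t * s)⁻¹
  map_mul : ∀ s t, ∀ x ∈ θ s⁻¹ '' (X s ∩ X t⁻¹), θ (t * s) x = θ t (θ s x)

namespace IsPartialAction

variable {S : Type v} [InverseMonoid S] {α : Type w} {X : S → Set α} {θ : S → α → α}

theorem map_idem (h : IsPartialAction X θ) {e : S} (he : e * e = e) {x : α} (hx : x ∈ X e) :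
    θ e x = x := by
  have hei := InverseMonoid.idem_inv he
  have hb := h.bijOn e
  rw [hei] at hb
  have h2 := h.map_mul e e
  rw [hei, Set.inter_self, hb.image_eq, he] at h2
  exact hb.injOn (hb.mapsTo hx) hx (h2 x hx).symm

theorem subset_idem (h : IsPartialAction X θ) (s : S) : X s ⊆ X (s * s⁻¹) := by
  have h1 := h.dom_mul s⁻¹ s
  rw [Set.inter_self, InverseMonoid.inv_inv', (h.bijOn _).image_eq,
    InverseMonoid.idem_inv (InverseMonoid.idem_left s)] at h1
  exact h1

theorem map_map_inv (h : IsPartialAction X θ) (s : S) {x : α} (hx : x ∈ X s) :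
    θ s (θ s⁻¹ x) = x := by
  have h2 := h.map_mul s⁻¹ s
  have h1 := h.subset_idem s
  rw [Set.inter_self, InverseMonoid.inv_inv', (h.bijOn _).image_eq] at h2
  rw [← h2 x hx]
  exact h.map_idem (InverseMonoid.idem_left s) (h1 hx)

theorem map_inv_mem (h : IsPartialAction X θ) (s : S) {x : α} (hx : x ∈ X s) :
    θ s⁻¹ x ∈ X s⁻¹ := by
  have := (h.bijOn s⁻¹).mapsTo
  rw [InverseMonoid.inv_inv'] at this
  exact this hx

theorem map_mem_mul (h : IsPartialAction X θ) (s t : S) {x : α} (hx : x ∈ X s⁻¹)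
    (hx' : x ∈ X t) : θ s x ∈ X (s * t) := by
  have h2 := h.dom_mul s⁻¹ t⁻¹
  rw [InverseMonoid.inv_inv', InverseMonoid.inv_inv', ← InverseMonoid.mul_inv_rev',
    InverseMonoid.inv_inv'] at h2
  exact h2 ⟨x, ⟨hx, hx'⟩, rfl⟩

end IsPartialAction

open Classical in
/-- A map between two subsets of `α`, extended by zero to all of `α`. -/
noncomputable def extendByZero {α : Type w} [Zero α] {P Q : α → Prop}
    (e : {x // P x} → {x // Q x}) (x : α) : α :=
  if h : P x then e ⟨x, h⟩ else 0

/-- A partial action of `S` on a C⋆-algebra: closed two-sided ideals (with their automatic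
`⋆`-closedness built in) and `⋆`-isomorphisms between them which form a partial action on the
underlying set. -/
structure PartialAction (S : Type v) [InverseMonoid S] (A : Type u) [NonUnitalCStarAlgebra A] where
  ideal : S → NonUnitalStarSubalgebra ℂ A
  mul_mem_left : ∀ (s : S) (a b : A), b ∈ ideal s → a * b ∈ ideal s
  mul_mem_right : ∀ (s : S) (a b : A), a ∈ ideal s → a * b ∈ ideal s
  isClosed : ∀ s, IsClosed (ideal s : Set A)
  equiv : ∀ s, ideal s⁻¹ ≃⋆ₐ[ℂ] ideal s
  isPartialAction : IsPartialAction (fun s => (ideal s : Set A))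
    (fun s => extendByZero (fun a : ideal s⁻¹ => equiv s a))

namespace PartialAction

variable {S : Type v} [InverseMonoid S] {A : Type u} [NonUnitalCStarAlgebra A]
variable (θ : PartialAction S A)

instance (s : S) : IsClosed (θ.ideal s : Set A) := θ.isClosed s

/-- The isomorphism `θ s`, extended by zero to all of `A`. -/
noncomputable def act (s : S) (a : A) : A := extendByZero (fun a : θ.ideal s⁻¹ => θ.equiv s a) a

theorem act_of_mem {s : S} {a : A} (h : a ∈ θ.ideal s⁻¹) : θ.act s a = θ.equiv s ⟨a, h⟩ :=
  dif_pos h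

theorem act_mem (s : S) (a : A) : θ.act s a ∈ θ.ideal s := by
  by_cases h : a ∈ θ.ideal s⁻¹
  · rw [θ.act_of_mem h]; exact (θ.equiv s _).2
  · have : θ.act s a = 0 := dif_neg h
    rw [this]; exact zero_mem _

theorem act_inv_mem (s : S) (a : A) : θ.act s⁻¹ a ∈ θ.ideal s⁻¹ := θ.act_mem _ _

theorem act_act_inv (s : S) {a : A} (h : a ∈ θ.ideal s) : θ.act s (θ.act s⁻¹ a) = a :=
  θ.isPartialAction.map_map_inv s h

theorem act_mem_mul (s t : S) {a : A} (h : a ∈ θ.ideal s⁻¹) (h' : a ∈ θ.ideal t) :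
    θ.act s a ∈ θ.ideal (s * t) :=
  θ.isPartialAction.map_mem_mul s t h h'

end PartialAction

/-! ### Covariant representations -/

/-- A partial representation of `S` on a Hilbert space `H`: closed subspaces `space s` and
operators `v s` which restrict to surjective isometries `space s⁻¹ → space s`, vanish on the
orthogonal complement of `space s⁻¹`, and form a partial action. -/
structure PartialRepresentation (S : Type v) [InverseMonoid S] (H : Type w)
    [NormedAddCommGroup H] [InnerProductSpace ℂ H] where
  space : S → Submodule ℂ H
  isClosed : ∀ s, IsClosed (space s : Set H)
  v : S → H →L[ℂ] H
  norm_map : ∀ s, ∀ ξ ∈ space s⁻¹, ‖v s ξ‖ = ‖ξ‖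
  map_orthogonal : ∀ s, ∀ ξ ∈ (space s⁻¹)ᗮ, v s ξ = 0
  isPartialAction : IsPartialAction (fun s => (space s : Set H)) (fun s => v s)

/-- A covariant representation of a partial action on a Hilbert space `H`. Here
`space s = v s (v s⁻¹ H)` is the range of `v s`, and `π(A_s)H` means the closed linear span. -/
structure CovariantRep {S : Type v} [InverseMonoid S] {A : Type u} [NonUnitalCStarAlgebra A]
    (θ : PartialAction S A) (H : Type w) [NormedAddCommGroup H] [InnerProductSpace ℂ H]
    [CompleteSpace H] extends PartialRepresentation S H where
  π : A →⋆ₙₐ[ℂ] (H →L[ℂ] H)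
  closure_span : ∀ s, (Submodule.span ℂ {η : H | ∃ a ∈ θ.ideal s, ∃ ξ, π a ξ = η}).topologicalClosure
    = space s
  covariant : ∀ s (a : θ.ideal s⁻¹), π (θ.equiv s a) = v s * π a * v s⁻¹

namespace PartialRepresentation

variable {S : Type v} [InverseMonoid S] {H : Type w}
    [NormedAddCommGroup H] [InnerProductSpace ℂ H] [CompleteSpace H]
    (V : PartialRepresentation S H)

theorem hasProj (s : S) : (V.space s).HasOrthogonalProjection :=
  haveI : CompleteSpace (V.space s) := (V.isClosed s).completeSpace_coe
  inferInstance

theorem apply_mem (s : S) (ξ : H) : V.v s ξ ∈ V.space s := by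
  have := V.hasProj s⁻¹
  obtain ⟨y, hy, z, hz, rfl⟩ := (V.space s⁻¹).exists_add_mem_mem_orthogonal ξ
  rw [map_add, V.map_orthogonal s z hz, add_zero]
  exact (V.isPartialAction.bijOn s).mapsTo hy

theorem norm_apply_le (s : S) (ξ : H) : ‖V.v s ξ‖ ≤ ‖ξ‖ := by
  have := V.hasProj s⁻¹
  obtain ⟨y, hy, z, hz, rfl⟩ := (V.space s⁻¹).exists_add_mem_mem_orthogonal ξ
  rw [map_add, V.map_orthogonal s z hz, add_zero, V.norm_map s y hy]
  have h : inner ℂ y z = 0 := hz y hy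
  have := norm_add_sq_eq_norm_sq_add_norm_sq_of_inner_eq_zero y z h
  nlinarith [norm_nonneg y, norm_nonneg z, norm_nonneg (y + z), mul_self_nonneg ‖z‖]

theorem norm_le_one (s : S) : ‖V.v s‖ ≤ 1 :=
  ContinuousLinearMap.opNorm_le_bound _ zero_le_one fun ξ => by simpa using V.norm_apply_le s ξ

theorem inner_map (s : S) {x y : H} (hx : x ∈ V.space s⁻¹) (hy : y ∈ V.space s⁻¹) :
    inner ℂ (V.v s x) (V.v s y) = inner ℂ x y := by
  let f : V.space s⁻¹ →ₗᵢ[ℂ] H :=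
    { toLinearMap := (V.v s).toLinearMap.comp (V.space s⁻¹).subtype
      norm_map' := fun z => V.norm_map s z z.2 }
  exact f.inner_map_map ⟨x, hx⟩ ⟨y, hy⟩

theorem star_v (s : S) : star (V.v s) = V.v s⁻¹ := by
  rw [ContinuousLinearMap.star_eq_adjoint]
  symm
  rw [ContinuousLinearMap.eq_adjoint_iff]
  intro x y
  have := V.hasProj s
  have := V.hasProj s⁻¹
  obtain ⟨x0, hx0, x1, hx1, rfl⟩ := (V.space s).exists_add_mem_mem_orthogonal x
  obtain ⟨y0, hy0, y1, hy1, rfl⟩ := (V.space s⁻¹).exists_add_mem_mem_orthogonal y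
  have e1 : V.v s⁻¹ x1 = 0 := V.map_orthogonal s⁻¹ x1 (by rwa [InverseMonoid.inv_inv'])
  have e2 : V.v s y1 = 0 := V.map_orthogonal s y1 hy1
  have e3 : inner ℂ (V.v s⁻¹ x0) y1 = 0 := hy1 _ (V.apply_mem _ _)
  have e4 : inner ℂ x1 (V.v s y0) = 0 :=
    Submodule.inner_left_of_mem_orthogonal (V.apply_mem s y0) hx1
  have e5 : V.v s (V.v s⁻¹ x0) = x0 := V.isPartialAction.map_map_inv s hx0
  rw [map_add, map_add, e1, e2, add_zero, add_zero, inner_add_right, inner_add_left, e3, e4,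
    add_zero, add_zero, ← V.inner_map s (V.apply_mem _ _) hy0, e5]

theorem map_inv_map (s : S) {x : H} (hx : x ∈ V.space s⁻¹) : V.v s⁻¹ (V.v s x) = x := by
  have := V.isPartialAction.map_map_inv s⁻¹ hx
  rwa [InverseMonoid.inv_inv'] at this

end PartialRepresentation

namespace CovariantRep

variable {S : Type v} [InverseMonoid S] {A : Type u} [NonUnitalCStarAlgebra A]
    {θ : PartialAction S A} {H : Type w} [NormedAddCommGroup H] [InnerProductSpace ℂ H]
    [CompleteSpace H] (ρ : CovariantRep θ H)

theorem π_mem {s : S} {a : A} (ha : a ∈ θ.ideal s) (ξ : H) : ρ.π a ξ ∈ ρ.space s := by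
  rw [← ρ.closure_span s]
  exact Submodule.le_topologicalClosure _ (Submodule.subset_span ⟨a, ha, ξ, rfl⟩)

theorem π_act {s : S} {a : A} (ha : a ∈ θ.ideal s⁻¹) :
    ρ.π (θ.act s a) = ρ.v s * ρ.π a * ρ.v s⁻¹ := by
  rw [θ.act_of_mem ha, ρ.covariant]

theorem v_inv_v_π {s : S} {a : A} (ha : a ∈ θ.ideal s⁻¹) :
    ρ.v s⁻¹ * ρ.v s * ρ.π a = ρ.π a := by
  ext ξ
  exact ρ.map_inv_map s (ρ.π_mem ha ξ)

theorem π_v_inv_v {s : S} {a : A} (ha : a ∈ θ.ideal s⁻¹) :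
    ρ.π a * ρ.v s⁻¹ * ρ.v s = ρ.π a := by
  have h := congrArg star (ρ.v_inv_v_π (star_mem ha))
  simpa [ρ.star_v, InverseMonoid.inv_inv', map_star, mul_assoc] using h

/-- The commutation rule `π(θ_s(c)) v_s = v_s π(c)`. -/
theorem π_act_mul_v {s : S} {a : A} (ha : a ∈ θ.ideal s⁻¹) :
    ρ.π (θ.act s a) * ρ.v s = ρ.v s * ρ.π a := by
  rw [ρ.π_act ha, mul_assoc, mul_assoc, ← mul_assoc (ρ.π a), ρ.π_v_inv_v ha]

theorem π_mul_v {s : S} {a : A} (ha : a ∈ θ.ideal s) :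
    ρ.π a * ρ.v s = ρ.v s * ρ.π (θ.act s⁻¹ a) := by
  rw [← ρ.π_act_mul_v (θ.act_inv_mem s a), θ.act_act_inv s ha]

theorem π_mul_v_mul_v {s t : S} {d : A} (hs : d ∈ θ.ideal s)
    (hd : θ.act s⁻¹ (star d) ∈ θ.ideal t) :
    ρ.π d * (ρ.v s * ρ.v t) = ρ.π d * ρ.v (s * t) := by
  apply star_injective
  simp only [star_mul, ρ.star_v, ← map_star, InverseMonoid.mul_inv_rev']
  have hs' : star d ∈ θ.ideal s := star_mem hs
  ext ξ
  simp only [mul_apply_eq_comp]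
  have h1 : ρ.π (star d) ξ ∈ ρ.space s := ρ.π_mem hs' ξ
  have h2 : ρ.v s⁻¹ (ρ.π (star d) ξ) ∈ ρ.space t := by
    have hh : star d ∈ θ.ideal (s⁻¹)⁻¹ := by rwa [InverseMonoid.inv_inv']
    have := ρ.π_act_mul_v hh
    have h3 := congrArg (fun T : H →L[ℂ] H => T ξ) this
    simp only [mul_apply_eq_comp] at h3
    rw [← h3]
    exact ρ.π_mem hd _
  have h4 := ρ.isPartialAction.map_mul s⁻¹ t⁻¹ (ρ.π (star d) ξ)
  simp only [InverseMonoid.inv_inv'] at h4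
  refine (h4 ⟨ρ.v s⁻¹ (ρ.π (star d) ξ), ⟨ρ.apply_mem _ _, h2⟩, ?_⟩).symm
  exact ρ.isPartialAction.map_map_inv s h1

/-- Multiplicativity of the integrated form on elementary terms. -/
theorem term_mul {s t : S} {a b : A} (ha : a ∈ θ.ideal s) (hb : b ∈ θ.ideal t) :
    (ρ.π a * ρ.v s) * (ρ.π b * ρ.v t) =
      ρ.π (θ.act s (θ.act s⁻¹ a * b)) * ρ.v (s * t) := by
  have hc : θ.act s⁻¹ a * b ∈ θ.ideal s⁻¹ := θ.mul_mem_right _ _ _ (θ.act_inv_mem s a)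
  have hct : θ.act s⁻¹ a * b ∈ θ.ideal t := θ.mul_mem_left _ _ _ hb
  have hd : θ.act s⁻¹ (star (θ.act s (θ.act s⁻¹ a * b))) ∈ θ.ideal t := by
    have h1 : star (θ.act s (θ.act s⁻¹ a * b)) = θ.act s (star (θ.act s⁻¹ a * b)) := by
      rw [θ.act_of_mem hc, θ.act_of_mem (star_mem hc)]
      exact (congrArg Subtype.val (map_star (θ.equiv s) ⟨_, hc⟩)).symm
    rw [h1]
    have h2 := θ.act_act_inv s⁻¹ (star_mem hc)
    rw [InverseMonoid.inv_inv'] at h2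
    rw [h2]
    exact star_mem hct
  rw [← ρ.π_mul_v_mul_v (θ.act_mem _ _) hd, ← mul_assoc (ρ.π (θ.act s _)), ρ.π_act_mul_v hc,
    ρ.π_mul_v ha, map_mul]
  simp only [mul_assoc]

theorem term_star {s : S} {a : A} (ha : a ∈ θ.ideal s) :
    star (ρ.π a * ρ.v s) = ρ.π (θ.act s⁻¹ (star a)) * ρ.v s⁻¹ := by
  rw [star_mul, ρ.star_v, ← map_star]
  have hh : star a ∈ θ.ideal (s⁻¹)⁻¹ := by
    rw [InverseMonoid.inv_inv']; exact star_mem ha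
  rw [ρ.π_act_mul_v hh]

end CovariantRep

/-! ### The crossed product -/

section CrossedProduct

variable {S : Type v} [InverseMonoid S] {A : Type u} [NonUnitalCStarAlgebra A]
    (θ : PartialAction S A)

/-- The finite formal linear combinations `∑ a_s u_s` with `a_s` in the ideal `A_s`. -/
def formalSums : Submodule ℂ (S →₀ A) where
  carrier := {f | ∀ s, f s ∈ θ.ideal s}
  add_mem' hf hg s := add_mem (hf s) (hg s)
  zero_mem' s := zero_mem (θ.ideal s)
  smul_mem' c _ hf s := SMulMemClass.smul_mem c (hf s)

/-- The space `C_c(S, A)`. -/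
def FormalSum : Type (max u v) := formalSums θ

namespace FormalSum

noncomputable instance : AddCommGroup (FormalSum θ) :=
  inferInstanceAs (AddCommGroup (formalSums θ))
noncomputable instance : Module ℂ (FormalSum θ) := inferInstanceAs (Module ℂ (formalSums θ))

variable {θ}

/-- The coefficient function of a formal sum. -/
def coeff (f : FormalSum θ) : S →₀ A := Subtype.val f

theorem coeff_mem (f : FormalSum θ) (s : S) : f.coeff s ∈ θ.ideal s := Subtype.property f s

variable (θ) in
/-- The formal sum `a u_s`. -/
noncomputable def single (s : S) (a : θ.ideal s) : FormalSum θ :=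
  ⟨Finsupp.single s (a : A), fun t => by
    classical
    rw [Finsupp.single_apply]
    split_ifs with h
    · subst h; exact a.2
    · exact zero_mem _⟩

/-- The product determined by `(a u_s)(b u_t) = θ_s(θ_{s⁻¹}(a) b) u_{st}`. -/
noncomputable instance : Mul (FormalSum θ) where
  mul f g := ∑ s ∈ f.coeff.support, ∑ t ∈ g.coeff.support,
    single θ (s * t) ⟨θ.act s (θ.act s⁻¹ (f.coeff s) * g.coeff t),
      θ.act_mem_mul s t (θ.mul_mem_right _ _ _ (θ.act_inv_mem s _))
        (θ.mul_mem_left _ _ _ (g.coeff_mem t))⟩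

/-- The involution determined by `(a u_s)⋆ = θ_{s⁻¹}(a⋆) u_{s⁻¹}`. -/
noncomputable instance : Star (FormalSum θ) where
  star f := ∑ s ∈ f.coeff.support,
    single θ s⁻¹ ⟨θ.act s⁻¹ (star (f.coeff s)), θ.act_mem _ _⟩

theorem coeff_single (s : S) (a : θ.ideal s) : (single θ s a).coeff = Finsupp.single s (a : A) := rfl

theorem single_congr {s : S} {a b : θ.ideal s} (h : (a : A) = b) : single θ s a = single θ s b :=
  congrArg (single θ s) (Subtype.ext h)

theorem single_zero' (s : S) {a : θ.ideal s} (h : (a : A) = 0) : single θ s a = 0 :=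
  Subtype.ext (show Finsupp.single s (a : A) = 0 by rw [h, Finsupp.single_zero])

theorem support_eq_empty (s : S) {a : θ.ideal s} (h : (a : A) = 0) :
    (single θ s a).coeff.support = ∅ := by
  rw [coeff_single, h, Finsupp.single_zero, Finsupp.support_zero]

theorem support_eq_singleton (s : S) {a : θ.ideal s} (h : (a : A) ≠ 0) :
    (single θ s a).coeff.support = {s} := by
  rw [coeff_single, Finsupp.support_single _ h]

theorem single_mul_single (s t : S) (a : θ.ideal s) (b : θ.ideal t) :
    single θ s a * single θ t b = single θ (s * t) ⟨θ.act s (θ.act s⁻¹ a * b),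
      θ.act_mem_mul s t (θ.mul_mem_right _ _ _ (θ.act_inv_mem s _))
        (θ.mul_mem_left _ _ _ b.2)⟩ := by
  classical
  change ∑ s' ∈ (single θ s a).coeff.support, ∑ t' ∈ (single θ t b).coeff.support, _ = _
  have h0 : ∀ r, θ.act r 0 = 0 := fun r => by
    rw [θ.act_of_mem (zero_mem _)]
    exact congrArg Subtype.val (map_zero (θ.equiv r))
  by_cases ha : (a : A) = 0
  · rw [support_eq_empty s ha, Finset.sum_empty]
    exact (single_zero' _ (by simp [ha, h0])).symm
  by_cases hb : (b : A) = 0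
  · rw [support_eq_empty t hb]
    simp only [Finset.sum_empty, Finset.sum_const_zero]
    exact (single_zero' _ (by simp [hb, h0])).symm
  rw [support_eq_singleton s ha, support_eq_singleton t hb, Finset.sum_singleton,
    Finset.sum_singleton]
  exact single_congr (by simp [coeff_single])

theorem star_single (s : S) (a : θ.ideal s) :
    star (single θ s a) = single θ s⁻¹ ⟨θ.act s⁻¹ (star (a : A)), θ.act_mem _ _⟩ := by
  classical
  change ∑ s' ∈ (single θ s a).coeff.support, _ = _
  by_cases ha : (a : A) = 0
  · rw [support_eq_empty s ha, Finset.sum_empty]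
    refine (single_zero' _ ?_).symm
    simp only [ha, star_zero]
    rw [θ.act_of_mem (zero_mem _)]
    exact congrArg Subtype.val (map_zero (θ.equiv s⁻¹))
  rw [support_eq_singleton s ha, Finset.sum_singleton]
  exact single_congr (by simp [coeff_single])

end FormalSum

/-- The integrated form `π ⋊ v : ∑ a_s u_s ↦ ∑ π(a_s) v_s` of a covariant representation. -/
noncomputable def CovariantRep.integrated {θ : PartialAction S A} {H : Type w}
    [NormedAddCommGroup H] [InnerProductSpace ℂ H] [CompleteSpace H] (ρ : CovariantRep θ H) :
    FormalSum θ →ₗ[ℂ] (H →L[ℂ] H) where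
  toFun f := f.coeff.sum fun s a => ρ.π a * ρ.v s
  map_add' f g := by
    exact Finsupp.sum_add_index' (f := f.coeff) (g := g.coeff)
      (h := fun s a => ρ.π a * ρ.v s) (by simp) (by simp [add_mul])
  map_smul' c f := by
    change Finsupp.sum (c • f.coeff) _ = _
    rw [Finsupp.sum_smul_index' (by simp)]
    simp [Finsupp.sum, Finset.smul_sum]

namespace CovariantRep

variable {θ} {H : Type w} [NormedAddCommGroup H] [InnerProductSpace ℂ H] [CompleteSpace H]
    (ρ : CovariantRep θ H)

theorem integrated_apply (f : FormalSum θ) :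
    ρ.integrated f = f.coeff.sum fun s a => ρ.π a * ρ.v s := rfl

theorem integrated_single (s : S) (a : θ.ideal s) :
    ρ.integrated (FormalSum.single θ s a) = ρ.π a * ρ.v s :=
  Finsupp.sum_single_index (a := s) (b := (a : A)) (h := fun s a => ρ.π a * ρ.v s) (by simp)

theorem integrated_mul (f g : FormalSum θ) :
    ρ.integrated (f * g) = ρ.integrated f * ρ.integrated g := by
  change ρ.integrated (∑ s ∈ f.coeff.support, ∑ t ∈ g.coeff.support, _) = _
  simp only [map_sum, integrated_single]
  simp only [integrated_apply, Finsupp.sum, Finset.sum_mul_sum]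
  refine Finset.sum_congr rfl fun s _ => Finset.sum_congr rfl fun t _ => ?_
  exact (ρ.term_mul (f.coeff_mem s) (g.coeff_mem t)).symm

theorem integrated_star (f : FormalSum θ) :
    ρ.integrated (star f) = star (ρ.integrated f) := by
  change ρ.integrated (∑ s ∈ f.coeff.support, _) = _
  simp only [map_sum, integrated_single]
  simp only [integrated_apply, Finsupp.sum, star_sum]
  exact Finset.sum_congr rfl fun s _ => (ρ.term_star (f.coeff_mem s)).symm

theorem norm_integrated_le (f : FormalSum θ) :
    ‖ρ.integrated f‖ ≤ ∑ s ∈ f.coeff.support, ‖f.coeff s‖ := by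
  refine (norm_sum_le _ _).trans (Finset.sum_le_sum fun s _ => ?_)
  refine (norm_mul_le _ _).trans ?_
  calc ‖ρ.π (f.coeff s)‖ * ‖ρ.v s‖ ≤ ‖f.coeff s‖ * 1 :=
        mul_le_mul (NonUnitalStarAlgHom.norm_apply_le ρ.π _) (ρ.norm_le_one s)
          (norm_nonneg _) (norm_nonneg _)
    _ = _ := mul_one _

end CovariantRep

/-- The `ℓ^∞`-product of a family of C⋆-algebras. -/
def LinftyProd {ι : Type w} (B : ι → Type u) [∀ i, CStarAlgebra (B i)] : Type (max w u) := lp B ∞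

namespace LinftyProd

variable {ι : Type w} {B : ι → Type u} [∀ i, CStarAlgebra (B i)]

noncomputable instance : NonUnitalCStarAlgebra (LinftyProd B) where
  __ := (inferInstance : NonUnitalNormedRing (lp B ∞))
  __ := (inferInstance : StarRing (lp B ∞))
  __ := (inferInstance : NormedSpace ℂ (lp B ∞))
  __ := (inferInstance : CompleteSpace (lp B ∞))
  __ := (inferInstance : CStarRing (lp B ∞))
  __ := (inferInstance : IsScalarTower ℂ (lp B ∞) (lp B ∞))
  __ := (inferInstance : SMulCommClass ℂ (lp B ∞) (lp B ∞))
  __ := (inferInstance : StarModule ℂ (lp B ∞))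

/-- The element with given coordinates. -/
def mk (x : ∀ i, B i) (h : BddAbove (Set.range fun i => ‖x i‖)) : LinftyProd B :=
  ⟨x, memℓp_infty h⟩

/-- The coordinates of an element. -/
def coord (x : LinftyProd B) (i : ι) : B i := Subtype.val x i

theorem ext {x y : LinftyProd B} (h : ∀ i, x.coord i = y.coord i) : x = y :=
  Subtype.ext (funext h)

end LinftyProd

/-- A Hilbert space together with a covariant representation on it. The universe is large enough
for every cyclic representation of `C_c(S, A)`. -/
structure BundledCovariantRep where
  H : Type (max u v)
  [normedAddCommGroup : NormedAddCommGroup H]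
  [innerProductSpace : InnerProductSpace ℂ H]
  [completeSpace : CompleteSpace H]
  rep : CovariantRep θ H

attribute [instance] BundledCovariantRep.normedAddCommGroup
  BundledCovariantRep.innerProductSpace BundledCovariantRep.completeSpace

/-- The operators on the Hilbert space of a covariant representation. -/
abbrev BundledCovariantRep.Op {θ : PartialAction S A} (ρ : BundledCovariantRep.{u, v} θ) :
    Type (max u v) := ρ.H →L[ℂ] ρ.H

/-- The `ℓ^∞`-product of the algebras `B(H)` over all covariant representations. -/
abbrev RepProd := LinftyProd fun ρ : BundledCovariantRep.{u, v} θ => ρ.Op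

namespace FormalSum

variable {θ}

theorem bddAbove_norm (f : FormalSum θ) :
    BddAbove (Set.range fun ρ : BundledCovariantRep.{u, v} θ => ‖ρ.rep.integrated f‖) :=
  ⟨∑ s ∈ f.coeff.support, ‖f.coeff s‖, by
    rintro _ ⟨ρ, rfl⟩
    exact ρ.rep.norm_integrated_le f⟩

variable (θ) in
/-- The direct sum of all integrated forms. -/
noncomputable def toProd :
    FormalSum θ →ₗ[ℂ] RepProd θ where
  toFun f := LinftyProd.mk (fun ρ => ρ.rep.integrated f) f.bddAbove_norm
  map_add' f g := LinftyProd.ext fun ρ => map_add ρ.rep.integrated f g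
  map_smul' c f := LinftyProd.ext fun ρ => map_smul ρ.rep.integrated c f

noncomputable instance : SeminormedAddCommGroup (FormalSum θ) :=
  SeminormedAddCommGroup.induced _ _ (toProd θ)

/-- The seminorm on `C_c(S, A)` is the supremum over all covariant representations. -/
theorem norm_def (f : FormalSum θ) :
    ‖f‖ = ⨆ ρ : BundledCovariantRep.{u, v} θ, ‖ρ.rep.integrated f‖ := rfl

noncomputable instance : NormedSpace ℂ (FormalSum θ) :=
  NormedSpace.induced _ _ _ (toProd θ)

theorem toProd_mul (f g : FormalSum θ) : toProd θ (f * g) = toProd θ f * toProd θ g :=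
  LinftyProd.ext fun ρ => ρ.rep.integrated_mul f g

theorem toProd_star (f : FormalSum θ) : toProd θ (star f) = star (toProd θ f) :=
  LinftyProd.ext fun ρ => ρ.rep.integrated_star f

variable (θ) in
/-- `toProd` as a linear isometry. -/
noncomputable def toProdLI :
    FormalSum θ →ₗᵢ[ℂ] RepProd θ where
  toLinearMap := toProd θ
  norm_map' _ := rfl

end FormalSum

/-- The crossed product `A ⋊ S`: the Hausdorff completion of `C_c(S, A)`. -/
def CrossedProduct : Type (max u v) := UniformSpace.Completion (FormalSum θ)

namespace CrossedProduct

noncomputable instance : NormedAddCommGroup (CrossedProduct θ) :=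
  inferInstanceAs (NormedAddCommGroup (UniformSpace.Completion (FormalSum θ)))
noncomputable instance : NormedSpace ℂ (CrossedProduct θ) :=
  inferInstanceAs (NormedSpace ℂ (UniformSpace.Completion (FormalSum θ)))
instance : CompleteSpace (CrossedProduct θ) :=
  inferInstanceAs (CompleteSpace (UniformSpace.Completion (FormalSum θ)))

variable {θ}

variable (θ) in
/-- The canonical map `C_c(S, A) → A ⋊ S`. -/
noncomputable def of : FormalSum θ →ₗᵢ[ℂ] CrossedProduct θ :=
  UniformSpace.Completion.toComplₗᵢ

theorem denseRange_of : DenseRange (of θ) := UniformSpace.Completion.denseRange_coe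

variable (θ) in
/-- The isometric embedding of `A ⋊ S` into the product of all `B(H)`. -/
noncomputable def toProd :
    CrossedProduct θ →L[ℂ] RepProd θ :=
  (FormalSum.toProdLI θ).toContinuousLinearMap.extend (of θ).toContinuousLinearMap

theorem toProd_of (f : FormalSum θ) : toProd θ (of θ f) = FormalSum.toProd θ f :=
  ContinuousLinearMap.extend_eq (f := (FormalSum.toProdLI θ).toContinuousLinearMap)
    (e := (of θ).toContinuousLinearMap) denseRange_of (of θ).isometry.isUniformInducing f

theorem norm_toProd (x : CrossedProduct θ) : ‖toProd θ x‖ = ‖x‖ := by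
  refine denseRange_of.induction_on (p := fun x => ‖toProd θ x‖ = ‖x‖) x
    (isClosed_eq (toProd θ).continuous.norm continuous_norm) (fun f => ?_)
  rw [toProd_of, (of θ).norm_map]
  rfl

theorem isometry_toProd : Isometry (toProd θ) :=
  AddMonoidHomClass.isometry_of_norm _ norm_toProd

theorem isClosed_range_toProd : IsClosed (Set.range (toProd θ)) :=
  isometry_toProd.isClosedEmbedding.isClosed_range

theorem exists_mul (x y : CrossedProduct θ) : ∃ z, toProd θ z = toProd θ x * toProd θ y := by
  refine denseRange_of.induction_on₂ (p := fun x y => ∃ z, toProd θ z = toProd θ x * toProd θ y)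
    ?_ (fun f g => ⟨of θ (f * g), by simp only [toProd_of, FormalSum.toProd_mul]⟩) x y
  have hc : Continuous fun p : CrossedProduct θ × CrossedProduct θ =>
      toProd θ p.1 * toProd θ p.2 :=
    ((toProd θ).continuous.comp continuous_fst).mul ((toProd θ).continuous.comp continuous_snd)
  exact isClosed_range_toProd.preimage hc

theorem exists_star (x : CrossedProduct θ) : ∃ z, toProd θ z = star (toProd θ x) := by
  refine denseRange_of.induction_on (p := fun x => ∃ z, toProd θ z = star (toProd θ x)) x
    ?_ (fun f => ⟨of θ (star f), by simp only [toProd_of, FormalSum.toProd_star]⟩)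
  exact isClosed_range_toProd.preimage (toProd θ).continuous.star

noncomputable instance : Mul (CrossedProduct θ) where
  mul x y := (exists_mul x y).choose
noncomputable instance : Star (CrossedProduct θ) where
  star x := (exists_star x).choose

theorem toProd_mul (x y : CrossedProduct θ) : toProd θ (x * y) = toProd θ x * toProd θ y :=
  (exists_mul x y).choose_spec
theorem toProd_star (x : CrossedProduct θ) : toProd θ (star x) = star (toProd θ x) :=
  (exists_star x).choose_spec

theorem toProd_injective : Function.Injective (toProd θ) := isometry_toProd.injective

/-- The product on `A ⋊ S` extends the one on `C_c(S, A)`. -/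
theorem of_mul (f g : FormalSum θ) : of θ (f * g) = of θ f * of θ g :=
  toProd_injective (by simp only [toProd_mul, toProd_of, FormalSum.toProd_mul])

/-- The involution on `A ⋊ S` extends the one on `C_c(S, A)`. -/
theorem of_star (f : FormalSum θ) : of θ (star f) = star (of θ f) :=
  toProd_injective (by simp only [toProd_star, toProd_of, FormalSum.toProd_star])

noncomputable instance : NonUnitalNormedRing (CrossedProduct θ) where
  __ := (inferInstance : NormedAddCommGroup (CrossedProduct θ))
  left_distrib a b c := toProd_injective (by simp only [toProd_mul, map_add, mul_add])
  right_distrib a b c := toProd_injective (by simp only [toProd_mul, map_add, add_mul])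
  zero_mul a := toProd_injective (by simp only [toProd_mul, map_zero, zero_mul])
  mul_zero a := toProd_injective (by simp only [toProd_mul, map_zero, mul_zero])
  mul_assoc a b c := toProd_injective (by simp only [toProd_mul, mul_assoc])
  norm_mul_le a b := by
    simp only [← norm_toProd, toProd_mul]
    exact norm_mul_le _ _

noncomputable instance : StarRing (CrossedProduct θ) where
  star_involutive a := toProd_injective (by simp only [toProd_star, star_star])
  star_mul a b := toProd_injective (by simp only [toProd_star, toProd_mul, star_mul])
  star_add a b := toProd_injective (by simp only [toProd_star, map_add, star_add])

noncomputable instance : NonUnitalCStarAlgebra (CrossedProduct θ) where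
  __ := (inferInstance : NonUnitalNormedRing (CrossedProduct θ))
  __ := (inferInstance : StarRing (CrossedProduct θ))
  __ := (inferInstance : NormedSpace ℂ (CrossedProduct θ))
  __ := (inferInstance : CompleteSpace (CrossedProduct θ))
  norm_mul_self_le a := by
    simp only [← norm_toProd, toProd_star, toProd_mul]
    exact CStarRing.norm_mul_self_le _
  smul_assoc c a b := toProd_injective (by
    simp only [smul_eq_mul, toProd_mul, map_smul, smul_mul_assoc])
  smul_comm c a b := toProd_injective (by
    simp only [smul_eq_mul, toProd_mul, map_smul, mul_smul_comm])
  star_smul c a := toProd_injective (by simp only [toProd_star, map_smul, star_smul])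

variable (θ) in
/-- The element `a u_s` of `A ⋊ S`. -/
noncomputable def single (s : S) (a : θ.ideal s) : CrossedProduct θ := of θ (FormalSum.single θ s a)

end CrossedProduct

end CrossedProduct

/-! ### The enveloping von Neumann algebra -/

/-- The direct sum of a uniformly bounded family of operators. -/
noncomputable def directSumOp {ι : Type w} {G : ι → Type w} [∀ i, NormedAddCommGroup (G i)]
    [∀ i, InnerProductSpace ℂ (G i)] (T : ∀ i, G i →L[ℂ] G i) (C : ℝ) (hC : ∀ i, ‖T i‖ ≤ C) :
    lp G 2 →L[ℂ] lp G 2 :=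
  have hb : ∀ (x : lp G 2) i, ‖T i (x i)‖ ≤ ‖((C : ℂ) • x) i‖ := fun x i => by
    rw [lp.coeFn_smul, Pi.smul_apply, norm_smul, Complex.norm_real]
    exact ((T i).le_of_opNorm_le (hC i) _).trans
      (mul_le_mul_of_nonneg_right (le_abs_self C) (norm_nonneg _))
  have hm : ∀ x : lp G 2, Memℓp (fun i => T i (x i)) 2 := fun x =>
    (lp.memℓp ((C : ℂ) • x)).mono' (hb x)
  LinearMap.mkContinuous
    { toFun := fun x => ⟨fun i => T i (x i), hm x⟩
      map_add' := fun x y => lp.ext (funext fun i => map_add (T i) (x i) (y i))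
      map_smul' := fun c x => lp.ext (funext fun i => map_smul (T i) c (x i)) } |C| fun x => by
    refine (lp.norm_mono two_ne_zero (y := (C : ℂ) • x) (hb x)).trans ?_
    rw [norm_smul, Complex.norm_real, Real.norm_eq_abs]

theorem directSumOp_apply {ι : Type w} {G : ι → Type w} [∀ i, NormedAddCommGroup (G i)]
    [∀ i, InnerProductSpace ℂ (G i)] (T : ∀ i, G i →L[ℂ] G i) (C : ℝ) (hC : ∀ i, ‖T i‖ ≤ C)
    (x : lp G 2) (i : ι) : directSumOp T C hC x i = T i (x i) := rfl

section Enveloping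

open scoped ComplexOrder

attribute [local instance] CStarAlgebra.spectralOrder CStarAlgebra.spectralOrderedRing

variable (A : Type u) [NonUnitalCStarAlgebra A]

/-- The universal Hilbert space of a C⋆-algebra: the Hilbert sum of the GNS spaces of all positive
linear functionals. -/
abbrev UniversalSpace : Type u := lp (fun f : A →ₚ[ℂ] ℂ => f.GNS) 2

/-- The universal representation: the direct sum of the GNS representations of all positive
linear functionals. -/
noncomputable def universalRep : A →⋆ₙₐ[ℂ] (UniversalSpace A →L[ℂ] UniversalSpace A) where
  toFun a := directSumOp (fun f => f.gnsNonUnitalStarAlgHom a) ‖a‖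
    fun f => NonUnitalStarAlgHom.norm_apply_le f.gnsNonUnitalStarAlgHom a
  map_zero' := by
    refine ContinuousLinearMap.ext fun x => lp.ext (funext fun f => ?_)
    rw [directSumOp_apply, map_zero]; rfl
  map_add' a b := by
    refine ContinuousLinearMap.ext fun x => lp.ext (funext fun f => ?_)
    rw [directSumOp_apply, map_add]; rfl
  map_smul' c a := by
    refine ContinuousLinearMap.ext fun x => lp.ext (funext fun f => ?_)
    rw [directSumOp_apply, map_smul]; rfl
  map_mul' a b := by
    refine ContinuousLinearMap.ext fun x => lp.ext (funext fun f => ?_)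
    rw [directSumOp_apply, map_mul]; rfl
  map_star' a := by
    rw [ContinuousLinearMap.star_eq_adjoint, ContinuousLinearMap.eq_adjoint_iff]
    intro x y
    rw [lp.inner_eq_tsum, lp.inner_eq_tsum]
    refine tsum_congr fun f => ?_
    rw [directSumOp_apply, directSumOp_apply, map_star, ContinuousLinearMap.star_eq_adjoint,
      ContinuousLinearMap.adjoint_inner_left]

end Enveloping

section Bidual

variable (A : Type u) [NonUnitalCStarAlgebra A]

/-- The commutant of the universal representation. -/
noncomputable def universalCommutant : VonNeumannAlgebra (UniversalSpace A) where
  toStarSubalgebra := StarSubalgebra.centralizer ℂ (Set.range (universalRep A))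
  centralizer_centralizer' := by simp

/-- The enveloping von Neumann algebra of `A`: the bicommutant of its universal representation. -/
noncomputable def envelopingVonNeumannAlgebra : VonNeumannAlgebra (UniversalSpace A) :=
  (universalCommutant A).commutant

theorem coe_envelopingVonNeumannAlgebra : (envelopingVonNeumannAlgebra A : Set (UniversalSpace A →L[ℂ] UniversalSpace A)) =
    Set.centralizer (Set.centralizer (Set.range (universalRep A))) := by
  have h : star (Set.range (universalRep A)) = Set.range (universalRep A) := by
    ext x
    constructor
    · rintro ⟨a, ha⟩
      exact ⟨star a, by rw [map_star, ha, star_star]⟩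
    · rintro ⟨a, rfl⟩
      exact ⟨star a, map_star _ _⟩
  rw [envelopingVonNeumannAlgebra, VonNeumannAlgebra.coe_commutant]
  change Set.centralizer (StarSubalgebra.centralizer ℂ (Set.range (universalRep A)) : Set (UniversalSpace A →L[ℂ] UniversalSpace A)) = _
  rw [StarSubalgebra.coe_centralizer, h, Set.union_self]

instance : IsClosed ((envelopingVonNeumannAlgebra A).toStarSubalgebra : Set
    (UniversalSpace A →L[ℂ] UniversalSpace A)) := by
  change IsClosed (envelopingVonNeumannAlgebra A : Set (UniversalSpace A →L[ℂ] UniversalSpace A))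
  rw [coe_envelopingVonNeumannAlgebra]
  exact Set.isClosed_centralizer _

/-- The C⋆-algebra `A**`, i.e. the enveloping von Neumann algebra of `A`. -/
def Bidual : Type u := (envelopingVonNeumannAlgebra A).toStarSubalgebra

noncomputable instance : CStarAlgebra (Bidual A) :=
  inferInstanceAs (CStarAlgebra (envelopingVonNeumannAlgebra A).toStarSubalgebra)

/-- The inclusion of `A**` into the operators on the universal Hilbert space. -/
noncomputable def Bidual.subtype : Bidual A →⋆ₐ[ℂ] (UniversalSpace A →L[ℂ] UniversalSpace A) :=
  (envelopingVonNeumannAlgebra A).toStarSubalgebra.subtype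

variable {A}

/-- The canonical inclusion `A → A**`. -/
noncomputable def toBidual : A →⋆ₙₐ[ℂ] Bidual A where
  toFun a := ⟨universalRep A a, by
    change _ ∈ (envelopingVonNeumannAlgebra A : Set (UniversalSpace A →L[ℂ] UniversalSpace A))
    rw [coe_envelopingVonNeumannAlgebra]
    exact Set.subset_centralizer_centralizer ⟨a, rfl⟩⟩
  map_zero' := Subtype.ext (map_zero _)
  map_add' a b := Subtype.ext (map_add _ a b)
  map_smul' c a := Subtype.ext (map_smul _ c a)
  map_mul' a b := Subtype.ext (map_mul _ a b)
  map_star' a := Subtype.ext (map_star _ a)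

theorem Bidual.subtype_toBidual (a : A) : Bidual.subtype A (toBidual a) = universalRep A a := rfl

/-- The ultraweak topology on `B(H)`: the initial topology of the functionals
`T ↦ ∑ ⟪ξ_n, T η_n⟫` for square-summable sequences `ξ`, `η`. -/
@[reducible]
noncomputable def ultraweakTopology (H : Type w) [NormedAddCommGroup H] [InnerProductSpace ℂ H] :
    TopologicalSpace (H →L[ℂ] H) :=
  ⨅ p : lp (fun _ : ℕ => H) 2 × lp (fun _ : ℕ => H) 2,
    TopologicalSpace.induced (fun T => ∑' n, inner ℂ (p.1 n) (T (p.2 n))) inferInstance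

variable (A) in
/-- The ultraweak topology of `A**`. -/
@[reducible]
noncomputable def Bidual.ultraweak : TopologicalSpace (Bidual A) :=
  (ultraweakTopology (UniversalSpace A)).induced (Bidual.subtype A)

/-- The ultraweak topology of `A**`, restricted to a subalgebra. -/
@[reducible]
noncomputable def Bidual.ultraweakOn (I : NonUnitalStarSubalgebra ℂ (Bidual A)) : TopologicalSpace I :=
  (Bidual.ultraweak A).induced Subtype.val

/-- `θ''` is the extension `θ**` of the partial action `θ` to `A**`: the ideal of `θ''` at `s` is
the ultraweak closure of `A_s` in `A**`, it is the enveloping von Neumann algebra of `A_s` (by an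
ultraweakly bicontinuous `⋆`-isomorphism compatible with the inclusions of `A_s`), and `θ''_s` is
an ultraweakly continuous extension of `θ_s`. -/
structure IsBidualAction {S : Type v} [InverseMonoid S] (θ : PartialAction S A)
    (θ'' : PartialAction S (Bidual A)) : Prop where
  ideal_eq_closure : ∀ s, (θ''.ideal s : Set (Bidual A)) =
    closure[Bidual.ultraweak A] (toBidual '' (θ.ideal s : Set A))
  ideal_equiv : ∀ s, ∃ e : Bidual (θ.ideal s) ≃⋆ₐ[ℂ] θ''.ideal s,
    Continuous[Bidual.ultraweak (θ.ideal s), Bidual.ultraweakOn (θ''.ideal s)] e ∧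
    Continuous[Bidual.ultraweakOn (θ''.ideal s), Bidual.ultraweak (θ.ideal s)] e.symm ∧
    ∀ a : θ.ideal s, (e (toBidual a) : Bidual A) = toBidual (a : A)
  normal : ∀ s, Continuous[Bidual.ultraweakOn (θ''.ideal s⁻¹), Bidual.ultraweakOn (θ''.ideal s)]
    (θ''.equiv s)
  equiv_extends : ∀ s (a : θ.ideal s⁻¹) (h : toBidual (a : A) ∈ θ''.ideal s⁻¹),
    (θ''.equiv s ⟨toBidual (a : A), h⟩ : Bidual A) = toBidual (θ.equiv s a : A)

theorem IsBidualAction.toBidual_mem {S : Type v} [InverseMonoid S] {θ : PartialAction S A}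
    {θ'' : PartialAction S (Bidual A)} (h : IsBidualAction θ θ'') {s : S} (a : θ.ideal s) :
    toBidual (a : A) ∈ θ''.ideal s := by
  obtain ⟨e, -, -, he⟩ := h.ideal_equiv s
  rw [← he a]
  exact (e (toBidual a)).2

end Bidual

/-! The engine is that the universal representation of `A` implements every vector of every
representation: for `π` on `H` and `ξ ∈ H`, the GNS space of `⟪ξ, π(·)ξ⟫` is a summand of the
universal space, which yields an intertwiner `W` and a vector `ω` with `W(aω) = π(a)ξ`
(`exists_intertwiner`). Applied to an amplification of the universal representation, this replaces a
square-summable sequence by one vector. Hence the ultraweak topology on `A**` is given by vector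
functionals, and every `x ∈ A**` is a strong limit of elements of `A`. Applied to an arbitrary `π`,
it gives a normal extension of `π` to `A**` (`Bidual.liftRep`). From then on, identities known on
`A`, or on an ideal of `A`, pass to ultraweak closures by continuity.

For part 1, left multiplication of `A` on a closed ideal `J` gives `A → M(J) ⊆ J**`. Its normal
extension `A** → J**` (`IsIdealEmbedding.retract`) inverts the normal extension of the inclusion on
the closure of `J`, so that closure is `J**`. Composing the retraction onto `(A_{s⁻¹})**` with the
normal extension of `θ_s` gives a normal endomorphism of `A**` extending `θ_s`. The partial action
axioms extend by density because `A_s ∩ A_t` is dense in `(A**)_s ∩ (A**)_t`, thanks to the unit of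
`(A_s)**` (`PartialAction.bidualIdeal_inter`). Uniqueness is density again.

For part 2, `CovariantData` isolates what makes a covariant representation: contractions `T s` whose
relations are tested only against operators `π(a)`; cutting them off by projections gives genuine
partial isometries. To obtain `ι`, a covariant representation of `A**`, not assumed normal, is
compressed to the closed span of `π(A)H`. This gives a covariant representation of `A` without loss
of norm on sums with coefficients in `A` (`CovariantRep.norm_integrated_mapBidual_le`).

To obtain `Φ`, the universal representation of `A ⋊ S` is disintegrated into a representation of `A`
and operators `v_s`, which are multipliers (`CrossedProduct.covariantData`). Extending the
representation of `A` normally and keeping the same `v_s` preserves covariance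
(`CovariantData.liftRep`). The new integrated form takes values in the bicommutant `(A ⋊ S)**` and
restricts to the universal representation. -/

open Filter

set_option linter.style.haveILetI false

/-! ### Approximate units and representations on Hilbert spaces -/

section ApproximateUnit

variable {A : Type u} [NonUnitalCStarAlgebra A]

/-- The canonical approximate unit of a C⋆-algebra, as a filter. -/
noncomputable def approxUnit (A : Type u) [NonUnitalCStarAlgebra A] : Filter A :=
  letI := CStarAlgebra.spectralOrder A
  letI := CStarAlgebra.spectralOrderedRing A
  CStarAlgebra.approximateUnit A

instance : (approxUnit A).NeBot :=
  letI := CStarAlgebra.spectralOrder A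
  letI := CStarAlgebra.spectralOrderedRing A
  (CStarAlgebra.increasingApproximateUnit A).neBot

theorem tendsto_approxUnit_mul (a : A) : Tendsto (fun e => e * a) (approxUnit A) (𝓝 a) :=
  letI := CStarAlgebra.spectralOrder A
  letI := CStarAlgebra.spectralOrderedRing A
  (CStarAlgebra.increasingApproximateUnit A).tendsto_mul_right a

theorem tendsto_mul_approxUnit (a : A) : Tendsto (fun e => a * e) (approxUnit A) (𝓝 a) :=
  letI := CStarAlgebra.spectralOrder A
  letI := CStarAlgebra.spectralOrderedRing A
  (CStarAlgebra.increasingApproximateUnit A).tendsto_mul_left a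

theorem eventually_approxUnit_norm_le : ∀ᶠ e in approxUnit A, ‖e‖ ≤ 1 :=
  letI := CStarAlgebra.spectralOrder A
  letI := CStarAlgebra.spectralOrderedRing A
  (CStarAlgebra.increasingApproximateUnit A).eventually_norm

end ApproximateUnit

section Extension

variable {H : Type w} [NormedAddCommGroup H] [InnerProductSpace ℂ H] [CompleteSpace H]
variable {A : Type u} [NonUnitalCStarAlgebra A]

theorem continuous_hom (π : A →⋆ₙₐ[ℂ] (H →L[ℂ] H)) : Continuous π :=
  (AddMonoidHomClass.lipschitz_of_bound π 1 fun a => by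
    simpa using NonUnitalStarAlgHom.norm_apply_le π a).continuous

theorem inner_hom_left (π : A →⋆ₙₐ[ℂ] (H →L[ℂ] H)) (a : A) (ξ η : H) :
    inner ℂ (π a ξ) η = inner ℂ ξ (π (star a) η) := by
  rw [map_star, ContinuousLinearMap.star_eq_adjoint, ContinuousLinearMap.adjoint_inner_right]

/-! ### GNS spaces and the universality of the universal representation. -/

section GNS

open scoped ComplexOrder

attribute [local instance] CStarAlgebra.spectralOrder CStarAlgebra.spectralOrderedRing

/-- The positive functional `a ↦ ⟪ξ, π(a) ξ⟫`. -/
noncomputable def vectorFunctional (π : A →⋆ₙₐ[ℂ] (H →L[ℂ] H)) (ξ : H) : A →ₚ[ℂ] ℂ :=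
  PositiveLinearMap.mk₀
    { toFun := fun a => inner ℂ ξ (π a ξ)
      map_add' := by simp
      map_smul' := by simp } fun a ha => by
    obtain ⟨b, rfl⟩ := CStarAlgebra.nonneg_iff_eq_star_mul_self.mp ha
    change 0 ≤ inner ℂ ξ (π (star b * b) ξ)
    rw [map_mul, mul_apply_eq_comp, ← inner_hom_left]
    rw [inner_self_eq_norm_sq_to_K]
    exact Complex.zero_le_real.mpr (sq_nonneg ‖π b ξ‖) |>.trans_eq (by simp)

theorem vectorFunctional_apply (π : A →⋆ₙₐ[ℂ] (H →L[ℂ] H)) (ξ : H) (a : A) :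
    vectorFunctional π ξ a = inner ℂ ξ (π a ξ) := rfl

/-- The isometry `a ↦ π(a) ξ` on the GNS space of `⟪ξ, π(·) ξ⟫`. -/
noncomputable def preGNSToRep (π : A →⋆ₙₐ[ℂ] (H →L[ℂ] H)) (ξ : H) :
    (vectorFunctional π ξ).PreGNS →ₗᵢ[ℂ] H where
  toFun a := π ((vectorFunctional π ξ).ofPreGNS a) ξ
  map_add' a b := by simp
  map_smul' c a := by simp
  norm_map' a := by
    have h := (vectorFunctional π ξ).preGNS_norm_sq a
    rw [vectorFunctional_apply, map_mul, mul_apply_eq_comp, ← inner_hom_left,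
      inner_self_eq_norm_sq_to_K] at h
    have h' : ‖a‖ ^ 2 = ‖π ((vectorFunctional π ξ).ofPreGNS a) ξ‖ ^ 2 := by
      exact Complex.ofReal_injective (by simpa using h)
    exact ((sq_eq_sq₀ (norm_nonneg _) (norm_nonneg _)).mp h').symm

/-- The isometry from the GNS space of `⟪ξ, π(·) ξ⟫`. -/
noncomputable def gnsToRep (π : A →⋆ₙₐ[ℂ] (H →L[ℂ] H)) (ξ : H) :
    (vectorFunctional π ξ).GNS →L[ℂ] H :=
  (preGNSToRep π ξ).toContinuousLinearMap.extend UniformSpace.Completion.toComplL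

theorem gnsToRep_coe (π : A →⋆ₙₐ[ℂ] (H →L[ℂ] H)) (ξ : H) (a : (vectorFunctional π ξ).PreGNS) :
    gnsToRep π ξ a = π ((vectorFunctional π ξ).ofPreGNS a) ξ :=
  ContinuousLinearMap.extend_eq (f := (preGNSToRep π ξ).toContinuousLinearMap)
    (e := UniformSpace.Completion.toComplL) UniformSpace.Completion.denseRange_coe
    (UniformSpace.Completion.isUniformInducing_coe _) a

theorem norm_gnsToRep_le (π : A →⋆ₙₐ[ℂ] (H →L[ℂ] H)) (ξ : H) : ‖gnsToRep π ξ‖ ≤ 1 := by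
  refine ContinuousLinearMap.opNorm_le_bound _ zero_le_one fun x => ?_
  induction x using UniformSpace.Completion.induction_on with
  | hp => exact isClosed_le (by fun_prop) (by fun_prop)
  | ih a =>
    rw [gnsToRep_coe, one_mul, UniformSpace.Completion.norm_coe]
    exact ((preGNSToRep π ξ).norm_map a).le

theorem gnsToRep_gns (π : A →⋆ₙₐ[ℂ] (H →L[ℂ] H)) (ξ : H) (a : A) (x) :
    gnsToRep π ξ ((vectorFunctional π ξ).gnsNonUnitalStarAlgHom a x) = π a (gnsToRep π ξ x) := by
  induction x using UniformSpace.Completion.induction_on with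
  | hp => exact isClosed_eq (by fun_prop) (by fun_prop)
  | ih b =>
    rw [PositiveLinearMap.gnsNonUnitalStarAlgHom_apply_coe, gnsToRep_coe, gnsToRep_coe]
    simp

/-- Without a unit in `A` there is no class of `1` in the GNS space. The image of `ξ` under the
adjoint of the isometry replaces it as cyclic vector, as pairing with the dense set of classes of
`b` shows: `⟪b, a V*ξ⟫ = ⟪π(a*b)ξ, ξ⟫ = ⟪ξ, π(b*a)ξ⟫`. -/
theorem gns_adjoint_gnsToRep (π : A →⋆ₙₐ[ℂ] (H →L[ℂ] H)) (ξ : H) (a : A) :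
    (vectorFunctional π ξ).gnsNonUnitalStarAlgHom a ((gnsToRep π ξ).adjoint ξ) =
      ((vectorFunctional π ξ).toPreGNS a : (vectorFunctional π ξ).GNS) := by
  refine ext_inner_left ℂ fun x => ?_
  induction x using UniformSpace.Completion.induction_on with
  | hp => exact isClosed_eq (by fun_prop) (by fun_prop)
  | ih b =>
    rw [← star_star a, ← inner_hom_left, ContinuousLinearMap.adjoint_inner_right, gnsToRep_gns,
      gnsToRep_coe, UniformSpace.Completion.inner_coe, PositiveLinearMap.preGNS_inner_def,
      vectorFunctional_apply, star_star, ← mul_apply_eq_comp, ← map_mul, inner_hom_left]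
    simp

open Classical in
theorem universalRep_single (a : A) (f : A →ₚ[ℂ] ℂ) (x : f.GNS) :
    universalRep A a (lp.single 2 f x : UniversalSpace A) = lp.single 2 f (E := fun f : A →ₚ[ℂ] ℂ => f.GNS) (f.gnsNonUnitalStarAlgHom a x) := by
  refine lp.ext (funext fun g => ?_)
  change g.gnsNonUnitalStarAlgHom a
    ((lp.single 2 f x : UniversalSpace A) g) = _
  rw [lp.single_apply, lp.single_apply]
  by_cases h : g = f
  · subst h; simp
  · rw [Pi.single_eq_of_ne h, Pi.single_eq_of_ne h, map_zero]

/-- Every vector of every representation is implemented by the universal representation. -/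
theorem exists_intertwiner (π : A →⋆ₙₐ[ℂ] (H →L[ℂ] H)) (ξ : H) :
    ∃ (W : UniversalSpace A →L[ℂ] H) (ω : UniversalSpace A), ‖W‖ ≤ 1 ∧ ‖ω‖ ≤ ‖ξ‖ ∧
      (∀ a x, W (universalRep A a x) = π a (W x)) ∧ ∀ a, W (universalRep A a ω) = π a ξ := by
  classical
  -- Both witnesses live on the single summand indexed by `⟪ξ, π(·)ξ⟫`: `W` evaluates there and
  -- applies the GNS isometry, and `ω` is the replacement cyclic vector placed there.
  refine ⟨gnsToRep π ξ ∘L lp.evalCLM ℂ (fun f : A →ₚ[ℂ] ℂ => f.GNS) 2 (vectorFunctional π ξ),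
    lp.single 2 (vectorFunctional π ξ) ((gnsToRep π ξ).adjoint ξ), ?_, ?_, ?_, ?_⟩
  · refine ContinuousLinearMap.opNorm_le_bound _ zero_le_one fun x => ?_
    rw [one_mul]
    refine ((gnsToRep π ξ).le_of_opNorm_le (norm_gnsToRep_le π ξ) _).trans ?_
    rw [one_mul]
    exact lp.norm_apply_le_norm two_ne_zero x _
  · rw [lp.norm_single (by norm_num)]
    refine ((gnsToRep π ξ).adjoint.le_of_opNorm_le
      ((LinearIsometryEquiv.norm_map _ _).trans_le (norm_gnsToRep_le π ξ)) _).trans ?_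
    rw [one_mul]
  · intro a x
    exact gnsToRep_gns π ξ a _
  · intro a
    rw [universalRep_single, gns_adjoint_gnsToRep]
    change gnsToRep π ξ ((lp.single 2 (vectorFunctional π ξ) _ : UniversalSpace A) _) = _
    rw [lp.single_apply, Pi.single_eq_same, gnsToRep_coe]
    simp

theorem universalRep_apply (a : A) (x : UniversalSpace A) (f : A →ₚ[ℂ] ℂ) :
    universalRep A a x f = f.gnsNonUnitalStarAlgHom a (x f) := rfl

/-- The universal representation is nondegenerate. -/
theorem eq_zero_of_universalRep {ζ : UniversalSpace A} (h : ∀ a, universalRep A a ζ = 0) :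
    ζ = 0 := by
  refine lp.ext (funext fun f => ?_)
  change ζ f = 0
  have hc : Continuous fun b => (f.toPreGNS b : f.GNS) := by
    refine UniformSpace.Completion.continuous_coe _ |>.comp ?_
    refine continuous_of_continuousAt_zero f.toPreGNS ?_
    rw [ContinuousAt, map_zero, tendsto_zero_iff_norm_tendsto_zero]
    have h1 : Continuous fun b : A => √(f (star b * b)).re :=
      Real.continuous_sqrt.comp (Complex.continuous_re.comp
        ((map_continuous f).comp (continuous_star.mul continuous_id)))
    have h2 := h1.tendsto 0
    simp only [star_zero, mul_zero, map_zero, Complex.zero_re, Real.sqrt_zero] at h2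
    exact h2
  refine ext_inner_right ℂ fun x => ?_
  rw [inner_zero_left]
  have h0 : ∀ a, f.gnsNonUnitalStarAlgHom a (ζ f) = 0 := fun a => by
    rw [← universalRep_apply, h]; rfl
  induction x using UniformSpace.Completion.induction_on with
  | hp => exact isClosed_eq (by fun_prop) (by fun_prop)
  | ih b =>
    -- The class of `b` is the limit of the classes of `e b`, and `⟪ζ_f, e b⟫ = ⟪e* ζ_f, b⟫ = 0` for
    -- each `e` in the approximate unit.
    have h1 := (hc.tendsto _).comp (tendsto_approxUnit_mul (f.ofPreGNS b))
    have h2 := (tendsto_const_nhds (x := ζ f)).inner (𝕜 := ℂ) h1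
    refine tendsto_nhds_unique h2 (tendsto_const_nhds.congr fun e => ?_)
    have h3 : (f.toPreGNS (e * f.ofPreGNS b) : f.GNS) = f.gnsNonUnitalStarAlgHom e b := by
      rw [PositiveLinearMap.gnsNonUnitalStarAlgHom_apply_coe]; rfl
    rw [Function.comp_apply, h3, ← star_star e, ← inner_hom_left, h0, inner_zero_left]

end GNS
end Extension

/-! ### Amplifications -/

section Amplification

variable {ι : Type v} {H : Type w} [NormedAddCommGroup H] [InnerProductSpace ℂ H]

/-- The amplification `T ⊗ 1` on `ℓ²(ι, H)`. -/
noncomputable def amplify (ι : Type v) (T : H →L[ℂ] H) :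
    lp (fun _ : ι => H) 2 →L[ℂ] lp (fun _ : ι => H) 2 :=
  have hb : ∀ (x : lp (fun _ : ι => H) 2) i, ‖T (x i)‖ ≤ ‖((‖T‖ : ℂ) • x) i‖ := fun x i => by
    rw [lp.coeFn_smul, Pi.smul_apply, norm_smul, Complex.norm_real, norm_norm]
    exact T.le_opNorm _
  have hm : ∀ x : lp (fun _ : ι => H) 2, Memℓp (fun i => T (x i)) 2 := fun x =>
    (lp.memℓp ((‖T‖ : ℂ) • x)).mono' (hb x)
  LinearMap.mkContinuous
    { toFun := fun x => ⟨fun i => T (x i), hm x⟩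
      map_add' := fun x y => lp.ext (funext fun i => map_add T (x i) (y i))
      map_smul' := fun c x => lp.ext (funext fun i => map_smul T c (x i)) } ‖T‖ fun x => by
    refine (lp.norm_mono two_ne_zero (y := (‖T‖ : ℂ) • x) (hb x)).trans ?_
    rw [norm_smul, Complex.norm_real, norm_norm]

theorem amplify_apply (T : H →L[ℂ] H) (x : lp (fun _ : ι => H) 2) (i : ι) :
    amplify ι T x i = T (x i) := rfl

variable {A : Type u} [NonUnitalCStarAlgebra A] [CompleteSpace H]

/-- The amplification of a representation. -/
noncomputable def amplifyHom (ι : Type v) (π : A →⋆ₙₐ[ℂ] (H →L[ℂ] H)) :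
    A →⋆ₙₐ[ℂ] (lp (fun _ : ι => H) 2 →L[ℂ] lp (fun _ : ι => H) 2) where
  toFun a := amplify ι (π a)
  map_zero' := by
    refine ContinuousLinearMap.ext fun x => lp.ext (funext fun f => ?_)
    rw [amplify_apply, map_zero]; rfl
  map_add' a b := by
    refine ContinuousLinearMap.ext fun x => lp.ext (funext fun f => ?_)
    rw [amplify_apply, map_add]; rfl
  map_smul' c a := by
    refine ContinuousLinearMap.ext fun x => lp.ext (funext fun f => ?_)
    rw [amplify_apply, map_smul]; rfl
  map_mul' a b := by
    refine ContinuousLinearMap.ext fun x => lp.ext (funext fun f => ?_)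
    rw [amplify_apply, map_mul]; rfl
  map_star' a := by
    rw [ContinuousLinearMap.star_eq_adjoint, ContinuousLinearMap.eq_adjoint_iff]
    intro x y
    rw [lp.inner_eq_tsum, lp.inner_eq_tsum]
    refine tsum_congr fun f => ?_
    rw [amplify_apply, amplify_apply, inner_hom_left, star_star]

theorem amplifyHom_apply (π : A →⋆ₙₐ[ℂ] (H →L[ℂ] H)) (a : A) (x : lp (fun _ : ι => H) 2) (i : ι) :
    amplifyHom ι π a x i = π a (x i) := rfl

end Amplification

/-! ### The enveloping von Neumann algebra -/

namespace Bidual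

variable {A : Type u} [NonUnitalCStarAlgebra A]

theorem subtype_injective : Function.Injective (Bidual.subtype A) := Subtype.val_injective

theorem norm_subtype (x : Bidual A) : ‖Bidual.subtype A x‖ = ‖x‖ := rfl

theorem mul_subtype_comm (x : Bidual A) {T : UniversalSpace A →L[ℂ] UniversalSpace A}
    (hT : ∀ a, T * universalRep A a = universalRep A a * T) :
    T * Bidual.subtype A x = Bidual.subtype A x * T := by
  have h : Bidual.subtype A x ∈ (envelopingVonNeumannAlgebra A :
    Set (UniversalSpace A →L[ℂ] UniversalSpace A)) := Subtype.property x
  rw [coe_envelopingVonNeumannAlgebra] at h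
  refine h T ?_
  rintro _ ⟨a, rfl⟩
  exact (hT a).symm

/-- An element of the bicommutant, as an element of `A**`. -/
def ofCommute (x : UniversalSpace A →L[ℂ] UniversalSpace A)
    (hx : ∀ T, (∀ a, T * universalRep A a = universalRep A a * T) → T * x = x * T) : Bidual A :=
  ⟨x, by
    change _ ∈ (envelopingVonNeumannAlgebra A : Set (UniversalSpace A →L[ℂ] UniversalSpace A))
    rw [coe_envelopingVonNeumannAlgebra]
    exact fun T hT => hx T fun a => (hT _ ⟨a, rfl⟩).symm⟩

/-- A square-summable family of vectors is controlled by a single vector. -/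
theorem exists_single_vector {ι : Type v} (η : lp (fun _ : ι => UniversalSpace A) 2) :
    ∃ (W : UniversalSpace A →L[ℂ] lp (fun _ : ι => UniversalSpace A) 2) (ω : UniversalSpace A),
      ∀ (x : Bidual A) i, Bidual.subtype A x (η i) = W (Bidual.subtype A x ω) i := by
  -- The family `η` is one vector of the amplified universal representation, so universality applies
  -- to it.
  obtain ⟨W, ω, -, -, hW, hω⟩ := exists_intertwiner (amplifyHom ι (universalRep A)) η
  refine ⟨W, ω, fun x i => ?_⟩
  have hi : ∀ z : lp (fun _ : ι => UniversalSpace A) 2,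
    lp.evalCLM ℂ (fun _ : ι => UniversalSpace A) 2 i z = z i := fun z => rfl
  -- Each coordinate of `W` is an operator in the commutant of the universal representation, hence
  -- commutes with every element of `A**`.
  have hc := mul_subtype_comm x (T := lp.evalCLM ℂ (fun _ : ι => UniversalSpace A) 2 i ∘L W)
    fun a => by
      ext1 z
      change W (universalRep A a z) i = universalRep A a (W z i)
      rw [hW, amplifyHom_apply]
  -- The intertwiner property only gives equality after applying each `a`; nondegeneracy removes
  -- `a`.
  have h1 : η i = W ω i := by
    refine sub_eq_zero.mp (eq_zero_of_universalRep fun a => ?_)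
    rw [map_sub, ← amplifyHom_apply, ← amplifyHom_apply, ← hW, hω, sub_self]
  rw [h1]
  exact (congrArg (fun T : UniversalSpace A →L[ℂ] UniversalSpace A => T ω) hc).symm

/-- Every ultraweakly continuous functional on `A**` is a vector functional. -/
theorem exists_vector_functional {ι : Type v} (ξ η : lp (fun _ : ι => UniversalSpace A) 2) :
    ∃ ξ' ω : UniversalSpace A, ∀ x : Bidual A,
      ∑' i, inner ℂ (ξ i) (Bidual.subtype A x (η i)) = inner ℂ ξ' (Bidual.subtype A x ω) := by
  obtain ⟨W, ω, h⟩ := exists_single_vector η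
  refine ⟨W.adjoint ξ, ω, fun x => ?_⟩
  rw [ContinuousLinearMap.adjoint_inner_left, lp.inner_eq_tsum]
  exact tsum_congr fun i => by rw [h]

theorem continuous_inner_subtype (ξ η : UniversalSpace A) :
    Continuous[Bidual.ultraweak A, inferInstance]
      fun x => inner ℂ ξ (Bidual.subtype A x η) := by
  let p : lp (fun _ : ℕ => UniversalSpace A) 2 × lp (fun _ : ℕ => UniversalSpace A) 2 :=
    (lp.single 2 0 ξ, lp.single 2 0 η)
  have h : (fun x => inner ℂ ξ (Bidual.subtype A x η)) =
      (fun T => ∑' n, inner ℂ (p.1 n) (T (p.2 n))) ∘ Bidual.subtype A := by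
    funext x
    rw [Function.comp_apply, tsum_eq_single 0]
    · simp [p, lp.single_apply]
    · intro n hn
      simp [p, lp.single_apply, hn]
  rw [h]
  exact @Continuous.comp _ _ _ (Bidual.ultraweak A) (ultraweakTopology (UniversalSpace A)) _ _ _
    (continuous_iInf_dom (i := p) continuous_induced_dom) continuous_induced_dom

/-- On `A**` the ultraweak and the weak operator topologies coincide, because every ultraweak
functional is a vector functional. Normality is therefore always checked on matrix coefficients. -/
theorem continuous_ultraweak_iff {X : Type w} [TopologicalSpace X] {g : X → Bidual A} :
    Continuous[inferInstance, Bidual.ultraweak A] g ↔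
      ∀ ξ η, Continuous fun x => inner ℂ ξ (Bidual.subtype A (g x) η) := by
  constructor
  · intro h ξ η
    exact @Continuous.comp _ _ _ _ (Bidual.ultraweak A) _ _ _ (continuous_inner_subtype ξ η) h
  · intro h
    letI := ultraweakTopology (UniversalSpace A)
    refine continuous_induced_rng.mpr (continuous_iInf_rng.mpr fun p => continuous_induced_rng.mpr ?_)
    obtain ⟨ξ, η, hp⟩ := exists_vector_functional p.1 p.2
    exact (h ξ η).congr fun x => (hp (g x)).symm

theorem t2_ultraweak : @T2Space _ (Bidual.ultraweak A) := by
  letI := Bidual.ultraweak A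
  refine ⟨fun x y hxy => ?_⟩
  have : ∃ ξ η, inner ℂ ξ (Bidual.subtype A x η) ≠ inner ℂ ξ (Bidual.subtype A y η) := by
    by_contra! h
    exact hxy (subtype_injective (ContinuousLinearMap.ext fun η => ext_inner_left ℂ fun ξ => h ξ η))
  obtain ⟨ξ, η, h⟩ := this
  exact separated_by_continuous (continuous_inner_subtype ξ η) h

theorem continuous_id_ultraweak : Continuous[inferInstance, Bidual.ultraweak A] (id : Bidual A → _) := by
  refine continuous_ultraweak_iff.mpr fun ξ η => ?_
  have h : Continuous (Bidual.subtype A) := continuous_subtype_val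
  exact continuous_const.inner (h.clm_apply continuous_const)

theorem continuous_mul_left (y : Bidual A) :
    Continuous[Bidual.ultraweak A, Bidual.ultraweak A] (fun x => y * x) := by
  letI := Bidual.ultraweak A
  refine continuous_ultraweak_iff.mpr fun ξ η => ?_
  refine (continuous_inner_subtype ((Bidual.subtype A y).adjoint ξ) η).congr fun x => ?_
  rw [map_mul, mul_apply_eq_comp, ContinuousLinearMap.adjoint_inner_left]

theorem continuous_mul_right (y : Bidual A) :
    Continuous[Bidual.ultraweak A, Bidual.ultraweak A] (fun x => x * y) := by
  letI := Bidual.ultraweak A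
  refine continuous_ultraweak_iff.mpr fun ξ η => ?_
  refine (continuous_inner_subtype ξ (Bidual.subtype A y η)).congr fun x => ?_
  rw [map_mul, mul_apply_eq_comp]

theorem _root_.starProjection_apply_of_invariant {H : Type w} [NormedAddCommGroup H]
    [InnerProductSpace ℂ H] [CompleteSpace H] (K : Submodule ℂ H) [K.HasOrthogonalProjection]
    (T : H →L[ℂ] H) (h : ∀ x ∈ K, T x ∈ K) (h' : ∀ x ∈ K, T.adjoint x ∈ K) (z : H) :
    K.starProjection (T z) = T (K.starProjection z) := by
  refine Submodule.eq_starProjection_of_mem_of_inner_eq_zero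
    (h _ (K.starProjection_apply_mem z)) fun w hw => ?_
  rw [← map_sub, ← ContinuousLinearMap.adjoint_inner_right]
  exact Submodule.starProjection_inner_eq_zero z _ (h' w hw)

/-- This is the one-vector case of the double commutant theorem. The closed orbit `K` of `ω` reduces
the universal representation, so its projection lies in the commutant and commutes with `x`; and `ω
∈ K` by nondegeneracy. -/
theorem mem_closure_orbit (x : Bidual A) (ω : UniversalSpace A) :
    Bidual.subtype A x ω ∈ closure (Set.range fun a => universalRep A a ω) := by
  let f : A →ₗ[ℂ] UniversalSpace A :=
    { toFun := fun a => universalRep A a ω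
      map_add' := by simp
      map_smul' := by simp }
  let K := (LinearMap.range f).topologicalClosure
  have hK : (K : Set (UniversalSpace A)) = closure (Set.range fun a => universalRep A a ω) :=
    (Submodule.topologicalClosure_coe _).trans (by rw [LinearMap.coe_range]; rfl)
  have hinv : ∀ a, ∀ z ∈ K, universalRep A a z ∈ K := fun a z hz => by
    have hm : Set.MapsTo (universalRep A a) (Set.range fun b => universalRep A b ω)
        (Set.range fun b => universalRep A b ω) := by
      rintro _ ⟨b, rfl⟩
      exact ⟨a * b, by simp only [map_mul, mul_apply_eq_comp]⟩
    have := hm.closure (universalRep A a).continuous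
    rw [← hK] at this
    exact this hz
  have : CompleteSpace K := (Submodule.isClosed_topologicalClosure _).completeSpace_coe
  have hP : ∀ a z, K.starProjection (universalRep A a z) = universalRep A a (K.starProjection z) :=
    fun a => starProjection_apply_of_invariant K _ (hinv a) fun z hz => by
      rw [← ContinuousLinearMap.star_eq_adjoint, ← map_star]
      exact hinv _ z hz
  have hω : K.starProjection ω = ω := by
    refine sub_eq_zero.mp (eq_zero_of_universalRep fun a => ?_)
    rw [map_sub, ← hP, sub_eq_zero, Submodule.starProjection_eq_self_iff]
    exact Submodule.le_topologicalClosure _ ⟨a, rfl⟩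
  have hx := mul_subtype_comm x (T := K.starProjection) fun a => by
    ext1 z
    exact hP a z
  rw [← hK, SetLike.mem_coe, ← hω]
  have h2 := congrArg (fun T : UniversalSpace A →L[ℂ] UniversalSpace A => T ω) hx
  simp only [mul_apply_eq_comp] at h2
  rw [← h2]
  exact K.starProjection_apply_mem _

/-- The filter of those elements of `A` which approximate `x ∈ A**` strongly. -/
noncomputable def approx (x : Bidual A) : Filter A :=
  ⨅ ω : UniversalSpace A, comap (fun a => universalRep A a ω) (𝓝 (Bidual.subtype A x ω))

theorem tendsto_approx (x : Bidual A) (ω : UniversalSpace A) :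
    Tendsto (fun a => universalRep A a ω) (approx x) (𝓝 (Bidual.subtype A x ω)) :=
  tendsto_iff_comap.mpr (iInf_le _ ω)

/-- The family of comaps is directed: two vectors form a family indexed by `Bool`, and approximating
`x` on the single vector that controls this family approximates it on both. Each comap is proper by
the density of orbits. -/
instance (x : Bidual A) : (approx x).NeBot := by
  refine iInf_neBot_of_directed' ?_ fun ω => ?_
  · intro ω₁ ω₂
    let η : lp (fun _ : Bool => UniversalSpace A) 2 :=
      lp.single 2 true ω₁ + lp.single 2 false ω₂
    have h1 : η true = ω₁ := by simp [η, lp.single_apply]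
    have h2 : η false = ω₂ := by simp [η, lp.single_apply]
    obtain ⟨W, ω, h⟩ := exists_single_vector η
    have key : ∀ i, comap (fun a => universalRep A a ω) (𝓝 (Bidual.subtype A x ω)) ≤
        comap (fun a => universalRep A a (η i)) (𝓝 (Bidual.subtype A x (η i))) := fun i => by
      rw [← tendsto_iff_comap]
      have hc : Continuous fun z => W z i :=
        (lp.evalCLM ℂ (fun _ : Bool => UniversalSpace A) 2 i).continuous.comp W.continuous
      refine (((hc.tendsto (Bidual.subtype A x ω)).comp tendsto_comap).congr fun a => ?_).trans_eq ?_
      · exact (h (toBidual a) i).symm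
      · rw [h x i]
    exact ⟨ω, by simpa [h1] using key true, by simpa [h2] using key false⟩
  · rw [comap_neBot_iff]
    intro t ht
    obtain ⟨_, h1, a, rfl⟩ := mem_closure_iff_nhds.mp (mem_closure_orbit x ω) t ht
    exact ⟨a, h1⟩

theorem tendsto_toBidual_approx (x : Bidual A) :
    Tendsto toBidual (approx x) (@nhds _ (Bidual.ultraweak A) x) := by
  rw [@nhds_induced _ _ (ultraweakTopology (UniversalSpace A)), nhds_iInf, tendsto_comap_iff,
    tendsto_iInf]
  intro p
  rw [nhds_induced, tendsto_comap_iff]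
  obtain ⟨ξ, η, hp⟩ := exists_vector_functional p.1 p.2
  rw [hp x]
  exact ((tendsto_const_nhds (x := ξ)).inner (𝕜 := ℂ) (tendsto_approx x η)).congr fun a =>
    (hp (toBidual a)).symm

/-- `A` is ultraweakly dense in `A**`. -/
theorem dense_toBidual : @Dense _ (Bidual.ultraweak A) (Set.range (toBidual (A := A))) := by
  letI := Bidual.ultraweak A
  intro x
  exact mem_closure_of_tendsto (tendsto_toBidual_approx x) (Eventually.of_forall fun a => ⟨a, rfl⟩)

end Bidual

namespace Bidual

/-! ### Normal extensions of representations -/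

section Lift

variable {A : Type u} [NonUnitalCStarAlgebra A]

theorem star_ultraweak :
    Continuous[Bidual.ultraweak A, Bidual.ultraweak A] (fun x => star x) := by
  letI := Bidual.ultraweak A
  refine continuous_ultraweak_iff.mpr fun ξ η => ?_
  refine (Complex.continuous_conj.comp (continuous_inner_subtype η ξ)).congr fun x => ?_
  rw [map_star, ContinuousLinearMap.star_eq_adjoint, ContinuousLinearMap.adjoint_inner_right]
  exact inner_conj_symm _ _

/-- The ultraweak topology is Hausdorff, so two continuous maps agreeing on a set agree on its
closure. -/
theorem eqOn_closure {X : Type w} [τ : TopologicalSpace X] [T2Space X] {f g : Bidual A → X}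
    (hf : Continuous[Bidual.ultraweak A, τ] f) (hg : Continuous[Bidual.ultraweak A, τ] g) {s : Set (Bidual A)}
    (h : ∀ x ∈ s, f x = g x) {x : Bidual A} (hx : x ∈ closure[Bidual.ultraweak A] s) : f x = g x :=
  letI := Bidual.ultraweak A
  Set.EqOn.closure (s := s) h hf hg hx

theorem map_closure {X : Type w} [τ : TopologicalSpace X] {f : Bidual A → X}
    (hf : Continuous[Bidual.ultraweak A, τ] f) {s : Set (Bidual A)} {t : Set X}
    (h : ∀ x ∈ s, f x ∈ t) {x : Bidual A} (hx : x ∈ closure[Bidual.ultraweak A] s) :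
    f x ∈ closure t :=
  letI := Bidual.ultraweak A
  Set.MapsTo.closure (s := s) h hf hx

variable {H : Type w} [NormedAddCommGroup H] [InnerProductSpace ℂ H] [CompleteSpace H]
  (π : A →⋆ₙₐ[ℂ] (H →L[ℂ] H))

/-- A vector of the universal space which implements `ξ`. -/
noncomputable def implVec (ξ : H) : UniversalSpace A := (exists_intertwiner π ξ).choose_spec.choose

/-- An intertwiner which implements `ξ`. -/
noncomputable def implMap (ξ : H) : UniversalSpace A →L[ℂ] H := (exists_intertwiner π ξ).choose

theorem norm_implMap_le (ξ : H) : ‖implMap π ξ‖ ≤ 1 :=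
  (exists_intertwiner π ξ).choose_spec.choose_spec.1

theorem norm_implVec_le (ξ : H) : ‖implVec π ξ‖ ≤ ‖ξ‖ :=
  (exists_intertwiner π ξ).choose_spec.choose_spec.2.1

theorem implMap_universalRep (ξ : H) (a : A) (x : UniversalSpace A) :
    implMap π ξ (universalRep A a x) = π a (implMap π ξ x) :=
  (exists_intertwiner π ξ).choose_spec.choose_spec.2.2.1 a x

theorem implMap_implVec (ξ : H) (a : A) :
    implMap π ξ (universalRep A a (implVec π ξ)) = π a ξ :=
  (exists_intertwiner π ξ).choose_spec.choose_spec.2.2.2 a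

/-- The value of the normal extension of `π` at `x`, applied to `ξ`. -/
noncomputable def liftFun (x : Bidual A) (ξ : H) : H :=
  implMap π ξ (Bidual.subtype A x (implVec π ξ))

/-- The intertwiner and vector chosen for `ξ` are arbitrary. Recognising the value as the limit of
`π(a)ξ` along `approx x` removes this dependence and gives linearity in `ξ`. -/
theorem tendsto_liftFun (x : Bidual A) (ξ : H) :
    Tendsto (fun a => π a ξ) (approx x) (𝓝 (liftFun π x ξ)) :=
  (((implMap π ξ).continuous.tendsto _).comp (tendsto_approx x _)).congr fun a =>
    implMap_implVec π ξ a

/-- The normal extension of `π` at `x`. -/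
noncomputable def liftOp (x : Bidual A) : H →L[ℂ] H :=
  (linearMapOfTendsto (l := approx x) (σ := RingHom.id ℂ) (liftFun π x) (fun a => (π a).toLinearMap)
    (tendsto_pi_nhds.mpr (tendsto_liftFun π x))).mkContinuous ‖x‖ fun ξ => by
      refine ((implMap π ξ).le_of_opNorm_le (norm_implMap_le π ξ) _).trans ?_
      rw [one_mul]
      refine ((Bidual.subtype A x).le_opNorm _).trans ?_
      exact mul_le_mul_of_nonneg_left (norm_implVec_le π ξ) (norm_nonneg _)

theorem liftOp_apply (x : Bidual A) (ξ : H) :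
    liftOp π x ξ = implMap π ξ (Bidual.subtype A x (implVec π ξ)) := rfl

theorem tendsto_liftOp (x : Bidual A) (ξ : H) :
    Tendsto (fun a => π a ξ) (approx x) (𝓝 (liftOp π x ξ)) := tendsto_liftFun π x ξ

/-- Both sides are limits of `π(a)(Wζ) = W(aζ)` along `approx x`. Multiplicativity of the normal
extension comes from the case where `W` is the intertwiner chosen for `ξ`. -/
theorem liftOp_intertwiner {W : UniversalSpace A →L[ℂ] H}
    (hW : ∀ a x, W (universalRep A a x) = π a (W x)) (x : Bidual A) (ζ : UniversalSpace A) :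
    liftOp π x (W ζ) = W (Bidual.subtype A x ζ) :=
  tendsto_nhds_unique (tendsto_liftOp π x (W ζ))
    (((W.continuous.tendsto _).comp (tendsto_approx x ζ)).congr fun a => hW a ζ)

/-- Matrix coefficients of the extension are vector functionals of `A**`, which is what makes it
normal. -/
theorem inner_liftOp (x : Bidual A) (ξ η : H) : inner ℂ ξ (liftOp π x η) =
    inner ℂ ((implMap π η).adjoint ξ) (Bidual.subtype A x (implVec π η)) := by
  rw [liftOp_apply, ContinuousLinearMap.adjoint_inner_left]

theorem continuous_inner_liftOp (ξ η : H) :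
    Continuous[Bidual.ultraweak A, inferInstance] fun x => inner ℂ ξ (liftOp π x η) := by
  simp only [inner_liftOp]
  exact continuous_inner_subtype _ _

theorem liftOp_toBidual (a : A) : liftOp π (toBidual a) = π a :=
  ContinuousLinearMap.ext fun ξ => implMap_implVec π ξ a

omit [CompleteSpace H] in
theorem ext_of_inner {f g : Bidual A → (H →L[ℂ] H)} {s : Set (Bidual A)}
    (hf : ∀ ξ η, Continuous[Bidual.ultraweak A, inferInstance] fun x => inner ℂ ξ (f x η))
    (hg : ∀ ξ η, Continuous[Bidual.ultraweak A, inferInstance] fun x => inner ℂ ξ (g x η))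
    (h : ∀ x ∈ s, f x = g x) {x : Bidual A} (hx : x ∈ closure[Bidual.ultraweak A] s) :
    f x = g x :=
  ContinuousLinearMap.ext fun η => ext_inner_left ℂ fun ξ =>
    eqOn_closure (hf ξ η) (hg ξ η) (fun y hy => by rw [h y hy]) hx

/-- The normal extension of a representation of `A` to `A**`. -/
noncomputable def liftRep : Bidual A →⋆ₙₐ[ℂ] (H →L[ℂ] H) where
  toFun := liftOp π
  -- The chosen intertwiner and vector depend on `ξ` but not on `x`, so linearity in `x` is
  -- immediate.
  map_zero' := by ext1 ξ; simp [liftOp_apply]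
  map_add' x y := by ext1 ξ; simp [liftOp_apply]
  map_smul' c x := by ext1 ξ; simp [liftOp_apply]
  map_mul' x y := by
    ext1 ξ
    rw [mul_apply_eq_comp, liftOp_apply π y, liftOp_intertwiner π (implMap_universalRep π ξ),
      liftOp_apply, map_mul, mul_apply_eq_comp]
  map_star' x := by
    refine congrFun (f := fun x => liftOp π (star x)) (g := fun x => star (liftOp π x)) ?_ x
    funext x
    refine ext_of_inner (f := fun x => liftOp π (star x)) (g := fun x => star (liftOp π x))
      (s := Set.range toBidual) ?_ ?_ ?_ (dense_toBidual x)
    · intro ξ η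
      exact @Continuous.comp _ _ _ (Bidual.ultraweak A) (Bidual.ultraweak A) _ _ _
        (continuous_inner_liftOp π ξ η) star_ultraweak
    · intro ξ η
      letI := Bidual.ultraweak A
      refine (Complex.continuous_conj.comp (continuous_inner_liftOp π η ξ)).congr fun x => ?_
      rw [ContinuousLinearMap.star_eq_adjoint, ContinuousLinearMap.adjoint_inner_right]
      exact inner_conj_symm _ _
    · rintro _ ⟨a, rfl⟩
      rw [← map_star, liftOp_toBidual, liftOp_toBidual, map_star]

theorem liftRep_toBidual (a : A) : liftRep π (toBidual a) = π a := liftOp_toBidual π a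

theorem continuous_inner_liftRep (ξ η : H) :
    Continuous[Bidual.ultraweak A, inferInstance] fun x => inner ℂ ξ (liftRep π x η) :=
  continuous_inner_liftOp π ξ η

/-- The commutation relation passes from `A` to `A**` by ultraweak density. It ensures that
extending a homomorphism `A → B**` gives values in the bicommutant of `B`. -/
theorem liftRep_comm {T : H →L[ℂ] H} (hT : ∀ a, T * π a = π a * T) (x : Bidual A) :
    T * liftRep π x = liftRep π x * T := by
  refine ext_of_inner (f := fun x => T * liftRep π x) (g := fun x => liftRep π x * T)
      (s := Set.range toBidual) ?_ ?_ ?_ (dense_toBidual x)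
  · intro ξ η
    letI := Bidual.ultraweak A
    refine (continuous_inner_liftRep π (T.adjoint ξ) η).congr fun x => ?_
    rw [mul_apply_eq_comp, ContinuousLinearMap.adjoint_inner_left]
  · intro ξ η
    exact continuous_inner_liftRep π ξ (T η)
  · rintro _ ⟨a, rfl⟩
    rw [liftRep_toBidual, hT]

variable {B : Type v} [NonUnitalCStarAlgebra B] (φ : A →⋆ₙₐ[ℂ] Bidual B)

/-- A `⋆`-homomorphism `A → B**`, as a representation on the universal space of `B`. -/
noncomputable def toRep : A →⋆ₙₐ[ℂ] (UniversalSpace B →L[ℂ] UniversalSpace B) :=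
  (Bidual.subtype B : Bidual B →⋆ₙₐ[ℂ] _).comp φ

theorem toRep_apply (a : A) : toRep φ a = Bidual.subtype B (φ a) := rfl

/-- The normal extension of a `⋆`-homomorphism `A → B**`, as a function. -/
noncomputable def liftVal (x : Bidual A) : Bidual B :=
  ofCommute (liftRep (toRep φ) x) fun _ hT => liftRep_comm _ (fun a => mul_subtype_comm (φ a) hT) x

theorem subtype_liftVal (x : Bidual A) :
    Bidual.subtype B (liftVal φ x) = liftRep (toRep φ) x := rfl

/-- The normal extension of a `⋆`-homomorphism `A → B**` to `A** → B**`. -/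
noncomputable def lift : Bidual A →⋆ₙₐ[ℂ] Bidual B where
  toFun := liftVal φ
  map_zero' := subtype_injective (by rw [subtype_liftVal, map_zero, map_zero])
  map_add' x y := subtype_injective (by simp only [subtype_liftVal, map_add])
  map_smul' c x := subtype_injective (by simp only [subtype_liftVal, map_smul, MonoidHom.id_apply])
  map_mul' x y := subtype_injective (by simp only [subtype_liftVal, map_mul])
  map_star' x := subtype_injective (by simp only [subtype_liftVal, map_star])

theorem subtype_lift (x : Bidual A) : Bidual.subtype B (lift φ x) = liftRep (toRep φ) x := rfl

theorem lift_toBidual (a : A) : lift φ (toBidual a) = φ a :=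
  subtype_injective (by rw [subtype_lift, liftRep_toBidual, toRep_apply])

theorem continuous_lift : Continuous[Bidual.ultraweak A, Bidual.ultraweak B] (lift φ) := by
  refine (@continuous_ultraweak_iff B _ _ (Bidual.ultraweak A) (lift φ)).mpr fun ξ η => ?_
  simp only [subtype_lift]
  exact continuous_inner_liftRep _ ξ η

/-- Normal maps on `A**` which agree on a set agree on its ultraweak closure. -/
theorem eq_of_mem_closure {f g : Bidual A → Bidual B}
    (hf : Continuous[Bidual.ultraweak A, Bidual.ultraweak B] f)
    (hg : Continuous[Bidual.ultraweak A, Bidual.ultraweak B] g) {s : Set (Bidual A)}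
    (h : ∀ x ∈ s, f x = g x) {x : Bidual A} (hx : x ∈ closure[Bidual.ultraweak A] s) : f x = g x :=
  @eqOn_closure A _ _ (Bidual.ultraweak B) t2_ultraweak f g hf hg s h x hx

theorem eq_of_toBidual {f g : Bidual A → Bidual B}
    (hf : Continuous[Bidual.ultraweak A, Bidual.ultraweak B] f)
    (hg : Continuous[Bidual.ultraweak A, Bidual.ultraweak B] g)
    (h : ∀ a, f (toBidual a) = g (toBidual a)) (x : Bidual A) : f x = g x :=
  eq_of_mem_closure hf hg (by rintro _ ⟨a, rfl⟩; exact h a) (dense_toBidual x)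

theorem mem_closure_of_map {f : Bidual A → Bidual B}
    (hf : Continuous[Bidual.ultraweak A, Bidual.ultraweak B] f) {s : Set (Bidual A)}
    {t : Set (Bidual B)} (h : ∀ x ∈ s, f x ∈ t) {x : Bidual A}
    (hx : x ∈ closure[Bidual.ultraweak A] s) : f x ∈ closure[Bidual.ultraweak B] t :=
  @map_closure A _ _ (Bidual.ultraweak B) f hf s t h x hx

end Lift

end Bidual

/-! ### Essential subspaces and one-sided multipliers -/

section Multiplier

variable {H : Type w} [NormedAddCommGroup H] [InnerProductSpace ℂ H] [CompleteSpace H]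

omit [CompleteSpace H] in
theorem tendsto_clm_apply {X : Type v} {l : Filter X} {f : X → H →L[ℂ] H} {T : H →L[ℂ] H}
    (h : Tendsto f l (𝓝 T)) (ξ : H) : Tendsto (fun x => f x ξ) l (𝓝 (T ξ)) :=
  ((ContinuousLinearMap.apply ℂ H ξ).continuous.tendsto T).comp h

/-- A uniformly bounded net of operators converging on `D` is pointwise Cauchy on the closure of
`D`. -/
theorem exists_tendsto_of_mem_closure {X : Type v} {l : Filter X} [l.NeBot]
    {f : X → H →L[ℂ] H} {C : ℝ} (hC : ∀ᶠ x in l, ‖f x‖ ≤ C) {D : Set H}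
    (hD : ∀ y ∈ D, ∃ z, Tendsto (fun x => f x y) l (𝓝 z)) {ξ : H} (hξ : ξ ∈ closure D) :
    ∃ z, Tendsto (fun x => f x ξ) l (𝓝 z) := by
  refine cauchy_map_iff_exists_tendsto.mp (Metric.cauchy_iff.mpr ⟨inferInstance, fun ε hε => ?_⟩)
  have hC0 : 0 < |C| + 1 := by positivity
  -- With this distance `f x ξ` is within `ε/4` of `f x y`, which is eventually within `ε/4` of `z`.
  -- Using `|C| + 1` keeps the denominator positive.
  obtain ⟨y, hy, hyξ⟩ := Metric.mem_closure_iff.mp hξ (ε / (4 * (|C| + 1))) (by positivity)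
  obtain ⟨z, hz⟩ := hD y hy
  refine ⟨Metric.ball z (ε / 2), ?_, fun a ha b hb => ?_⟩
  · have h1 := Metric.tendsto_nhds.mp hz (ε / 4) (by positivity)
    rw [mem_map]
    filter_upwards [hC, h1] with x hx hx1
    rw [Set.mem_preimage, Metric.mem_ball]
    have h2 : dist (f x ξ) (f x y) ≤ ε / 4 := by
      rw [dist_eq_norm, ← map_sub]
      rw [dist_eq_norm] at hyξ
      calc ‖f x (ξ - y)‖ ≤ (|C| + 1) * (ε / (4 * (|C| + 1))) :=
            ((f x).le_opNorm _).trans (mul_le_mul (by linarith [le_abs_self C]) hyξ.le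
              (norm_nonneg _) hC0.le)
        _ = ε / 4 := by field_simp
    linarith [dist_triangle (f x ξ) (f x y) z]
  · rw [Metric.mem_ball] at ha hb
    linarith [dist_triangle_right a b z]

variable {A : Type u} [NonUnitalCStarAlgebra A]

/-- The closed linear span of `π(I) H`. -/
def essSpace (π : A →⋆ₙₐ[ℂ] (H →L[ℂ] H)) (I : NonUnitalStarSubalgebra ℂ A) : Submodule ℂ H :=
  (Submodule.span ℂ {η : H | ∃ a ∈ I, ∃ ξ, π a ξ = η}).topologicalClosure

variable (π : A →⋆ₙₐ[ℂ] (H →L[ℂ] H)) {I : NonUnitalStarSubalgebra ℂ A}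

theorem isClosed_essSpace (I : NonUnitalStarSubalgebra ℂ A) : IsClosed (essSpace π I : Set H) :=
  Submodule.isClosed_topologicalClosure _

instance hasOrthogonalProjection_essSpace : (essSpace π I).HasOrthogonalProjection :=
  haveI : CompleteSpace (essSpace π I) := (isClosed_essSpace π I).completeSpace_coe
  inferInstance

theorem apply_mem_essSpace {a : A} (ha : a ∈ I) (ξ : H) : π a ξ ∈ essSpace π I :=
  Submodule.le_topologicalClosure _ (Submodule.subset_span ⟨a, ha, ξ, rfl⟩)

theorem essSpace_le {K : Submodule ℂ H} (hK : IsClosed (K : Set H))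
    (h : ∀ a ∈ I, ∀ ξ, π a ξ ∈ K) : essSpace π I ≤ K :=
  Submodule.topologicalClosure_minimal _ (Submodule.span_le.mpr (by
    rintro _ ⟨a, ha, ξ, rfl⟩
    exact h a ha ξ)) hK

theorem map_mem_of_essSpace {K : Submodule ℂ H} (hK : IsClosed (K : Set H)) (T : H →L[ℂ] H)
    (h : ∀ a ∈ I, ∀ ξ, T (π a ξ) ∈ K) {η : H} (hη : η ∈ essSpace π I) : T η ∈ K :=
  essSpace_le π (K := K.comap T.toLinearMap) (hK.preimage T.continuous) h hη

theorem eq_of_mem_essSpace {S T : H →L[ℂ] H} (h : ∀ a ∈ I, ∀ ξ, S (π a ξ) = T (π a ξ)) {η : H}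
    (hη : η ∈ essSpace π I) : S η = T η := by
  have h1 := map_mem_of_essSpace π (K := ⊥) isClosed_singleton (S - T) (fun a ha ξ => by
    simp [h a ha ξ]) hη
  simpa [sub_eq_zero] using h1

/-- Since `I` is closed under the star, `⟪π(a)ξ, x⟫ = ⟪ξ, π(a*)x⟫` exchanges the two conditions. -/
theorem mem_orthogonal_essSpace_iff {ξ : H} :
    ξ ∈ (essSpace π I)ᗮ ↔ ∀ a ∈ I, π a ξ = 0 := by
  constructor
  · intro h a ha
    refine ext_inner_right ℂ fun x => ?_
    rw [inner_hom_left, inner_zero_left]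
    exact Submodule.inner_left_of_mem_orthogonal (apply_mem_essSpace π (star_mem ha) x) h
  · intro h
    have h1 : essSpace π I ≤ (Submodule.span ℂ {ξ})ᗮ := by
      refine essSpace_le π (Submodule.isClosed_orthogonal _) fun a ha x => ?_
      rw [Submodule.mem_orthogonal_singleton_iff_inner_right, ← star_star a, ← inner_hom_left,
        h _ (star_mem ha), inner_zero_left]
    refine (Submodule.mem_orthogonal _ _).mpr fun x hx => ?_
    exact Submodule.mem_orthogonal_singleton_iff_inner_left.mp (h1 hx)

theorem apply_starProjection_essSpace {a : A} (ha : a ∈ I) (ξ : H) :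
    π a ((essSpace π I).starProjection ξ) = π a ξ := by
  have h := (mem_orthogonal_essSpace_iff π).mp
    ((essSpace π I).sub_starProjection_mem_orthogonal ξ) a ha
  rw [map_sub, sub_eq_zero] at h
  exact h.symm

/-- Extension of a right module map `L` to an operator. -/
theorem exists_multiplier (L : A →ₗ[ℂ] (H →L[ℂ] H)) {C : ℝ} (hC0 : 0 ≤ C)
    (hC : ∀ b, ‖L b‖ ≤ C * ‖b‖) (hL : ∀ b c, L (b * c) = L b * π c) :
    ∃ T : H →L[ℂ] H, ‖T‖ ≤ C ∧ (∀ b, T * π b = L b) ∧ ∀ ξ, (∀ b, π b ξ = 0) → T ξ = 0 := by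
  have hLc : Continuous L := AddMonoidHomClass.continuous_of_bound L C hC
  have hbd : ∀ᶠ e in approxUnit A, ‖L e‖ ≤ C := eventually_approxUnit_norm_le.mono fun e he =>
    (hC e).trans (mul_le_of_le_one_right hC0 he)
  -- The operator sought is the strong limit of `L e` along the approximate unit; on `π(b)ξ` it
  -- exists because `L(e)π(b) = L(e b) → L(b)`.
  have hgen : ∀ b ξ, Tendsto (fun e => L e (π b ξ)) (approxUnit A) (𝓝 (L b ξ)) := fun b ξ => by
    refine (tendsto_clm_apply ((hLc.tendsto b).comp (tendsto_approxUnit_mul b)) ξ).congr fun e => ?_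
    rw [Function.comp_apply, hL, mul_apply_eq_comp]
  -- As `L(b)` is the limit of `L(b e) = L(b)π(e)`, it vanishes on vectors killed by `π`.
  have hzero : ∀ ξ, (∀ b, π b ξ = 0) → ∀ b, L b ξ = 0 := fun ξ hξ b => by
    refine tendsto_nhds_unique (tendsto_clm_apply ((hLc.tendsto b).comp (tendsto_mul_approxUnit b)) ξ) (tendsto_const_nhds.congr fun e => ?_)
    rw [Function.comp_apply, hL, mul_apply_eq_comp, hξ, map_zero]
  have hex : ∀ ξ, ∃ z, Tendsto (fun e => L e ξ) (approxUnit A) (𝓝 z) := fun ξ => by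
    -- On the essential space convergence follows from the generators and the uniform bound; on its
    -- complement all the operators vanish.
    obtain ⟨y, hy, w, hw, rfl⟩ := (essSpace π ⊤).exists_add_mem_mem_orthogonal ξ
    have hw' : ∀ b, π b w = 0 := fun b => (mem_orthogonal_essSpace_iff π).mp hw b trivial
    have hy' : y ∈ closure (Submodule.span ℂ {η : H | ∃ a ∈ (⊤ : NonUnitalStarSubalgebra ℂ A),
      ∃ ξ, π a ξ = η} : Set H) := by
      rw [← Submodule.topologicalClosure_coe]; exact hy
    obtain ⟨z, hz⟩ := exists_tendsto_of_mem_closure hbd (fun y hy => by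
      induction hy using Submodule.span_induction with
      | mem x hx =>
        obtain ⟨a, -, ξ, rfl⟩ := hx
        exact ⟨_, hgen a ξ⟩
      | zero => exact ⟨0, by simp⟩
      | add x y _ _ hx hy =>
        obtain ⟨z, hz⟩ := hx
        obtain ⟨z', hz'⟩ := hy
        exact ⟨z + z', by simpa using hz.add hz'⟩
      | smul c x _ hx =>
        obtain ⟨z, hz⟩ := hx
        exact ⟨c • z, by simpa using hz.const_smul c⟩) hy'
    exact ⟨z, hz.congr fun e => by rw [map_add, hzero w hw', add_zero]⟩
  choose T hT using hex
  refine ⟨(linearMapOfTendsto (l := approxUnit A) (σ := RingHom.id ℂ) T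
    (fun e => (L e).toLinearMap) (tendsto_pi_nhds.mpr hT)).mkContinuous C fun ξ => ?_, ?_, ?_, ?_⟩
  · refine le_of_tendsto (hT ξ).norm (hbd.mono fun e he => ?_)
    exact (L e).le_of_opNorm_le he ξ
  · exact LinearMap.mkContinuous_norm_le _ hC0 _
  · intro b
    ext1 ξ
    exact tendsto_nhds_unique (hT (π b ξ)) (hgen b ξ)
  · intro ξ hξ
    exact tendsto_nhds_unique (hT ξ) (tendsto_const_nhds.congr fun e => (hzero ξ hξ e).symm)

/-- Taking adjoints turns `(S - T)π(a) = 0` for all `a` into the statement that the range of `(S -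
T)*` is killed by `π`. -/
theorem ext_of_mul_hom (hπ : ∀ ζ, (∀ a, π a ζ = 0) → ζ = 0) {S T : H →L[ℂ] H}
    (h : ∀ a, S * π a = T * π a) : S = T := by
  rw [← sub_eq_zero, ← star_eq_zero]
  ext1 ζ
  refine hπ _ fun a => ?_
  have h1 : π a * star (S - T) = 0 := by
    rw [← star_star (π a), ← star_mul, ← map_star, sub_mul, h, sub_self, star_zero]
  exact congrArg (fun R : H →L[ℂ] H => R ζ) h1

/-- Boundedness gives a limit `z` in the essential space. For `a ∈ I`, `π(a)z` is the limit of `π(a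
e)ξ`, namely `π(a)ξ`, so `z - ξ` is also orthogonal to the essential space and vanishes. -/
theorem tendsto_approxUnit_apply [IsClosed (I : Set A)] {ξ : H} (hξ : ξ ∈ essSpace π I) :
    Tendsto (fun e : I => π e ξ) (approxUnit I) (𝓝 ξ) := by
  have hbd : ∀ᶠ e : I in approxUnit I, ‖π (e : A)‖ ≤ 1 := eventually_approxUnit_norm_le.mono fun e he =>
    (NonUnitalStarAlgHom.norm_apply_le π _).trans he
  have hpc : Continuous fun e : I => π (e : A) := (continuous_hom π).comp continuous_subtype_val
  have hgen : ∀ b : I, ∀ ξ, Tendsto (fun e : I => π e (π b ξ)) (approxUnit I) (𝓝 (π b ξ)) :=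
    fun b ξ => by
    refine (tendsto_clm_apply ((hpc.tendsto b).comp (tendsto_approxUnit_mul b)) ξ).congr fun e => ?_
    rw [Function.comp_apply, ← mul_apply_eq_comp, ← map_mul]; rfl
  obtain ⟨z, hz⟩ := exists_tendsto_of_mem_closure hbd (fun y hy => by
      induction hy using Submodule.span_induction with
      | mem x hx =>
        obtain ⟨a, ha, ξ, rfl⟩ := hx
        exact ⟨_, hgen ⟨a, ha⟩ ξ⟩
      | zero => exact ⟨0, by simp⟩
      | add x y _ _ hx hy =>
        obtain ⟨z, hz⟩ := hx
        obtain ⟨z', hz'⟩ := hy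
        exact ⟨z + z', by simpa using hz.add hz'⟩
      | smul c x _ hx =>
        obtain ⟨z, hz⟩ := hx
        exact ⟨c • z, by simpa using hz.const_smul c⟩)
      ((Submodule.topologicalClosure_coe _).subset hξ)
  have hzK : z ∈ essSpace π I := (isClosed_essSpace π I).mem_of_tendsto hz
    (Eventually.of_forall fun e => apply_mem_essSpace π e.2 ξ)
  have h0 : z - ξ ∈ (essSpace π I)ᗮ := by
    refine (mem_orthogonal_essSpace_iff π).mpr fun a ha => ?_
    rw [map_sub, sub_eq_zero]
    refine tendsto_nhds_unique (((π a).continuous.tendsto z).comp hz)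
      ((tendsto_clm_apply ((hpc.tendsto ⟨a, ha⟩).comp (tendsto_mul_approxUnit (⟨a, ha⟩ : I))) ξ).congr fun e => ?_)
    rw [Function.comp_apply, Function.comp_apply, ← mul_apply_eq_comp, ← map_mul]; rfl
  have h1 : z - ξ = 0 := by
    have := Submodule.inner_right_of_mem_orthogonal (sub_mem hzK hξ) h0
    exact inner_self_eq_zero.mp this
  rwa [sub_eq_zero.mp h1] at hz

end Multiplier

theorem Bidual.continuous_comp {A : Type u} {B : Type v} {C : Type w} [NonUnitalCStarAlgebra A]
    [NonUnitalCStarAlgebra B] [NonUnitalCStarAlgebra C] {g : Bidual B → Bidual C}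
    {f : Bidual A → Bidual B} (hg : Continuous[Bidual.ultraweak B, Bidual.ultraweak C] g)
    (hf : Continuous[Bidual.ultraweak A, Bidual.ultraweak B] f) :
    Continuous[Bidual.ultraweak A, Bidual.ultraweak C] (g ∘ f) :=
  @Continuous.comp _ _ _ (Bidual.ultraweak A) (Bidual.ultraweak B) (Bidual.ultraweak C) _ _ hg hf

theorem Bidual.continuous_toSubalgebra {A : Type u} {B : Type v} [NonUnitalCStarAlgebra A]
    [NonUnitalCStarAlgebra B] {I : NonUnitalStarSubalgebra ℂ (Bidual B)} {f : Bidual A → I}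
    (hf : Continuous[Bidual.ultraweak A, Bidual.ultraweak B] fun x => (f x : Bidual B)) :
    Continuous[Bidual.ultraweak A, Bidual.ultraweakOn I] f :=
  continuous_induced_rng.mpr hf

theorem Bidual.continuous_ofSubalgebra {A : Type u} {B : Type v} [NonUnitalCStarAlgebra A]
    [NonUnitalCStarAlgebra B] {I : NonUnitalStarSubalgebra ℂ (Bidual A)} {f : Bidual A → Bidual B}
    (hf : Continuous[Bidual.ultraweak A, Bidual.ultraweak B] f) :
    Continuous[Bidual.ultraweakOn I, Bidual.ultraweak B] fun x : I => f x :=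
  @Continuous.comp _ _ _ (Bidual.ultraweakOn I) (Bidual.ultraweak A) (Bidual.ultraweak B) _ _ hf
    (@continuous_induced_dom _ _ _ (Bidual.ultraweak A))

/-! ### Ideals -/

section Ideal

variable {A : Type u} [NonUnitalCStarAlgebra A] {J : Type v} [NonUnitalCStarAlgebra J]

/-- An injective homomorphism `i : J → A` whose image is a two-sided ideal. -/
structure IsIdealEmbedding (i : J →⋆ₙₐ[ℂ] A) : Prop where
  injective : Function.Injective i
  exists_mul_left : ∀ a b, ∃ c, i c = a * i b

namespace IsIdealEmbedding

variable {i : J →⋆ₙₐ[ℂ] A} (hi : IsIdealEmbedding i)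

/-- The element of `J` corresponding to `a * i b`. -/
noncomputable def lmul (a : A) (b : J) : J := (hi.exists_mul_left a b).choose

theorem map_lmul (a : A) (b : J) : i (hi.lmul a b) = a * i b := (hi.exists_mul_left a b).choose_spec

theorem lmul_eq {a : A} {b c : J} (h : i c = a * i b) : hi.lmul a b = c :=
  hi.injective ((hi.map_lmul a b).trans h.symm)

include hi in
theorem norm_map (b : J) : ‖i b‖ = ‖b‖ := NonUnitalStarAlgHom.norm_map i hi.injective b

/-- The map `b ↦ a b` on `J` is a right module map of norm at most `‖a‖`, so on the universal space
of `J` it is left multiplication by an operator. -/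
theorem exists_left_multiplier (a : A) :
    ∃ T : UniversalSpace J →L[ℂ] UniversalSpace J,
      ∀ b : J, T * universalRep J b = universalRep J (hi.lmul a b) := by
  let L : J →ₗ[ℂ] (UniversalSpace J →L[ℂ] UniversalSpace J) :=
    { toFun := fun b => universalRep J (hi.lmul a b)
      map_add' := fun b c => by
        rw [← map_add, hi.lmul_eq]
        rw [map_add, map_add, mul_add, hi.map_lmul, hi.map_lmul]
      map_smul' := fun c b => by
        rw [RingHom.id_apply, ← map_smul, hi.lmul_eq]
        rw [map_smul, map_smul, mul_smul_comm, hi.map_lmul] }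
  obtain ⟨T, -, hT, -⟩ := exists_multiplier (universalRep J) L (norm_nonneg a)
    (fun b => (NonUnitalStarAlgHom.norm_apply_le (universalRep J) _).trans (by
      rw [← hi.norm_map, hi.map_lmul, ← hi.norm_map b]
      exact norm_mul_le a (i b))) fun b c => by
      change universalRep J _ = universalRep J _ * universalRep J c
      rw [← map_mul, hi.lmul_eq]
      rw [map_mul, map_mul, hi.map_lmul, mul_assoc]
  exact ⟨T, hT⟩

theorem _root_.ext_of_mul_universalRep {S T : UniversalSpace J →L[ℂ] UniversalSpace J}
    (h : ∀ b, S * universalRep J b = T * universalRep J b) : S = T :=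
  ext_of_mul_hom (universalRep J) (fun _ h => eq_zero_of_universalRep h) h

/-- Left multiplication by `a` on the universal space of the ideal `J`. -/
noncomputable def leftMultiplier (a : A) : UniversalSpace J →L[ℂ] UniversalSpace J :=
  (hi.exists_left_multiplier a).choose

theorem leftMultiplier_mul (a : A) (b : J) :
    hi.leftMultiplier a * universalRep J b = universalRep J (hi.lmul a b) :=
  (hi.exists_left_multiplier a).choose_spec b

/-- Left multiplication by `a`, as an element of `J**`. -/
noncomputable def leftMultiplierVal (a : A) : Bidual J :=
  -- If `T` commutes with `J` and `M` is the multiplier, then `T M b = T(a b) = (a b)T = M b T = M T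
  -- b` for every `b ∈ J`, so `T M = M T` by nondegeneracy.
  Bidual.ofCommute (hi.leftMultiplier a) fun T hT => ext_of_mul_universalRep fun b => by
    rw [mul_assoc, leftMultiplier_mul, hT, mul_assoc, hT, ← mul_assoc, leftMultiplier_mul]

theorem _root_.Bidual.ext_of_mul_toBidual {x y : Bidual J}
    (h : ∀ b, x * toBidual b = y * toBidual b) : x = y := by
  refine Bidual.subtype_injective (ext_of_mul_universalRep fun b => ?_)
  have h1 := congrArg (Bidual.subtype J) (h b)
  rwa [map_mul, map_mul] at h1

theorem leftMultiplierVal_mul (a : A) (b : J) :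
    hi.leftMultiplierVal a * toBidual b = toBidual (hi.lmul a b) := by
  refine Bidual.subtype_injective ?_
  rw [map_mul]
  exact hi.leftMultiplier_mul a b

theorem leftMultiplierVal_ext {a : A} {x : Bidual J}
    (h : ∀ b : J, x * toBidual b = toBidual (hi.lmul a b)) : hi.leftMultiplierVal a = x :=
  Bidual.ext_of_mul_toBidual fun b => by rw [h, leftMultiplierVal_mul]

/-- Only left multiplication on `J` has been constructed, so the product `b a` in `J` appears as
`(a* b*)*`. This right-hand formula is what shows that `a ↦ M_a` respects the star. -/
theorem toBidual_mul_leftMultiplierVal (a : A) (b : J) :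
    toBidual b * hi.leftMultiplierVal a = toBidual (star (hi.lmul (star a) (star b))) := by
  refine Bidual.ext_of_mul_toBidual fun c => ?_
  rw [mul_assoc, leftMultiplierVal_mul, ← map_mul, ← map_mul]
  congr 1
  apply hi.injective
  rw [map_mul, map_mul, map_star, hi.map_lmul, hi.map_lmul, star_mul, map_star, star_star, star_star,
    mul_assoc]

/-- The canonical homomorphism `A → M(J) ⊆ J**` for a closed ideal `J` of `A`. -/
noncomputable def multiplierHom : A →⋆ₙₐ[ℂ] Bidual J where
  toFun := hi.leftMultiplierVal
  map_zero' := hi.leftMultiplierVal_ext fun b => by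
    rw [zero_mul, hi.lmul_eq (c := 0), map_zero]
    rw [map_zero, zero_mul]
  map_add' x y := hi.leftMultiplierVal_ext fun b => by
    rw [add_mul, leftMultiplierVal_mul, leftMultiplierVal_mul, ← map_add,
      hi.lmul_eq (a := x + y) (c := hi.lmul x b + hi.lmul y b)]
    rw [map_add, add_mul, hi.map_lmul, hi.map_lmul]
  map_smul' c x := hi.leftMultiplierVal_ext fun b => by
    rw [MonoidHom.id_apply, smul_mul_assoc, leftMultiplierVal_mul, ← map_smul,
      hi.lmul_eq (a := c • x) (c := c • hi.lmul x b)]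
    rw [map_smul, smul_mul_assoc, hi.map_lmul]
  map_mul' x y := hi.leftMultiplierVal_ext fun b => by
    rw [mul_assoc, leftMultiplierVal_mul, leftMultiplierVal_mul,
      hi.lmul_eq (a := x * y) (c := hi.lmul x (hi.lmul y b))]
    rw [hi.map_lmul, hi.map_lmul, mul_assoc]
  map_star' x := hi.leftMultiplierVal_ext fun b => by
    rw [← star_star (toBidual b), ← star_mul, ← map_star, toBidual_mul_leftMultiplierVal,
      ← map_star, star_star, star_star]

theorem multiplierHom_apply (b : J) : hi.multiplierHom (i b) = toBidual b :=
  hi.leftMultiplierVal_ext fun c => by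
    rw [← map_mul, hi.lmul_eq]
    rw [map_mul]

/-- The normal homomorphism `A** → J**` which is the identity on `J`. -/
noncomputable def retract : Bidual A →⋆ₙₐ[ℂ] Bidual J := Bidual.lift hi.multiplierHom

theorem retract_toBidual (b : J) : hi.retract (toBidual (i b)) = toBidual b := by
  rw [retract, Bidual.lift_toBidual, multiplierHom_apply]

theorem continuous_retract : Continuous[Bidual.ultraweak A, Bidual.ultraweak J] hi.retract :=
  Bidual.continuous_lift _

/-- The normal extension `J** → A**` of the inclusion. -/
noncomputable def _root_.Bidual.map (i : J →⋆ₙₐ[ℂ] A) : Bidual J →⋆ₙₐ[ℂ] Bidual A :=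
  Bidual.lift (toBidual.comp i)

theorem _root_.Bidual.map_toBidual (i : J →⋆ₙₐ[ℂ] A) (b : J) :
    Bidual.map i (toBidual b) = toBidual (i b) := Bidual.lift_toBidual _ b

theorem _root_.Bidual.continuous_map (i : J →⋆ₙₐ[ℂ] A) :
    Continuous[Bidual.ultraweak J, Bidual.ultraweak A] (Bidual.map i) := Bidual.continuous_lift _

/-- The composite is normal on `J**` and is the identity on the dense subset `J`. -/
theorem retract_map (x : Bidual J) : hi.retract (Bidual.map i x) = x := by
  letI := Bidual.ultraweak J
  letI := Bidual.ultraweak A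
  exact Bidual.eq_of_toBidual (f := fun x => hi.retract (Bidual.map i x)) (g := id)
    (hi.continuous_retract.comp (Bidual.continuous_map i)) continuous_id
    (fun b => by rw [Bidual.map_toBidual, hi.retract_toBidual, id]) x

/-- The composite is a normal endomorphism of `A**` fixing `J`, hence the identity on the ultraweak
closure of `J`, though not on all of `A**` in general. -/
theorem map_retract {y : Bidual A}
    (hy : y ∈ closure[Bidual.ultraweak A] (Set.range fun b => toBidual (i b))) :
    Bidual.map i (hi.retract y) = y := by
  letI := Bidual.ultraweak J
  letI := Bidual.ultraweak A
  exact Bidual.eq_of_mem_closure (f := fun x => Bidual.map i (hi.retract x)) (g := id)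
    ((Bidual.continuous_map i).comp hi.continuous_retract) continuous_id
    (by rintro _ ⟨b, rfl⟩; rw [hi.retract_toBidual, Bidual.map_toBidual, id]) hy

theorem _root_.Bidual.map_mem_closure (i : J →⋆ₙₐ[ℂ] A) (x : Bidual J) :
    Bidual.map i x ∈ closure[Bidual.ultraweak A] (Set.range fun b => toBidual (i b)) :=
  Bidual.mem_closure_of_map (Bidual.continuous_map i)
    (by rintro _ ⟨b, rfl⟩; exact ⟨b, (Bidual.map_toBidual i b).symm⟩) (Bidual.dense_toBidual x)

/-- The normal extension to `A**` of a homomorphism on the ideal `J`. -/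
noncomputable def extend {B : Type w} [NonUnitalCStarAlgebra B] (ψ : J →⋆ₙₐ[ℂ] B) :
    Bidual A →⋆ₙₐ[ℂ] Bidual B := (Bidual.map ψ).comp hi.retract

theorem continuous_extend {B : Type w} [NonUnitalCStarAlgebra B] (ψ : J →⋆ₙₐ[ℂ] B) :
    Continuous[Bidual.ultraweak A, Bidual.ultraweak B] (hi.extend ψ) := by
  rw [extend, NonUnitalStarAlgHom.coe_comp]
  exact Bidual.continuous_comp (Bidual.continuous_map ψ) hi.continuous_retract

theorem extend_toBidual {B : Type w} [NonUnitalCStarAlgebra B] (ψ : J →⋆ₙₐ[ℂ] B) (b : J) :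
    hi.extend ψ (toBidual (i b)) = toBidual (ψ b) := by
  rw [extend, NonUnitalStarAlgHom.comp_apply, hi.retract_toBidual, Bidual.map_toBidual]

/-- The enveloping von Neumann algebra of `J` is the ultraweak closure of `J` in `A**`. -/
noncomputable def equivClosure (I : NonUnitalStarSubalgebra ℂ (Bidual A))
    (hI : ∀ x, x ∈ I ↔ x ∈ closure[Bidual.ultraweak A] (Set.range fun b => toBidual (i b))) :
    Bidual J ≃⋆ₐ[ℂ] I where
  toFun x := ⟨Bidual.map i x, (hI _).mpr (Bidual.map_mem_closure i x)⟩
  invFun y := hi.retract y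
  left_inv x := hi.retract_map x
  right_inv y := Subtype.ext (hi.map_retract ((hI _).mp y.2))
  map_mul' x y := Subtype.ext (map_mul (Bidual.map i) x y)
  map_add' x y := Subtype.ext (map_add (Bidual.map i) x y)
  map_star' x := Subtype.ext (map_star (Bidual.map i) x)
  map_smul' c x := Subtype.ext (map_smul (Bidual.map i) c x)

include hi in
theorem exists_equivClosure (I : NonUnitalStarSubalgebra ℂ (Bidual A))
    (hI : ∀ x, x ∈ I ↔ x ∈ closure[Bidual.ultraweak A] (Set.range fun b => toBidual (i b))) :
    ∃ e : Bidual J ≃⋆ₐ[ℂ] I, Continuous[Bidual.ultraweak J, Bidual.ultraweakOn I] e ∧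
      Continuous[Bidual.ultraweakOn I, Bidual.ultraweak J] e.symm ∧
      ∀ b, (e (toBidual b) : Bidual A) = toBidual (i b) :=
  ⟨hi.equivClosure I hI, Bidual.continuous_toSubalgebra (Bidual.continuous_map i),
    Bidual.continuous_ofSubalgebra hi.continuous_retract, fun b => Bidual.map_toBidual i b⟩

end IsIdealEmbedding

end Ideal

/-! ### The extension of a partial action to the enveloping von Neumann algebra -/

/-- Multiplication is used only as a separately ultraweakly continuous map, so the two factors are
approximated one after the other. -/
theorem Bidual.mul_mem_closure {A : Type u} [NonUnitalCStarAlgebra A] {s t r : Set A}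
    (h : ∀ a ∈ s, ∀ b ∈ t, a * b ∈ r) {x y : Bidual A}
    (hx : x ∈ closure[Bidual.ultraweak A] (toBidual '' s))
    (hy : y ∈ closure[Bidual.ultraweak A] (toBidual '' t)) :
    x * y ∈ closure[Bidual.ultraweak A] (toBidual '' r) := by
  have h1 : ∀ z ∈ toBidual '' s, z * y ∈ closure[Bidual.ultraweak A] (toBidual '' r) := by
    rintro _ ⟨a, ha, rfl⟩
    refine Bidual.mem_closure_of_map (f := fun y => toBidual a * y)
      (Bidual.continuous_mul_left _) ?_ hy
    rintro _ ⟨b, hb, rfl⟩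
    exact ⟨a * b, h a ha b hb, map_mul _ _ _⟩
  have h2 := Bidual.mem_closure_of_map (f := fun x => x * y) (Bidual.continuous_mul_right y) h1 hx
  rwa [@closure_closure _ (Bidual.ultraweak A)] at h2

namespace PartialAction

/-- Once the ideals are identified, both families of isomorphisms have the same type and are
determined by their values on the domains; the remaining fields are propositions. -/
theorem ext_act {S : Type v} [InverseMonoid S] {A : Type u} [NonUnitalCStarAlgebra A]
    {θ₁ θ₂ : PartialAction S A} (h : ∀ s, θ₁.ideal s = θ₂.ideal s)
    (h' : ∀ s, ∀ a ∈ θ₁.ideal s⁻¹, θ₁.act s a = θ₂.act s a) : θ₁ = θ₂ := by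
  have h1 : ∀ s (a : A) (h₁ : a ∈ θ₁.ideal s⁻¹) (h₂ : a ∈ θ₂.ideal s⁻¹),
      (θ₁.equiv s ⟨a, h₁⟩ : A) = θ₂.equiv s ⟨a, h₂⟩ := fun s a h₁ h₂ => by
    rw [← act_of_mem, ← act_of_mem, h' s a h₁]
  clear h'
  obtain ⟨I₁, hl₁, hr₁, hc₁, e₁, p₁⟩ := θ₁
  obtain ⟨I₂, hl₂, hr₂, hc₂, e₂, p₂⟩ := θ₂
  obtain rfl : I₁ = I₂ := funext h
  obtain rfl : e₁ = e₂ := funext fun s => StarAlgEquiv.ext fun a =>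
    Subtype.ext (h1 s a a.2 a.2)
  rfl

variable {S : Type v} [InverseMonoid S] {A : Type u} [NonUnitalCStarAlgebra A]
  (θ : PartialAction S A)

/-- The inclusion of the ideal `A_s`. -/
def incl (s : S) : θ.ideal s →⋆ₙₐ[ℂ] A := NonUnitalStarSubalgebraClass.subtype (θ.ideal s)

theorem incl_apply (s : S) (a : θ.ideal s) : θ.incl s a = a := rfl

theorem isIdealEmbedding (s : S) : IsIdealEmbedding (θ.incl s) where
  injective := Subtype.val_injective
  exists_mul_left a b := ⟨⟨a * b, θ.mul_mem_left s a b b.2⟩, rfl⟩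

theorem act_inv_act (s : S) {a : A} (h : a ∈ θ.ideal s⁻¹) : θ.act s⁻¹ (θ.act s a) = a := by
  simpa only [InverseMonoid.inv_inv'] using θ.act_act_inv s⁻¹ h

/-- The isomorphism `θ s`, as a homomorphism into `A`. -/
noncomputable def hom (s : S) : θ.ideal s⁻¹ →⋆ₙₐ[ℂ] A :=
  (θ.incl s).comp (NonUnitalStarAlgHomClass.toNonUnitalStarAlgHom (θ.equiv s))

theorem hom_apply (s : S) (a : θ.ideal s⁻¹) : θ.hom s a = θ.act s a := (θ.act_of_mem a.2).symm

/-- A normal endomorphism of `A**` extending `θ s`. -/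
noncomputable def bidualHom (s : S) : Bidual A →⋆ₙₐ[ℂ] Bidual A :=
  (θ.isIdealEmbedding s⁻¹).extend (θ.hom s)

theorem continuous_bidualHom (s : S) :
    Continuous[Bidual.ultraweak A, Bidual.ultraweak A] (θ.bidualHom s) :=
  (θ.isIdealEmbedding s⁻¹).continuous_extend (θ.hom s)

theorem bidualHom_toBidual (s : S) {a : A} (ha : a ∈ θ.ideal s⁻¹) :
    θ.bidualHom s (toBidual a) = toBidual (θ.act s a) :=
  ((θ.isIdealEmbedding s⁻¹).extend_toBidual (θ.hom s) ⟨a, ha⟩).trans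
    (congrArg toBidual (θ.hom_apply s ⟨a, ha⟩))

/-- The ideal of `A**` generated by `A_s`. -/
noncomputable def bidualIdeal (s : S) : NonUnitalStarSubalgebra ℂ (Bidual A) :=
  NonUnitalStarAlgHom.range (Bidual.map (θ.incl s))

theorem range_incl (s : S) :
    (Set.range fun b => toBidual (θ.incl s b)) = toBidual '' (θ.ideal s : Set A) := by
  ext x
  constructor
  · rintro ⟨b, rfl⟩; exact ⟨b, b.2, rfl⟩
  · rintro ⟨b, hb, rfl⟩; exact ⟨⟨b, hb⟩, rfl⟩

theorem map_incl_retract (s : S) {y : Bidual A}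
    (hy : y ∈ closure[Bidual.ultraweak A] (toBidual '' (θ.ideal s : Set A))) :
    Bidual.map (θ.incl s) ((θ.isIdealEmbedding s).retract y) = y :=
  (θ.isIdealEmbedding s).map_retract (by rwa [range_incl])

/-- The two descriptions serve different purposes: as a range of `(A_s)**` the ideal is a star
subalgebra with a unit, while as a closure it receives every identity between normal maps known on
`A_s`. -/
theorem mem_bidualIdeal_iff {s : S} {x : Bidual A} : x ∈ θ.bidualIdeal s ↔
    x ∈ closure[Bidual.ultraweak A] (toBidual '' (θ.ideal s : Set A)) := by
  constructor
  · rintro ⟨z, rfl⟩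
    rw [← range_incl]
    exact Bidual.map_mem_closure (θ.incl s) z
  · intro hx
    exact ⟨_, θ.map_incl_retract s hx⟩

theorem toBidual_mem_bidualIdeal {s : S} {a : A} (ha : a ∈ θ.ideal s) :
    toBidual a ∈ θ.bidualIdeal s := ⟨toBidual ⟨a, ha⟩, Bidual.map_toBidual _ _⟩

theorem bidualHom_mem (s : S) {x : Bidual A} (hx : x ∈ θ.bidualIdeal s⁻¹) :
    θ.bidualHom s x ∈ θ.bidualIdeal s := by
  rw [mem_bidualIdeal_iff] at hx ⊢
  refine Bidual.mem_closure_of_map (θ.continuous_bidualHom s) ?_ hx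
  rintro _ ⟨a, ha, rfl⟩
  exact ⟨_, θ.act_mem s a, (θ.bidualHom_toBidual s ha).symm⟩

theorem bidualHom_bidualHom_inv (s : S) {x : Bidual A} (hx : x ∈ θ.bidualIdeal s) :
    θ.bidualHom s (θ.bidualHom s⁻¹ x) = x := by
  rw [mem_bidualIdeal_iff] at hx
  letI := Bidual.ultraweak A
  refine Bidual.eq_of_mem_closure (f := fun x => θ.bidualHom s (θ.bidualHom s⁻¹ x)) (g := id)
    ((θ.continuous_bidualHom s).comp (θ.continuous_bidualHom s⁻¹)) continuous_id ?_ hx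
  rintro _ ⟨a, ha, rfl⟩
  have ha' : a ∈ θ.ideal (s⁻¹)⁻¹ := by rwa [InverseMonoid.inv_inv']
  rw [bidualHom_toBidual _ _ ha', bidualHom_toBidual _ _ (θ.act_inv_mem s a), θ.act_act_inv s ha, id]

theorem bidualHom_inv_bidualHom (s : S) {x : Bidual A} (hx : x ∈ θ.bidualIdeal s⁻¹) :
    θ.bidualHom s⁻¹ (θ.bidualHom s x) = x := by
  simpa only [InverseMonoid.inv_inv'] using θ.bidualHom_bidualHom_inv s⁻¹ hx

theorem bidualHom_inv_mem (s : S) {x : Bidual A} (hx : x ∈ θ.bidualIdeal s) :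
    θ.bidualHom s⁻¹ x ∈ θ.bidualIdeal s⁻¹ :=
  θ.bidualHom_mem s⁻¹ (by rwa [InverseMonoid.inv_inv'])

/-- The isomorphism `(A**)_{s⁻¹} → (A**)_s` induced by `θ s`. -/
noncomputable def bidualEquiv (s : S) : θ.bidualIdeal s⁻¹ ≃⋆ₐ[ℂ] θ.bidualIdeal s where
  toFun x := ⟨θ.bidualHom s x, θ.bidualHom_mem s x.2⟩
  invFun x := ⟨θ.bidualHom s⁻¹ x, θ.bidualHom_inv_mem s x.2⟩
  left_inv x := Subtype.ext (θ.bidualHom_inv_bidualHom s x.2)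
  right_inv x := Subtype.ext (θ.bidualHom_bidualHom_inv s x.2)
  map_mul' x y := Subtype.ext (map_mul (θ.bidualHom s) (x : Bidual A) y)
  map_add' x y := Subtype.ext (map_add (θ.bidualHom s) (x : Bidual A) y)
  map_star' x := Subtype.ext (map_star (θ.bidualHom s) (x : Bidual A))
  map_smul' c x := Subtype.ext (map_smul (θ.bidualHom s) c (x : Bidual A))

/-- The image `p` of the unit of `(A_s)**` satisfies `p x = x`. Approximating `p` from `A_s` and `x`
from `A_t` gives products lying in `A_s ∩ A_t`. This density is what lets the axioms on composite
domains extend to `A**`. -/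
theorem bidualIdeal_inter (s t : S) {x : Bidual A} (hs : x ∈ θ.bidualIdeal s)
    (ht : x ∈ θ.bidualIdeal t) : x ∈ closure[Bidual.ultraweak A]
      (toBidual '' ((θ.ideal s : Set A) ∩ (θ.ideal t : Set A))) := by
  have hu : Bidual.map (θ.incl s) 1 ∈ θ.bidualIdeal s := ⟨1, rfl⟩
  obtain ⟨z, hz⟩ := id hs
  have h1 : Bidual.map (θ.incl s) 1 * x = x := by
    rw [← hz]
    exact (map_mul (Bidual.map (θ.incl s)) 1 z).symm.trans (by rw [one_mul]; rfl)
  rw [mem_bidualIdeal_iff] at hu ht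
  rw [← h1]
  exact Bidual.mul_mem_closure (r := (θ.ideal s : Set A) ∩ (θ.ideal t : Set A))
    (fun a ha b hb => ⟨θ.mul_mem_right _ _ _ ha, θ.mul_mem_left _ _ _ hb⟩) hu ht

theorem bidual_mul_mem_left (s : S) (x y : Bidual A) (hy : y ∈ θ.bidualIdeal s) :
    x * y ∈ θ.bidualIdeal s := by
  rw [mem_bidualIdeal_iff] at hy ⊢
  have hx := Bidual.dense_toBidual x
  rw [← Set.image_univ] at hx
  exact Bidual.mul_mem_closure (fun a _ b hb => θ.mul_mem_left s a b hb) hx hy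

theorem bidual_mul_mem_right (s : S) (x y : Bidual A) (hx : x ∈ θ.bidualIdeal s) :
    x * y ∈ θ.bidualIdeal s := by
  rw [mem_bidualIdeal_iff] at hx ⊢
  have hy := Bidual.dense_toBidual y
  rw [← Set.image_univ] at hy
  exact Bidual.mul_mem_closure (fun a ha b _ => θ.mul_mem_right s a b ha) hx hy

theorem bidual_isClosed (s : S) : IsClosed (θ.bidualIdeal s : Set (Bidual A)) := by
  have h : (θ.bidualIdeal s : Set (Bidual A)) =
      id ⁻¹' closure[Bidual.ultraweak A] (toBidual '' (θ.ideal s : Set A)) := by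
    ext x; exact θ.mem_bidualIdeal_iff
  rw [h]
  exact @IsClosed.preimage _ _ _ (Bidual.ultraweak A) _ Bidual.continuous_id_ultraweak _
    (@isClosed_closure _ (Bidual.ultraweak A) _)

theorem extendByZero_bidualEquiv {s : S} {x : Bidual A} (hx : x ∈ θ.bidualIdeal s⁻¹) :
    extendByZero (fun a : θ.bidualIdeal s⁻¹ => θ.bidualEquiv s a) x = θ.bidualHom s x :=
  dif_pos hx

theorem bidual_isPartialAction : IsPartialAction (fun s => (θ.bidualIdeal s : Set (Bidual A)))
    (fun s => extendByZero (fun a : θ.bidualIdeal s⁻¹ => θ.bidualEquiv s a)) := by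
  -- For elements of `A_s ∩ A_{t⁻¹}` this is the domain axiom of `θ`; normality and the density of
  -- this intersection give the rest.
  have hdom : ∀ s t : S, ∀ y ∈ θ.bidualIdeal s, y ∈ θ.bidualIdeal t⁻¹ →
      θ.bidualHom s⁻¹ y ∈ θ.bidualIdeal (t * s)⁻¹ := by
    intro s t y hs ht
    rw [mem_bidualIdeal_iff]
    refine Bidual.mem_closure_of_map (θ.continuous_bidualHom s⁻¹) ?_ (θ.bidualIdeal_inter s t⁻¹ hs ht)
    rintro _ ⟨a, ⟨ha, hat⟩, rfl⟩
    have ha' : a ∈ θ.ideal (s⁻¹)⁻¹ := by rwa [InverseMonoid.inv_inv']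
    refine ⟨_, ?_, (θ.bidualHom_toBidual s⁻¹ ha').symm⟩
    rw [InverseMonoid.mul_inv_rev']
    exact θ.act_mem_mul s⁻¹ t⁻¹ ha' hat
  have hval : ∀ s : S, ∀ y ∈ θ.bidualIdeal s,
      extendByZero (fun a : θ.bidualIdeal (s⁻¹)⁻¹ => θ.bidualEquiv s⁻¹ a) y =
        θ.bidualHom s⁻¹ y := fun s y hy =>
    θ.extendByZero_bidualEquiv (by rwa [InverseMonoid.inv_inv'])
  have hone : ∀ x, x ∈ θ.bidualIdeal 1 := fun x => by
    have h1 : (θ.ideal 1 : Set A) = Set.univ := θ.isPartialAction.dom_one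
    rw [mem_bidualIdeal_iff, h1, Set.image_univ]
    exact Bidual.dense_toBidual x
  refine ⟨fun s => ?_, Set.eq_univ_of_forall hone, fun x => ?_, fun s t => ?_, fun s t => ?_⟩
  · refine ⟨fun x hx => ?_, fun x hx y hy hxy => ?_, fun y hy => ?_⟩
    · rw [extendByZero_bidualEquiv θ hx]
      exact θ.bidualHom_mem s hx
    · rw [extendByZero_bidualEquiv θ hx, extendByZero_bidualEquiv θ hy] at hxy
      rw [← θ.bidualHom_inv_bidualHom s hx, hxy, θ.bidualHom_inv_bidualHom s hy]
    · refine ⟨θ.bidualHom s⁻¹ y, θ.bidualHom_inv_mem s hy, ?_⟩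
      rw [extendByZero_bidualEquiv θ (θ.bidualHom_inv_mem s hy), θ.bidualHom_bidualHom_inv s hy]
  · rw [extendByZero_bidualEquiv θ (by rw [InverseMonoid.inv_one']; exact hone x)]
    letI := Bidual.ultraweak A
    refine Bidual.eq_of_toBidual (f := θ.bidualHom 1) (g := id) (θ.continuous_bidualHom 1)
      continuous_id (fun a => ?_) x
    have h1 : (θ.ideal 1 : Set A) = Set.univ := θ.isPartialAction.dom_one
    have ha : a ∈ (θ.ideal 1⁻¹ : Set A) := by rw [InverseMonoid.inv_one', h1]; trivial
    rw [bidualHom_toBidual _ _ ha, id]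
    exact congrArg _ (θ.isPartialAction.map_one a)
  · rintro _ ⟨y, ⟨hs, ht⟩, rfl⟩
    rw [hval s y hs]
    exact hdom s t y hs ht
  · rintro _ ⟨y, ⟨hs, ht⟩, rfl⟩
    rw [hval s y hs, extendByZero_bidualEquiv θ (hdom s t y hs ht),
      extendByZero_bidualEquiv θ (θ.bidualHom_inv_mem s hs), θ.bidualHom_bidualHom_inv s hs,
      extendByZero_bidualEquiv θ ht]
    letI := Bidual.ultraweak A
    -- Both sides are normal in `y`, so the composition rule need only be verified for `y` in `A_s ∩
    -- A_{t⁻¹}`.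
    refine Bidual.eq_of_mem_closure (f := fun y => θ.bidualHom (t * s) (θ.bidualHom s⁻¹ y))
      (g := θ.bidualHom t) ((θ.continuous_bidualHom _).comp (θ.continuous_bidualHom _))
      (θ.continuous_bidualHom t) ?_ (θ.bidualIdeal_inter s t⁻¹ hs ht)
    rintro _ ⟨a, ⟨ha, hat⟩, rfl⟩
    have ha' : a ∈ θ.ideal (s⁻¹)⁻¹ := by rwa [InverseMonoid.inv_inv']
    have hm : θ.act s⁻¹ a ∈ θ.ideal (t * s)⁻¹ := by
      rw [InverseMonoid.mul_inv_rev']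
      exact θ.act_mem_mul s⁻¹ t⁻¹ ha' hat
    rw [bidualHom_toBidual _ _ ha', bidualHom_toBidual _ _ hm, bidualHom_toBidual _ _ hat]
    congr 1
    have h := θ.isPartialAction.map_mul s t (θ.act s⁻¹ a) ⟨a, ⟨ha, hat⟩, rfl⟩
    refine h.trans (congrArg (θ.act t) ?_)
    exact θ.act_act_inv s ha

/-- The extension `θ**` of a partial action `θ` to the enveloping von Neumann algebra. -/
noncomputable def bidual : PartialAction S (Bidual A) where
  ideal := θ.bidualIdeal
  mul_mem_left := θ.bidual_mul_mem_left
  mul_mem_right := θ.bidual_mul_mem_right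
  isClosed := θ.bidual_isClosed
  equiv := θ.bidualEquiv
  isPartialAction := θ.bidual_isPartialAction

theorem bidual_act {s : S} {x : Bidual A} (hx : x ∈ θ.bidualIdeal s⁻¹) :
    θ.bidual.act s x = θ.bidualHom s x := dif_pos hx

theorem isBidualAction_bidual : IsBidualAction θ θ.bidual where
  ideal_eq_closure s := by
    ext x
    exact θ.mem_bidualIdeal_iff
  ideal_equiv s := by
    refine (θ.isIdealEmbedding s).exists_equivClosure (θ.bidualIdeal s) fun x => ?_
    rw [range_incl]
    exact θ.mem_bidualIdeal_iff
  normal s := by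
    exact continuous_induced_rng.mpr
      (Bidual.continuous_ofSubalgebra (θ.continuous_bidualHom s))
  equiv_extends s a h := by
    refine (θ.bidualHom_toBidual s a.2).trans ?_
    rw [θ.act_of_mem a.2]

/-- The ideals are forced by the closure condition. The maps are compared after pulling them back to
`(A_{s⁻¹})**`, where both are normal and agree on the dense subset `A_{s⁻¹}`. -/
theorem eq_bidual {θ' : PartialAction S (Bidual A)} (h : IsBidualAction θ θ') : θ' = θ.bidual := by
  have hI : ∀ s, θ'.ideal s = θ.bidual.ideal s := fun s => SetLike.coe_injective (by
    rw [h.ideal_eq_closure, θ.isBidualAction_bidual.ideal_eq_closure])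
  refine ext_act hI fun s x hx => ?_
  have hx' : x ∈ θ.bidualIdeal s⁻¹ := by rw [hI] at hx; exact hx
  obtain ⟨z, rfl⟩ := hx'
  have hm : ∀ z, Bidual.map (θ.incl s⁻¹) z ∈ θ'.ideal s⁻¹ := fun z => by
    rw [hI]; exact ⟨z, rfl⟩
  have h1 : Continuous[Bidual.ultraweak _, Bidual.ultraweak A]
      fun z => θ'.act s (Bidual.map (θ.incl s⁻¹) z) := by
    have hc := Bidual.continuous_toSubalgebra (I := θ'.ideal s⁻¹) (f := fun z => ⟨_, hm z⟩)
      (Bidual.continuous_map (θ.incl s⁻¹))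
    have hc' := @continuous_induced_dom _ _ (Subtype.val : θ'.ideal s → Bidual A)
      (Bidual.ultraweak A)
    have hc'' := @Continuous.comp _ _ _ (Bidual.ultraweak _) (Bidual.ultraweakOn _)
      (Bidual.ultraweak A) _ _ (@Continuous.comp _ _ _ (Bidual.ultraweakOn _)
        (Bidual.ultraweakOn _) (Bidual.ultraweak A) _ _ hc' (h.normal s)) hc
    exact @Continuous.congr _ _ (Bidual.ultraweak _) (Bidual.ultraweak A) _ _ hc'' fun z =>
      (θ'.act_of_mem (hm z)).symm
  have h2 : Continuous[Bidual.ultraweak _, Bidual.ultraweak A]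
      fun z => θ.bidualHom s (Bidual.map (θ.incl s⁻¹) z) :=
    Bidual.continuous_comp (θ.continuous_bidualHom s) (Bidual.continuous_map (θ.incl s⁻¹))
  refine (Bidual.eq_of_toBidual h1 h2 (fun a => ?_) z).trans (θ.bidual_act ⟨z, rfl⟩).symm
  have hma := hm (toBidual a)
  rw [Bidual.map_toBidual] at hma ⊢
  rw [θ'.act_of_mem hma]
  refine (h.equiv_extends s a hma).trans ?_
  rw [incl_apply, θ.bidualHom_toBidual s a.2, θ.act_of_mem a.2]

end PartialAction

/-! ### Construction of covariant representations -/

section CovariantData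

variable {S : Type v} [InverseMonoid S] {A : Type u} [NonUnitalCStarAlgebra A]
  {H : Type w} [NormedAddCommGroup H] [InnerProductSpace ℂ H] [CompleteSpace H]

/-- A vector in both essential spaces is a limit of `π(e)ξ` with `e ∈ I`, and `π(e)` maps `π(b)ζ`,
`b ∈ J`, to `π(e b)ζ` with `e b ∈ I ∩ J`. Properties on the intersection can thus be tested on `π(I
∩ J)H`. -/
theorem map_mem_of_inter (π : A →⋆ₙₐ[ℂ] (H →L[ℂ] H)) {I J : NonUnitalStarSubalgebra ℂ A}
    [IsClosed (I : Set A)] (hIr : ∀ a b : A, a ∈ I → a * b ∈ I) (hJl : ∀ a b : A, b ∈ J → a * b ∈ J)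
    {K : Submodule ℂ H} (hK : IsClosed (K : Set H)) (T : H →L[ℂ] H)
    (h : ∀ a ∈ I, a ∈ J → ∀ ξ, T (π a ξ) ∈ K) {ξ : H} (hI : ξ ∈ essSpace π I)
    (hJ : ξ ∈ essSpace π J) : T ξ ∈ K := by
  refine hK.mem_of_tendsto ((T.continuous.tendsto ξ).comp (tendsto_approxUnit_apply π hI))
    (Eventually.of_forall fun e => ?_)
  refine map_mem_of_essSpace π hK (T * π (e : A)) (fun b hb ζ => ?_) hJ
  rw [mul_apply_eq_comp, ← mul_apply_eq_comp (π (e : A)), ← map_mul]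
  exact h _ (hIr _ _ e.2) (hJl _ _ hb) ζ

/-- A representation of `A` with contractions which implement the partial action `θ` on the
subspaces `π(A_s) H`. -/
structure CovariantData (θ : PartialAction S A) (π : A →⋆ₙₐ[ℂ] (H →L[ℂ] H)) (T : S → H →L[ℂ] H) :
    Prop where
  norm_le : ∀ s, ‖T s‖ ≤ 1
  map_one : ∀ a, T 1 * π a = π a
  comm : ∀ s, ∀ a ∈ θ.ideal s⁻¹, T s * π a = π (θ.act s a) * T s
  mul_inv : ∀ s, ∀ a ∈ θ.ideal s, T s * T s⁻¹ * π a = π a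
  map_mul : ∀ s t, ∀ a ∈ θ.ideal s, a ∈ θ.ideal t⁻¹ →
    T (t * s) * π (θ.act s⁻¹ a) = T t * T s * π (θ.act s⁻¹ a)
  nondegenerate : ∀ ξ, (∀ a, π a ξ = 0) → ξ = 0

namespace CovariantData

variable {θ : PartialAction S A} {π : A →⋆ₙₐ[ℂ] (H →L[ℂ] H)} {T : S → H →L[ℂ] H}
  (h : CovariantData θ π T)

include h

theorem apply_mem (s : S) {ξ : H} (hξ : ξ ∈ essSpace π (θ.ideal s⁻¹)) :
    T s ξ ∈ essSpace π (θ.ideal s) :=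
  map_mem_of_essSpace π (isClosed_essSpace π _) (T s) (fun a ha ζ => by
    rw [← mul_apply_eq_comp, h.comm s a ha]
    exact apply_mem_essSpace π (θ.act_mem s a) _) hξ

theorem apply_inv_mem (s : S) {ξ : H} (hξ : ξ ∈ essSpace π (θ.ideal s)) :
    T s⁻¹ ξ ∈ essSpace π (θ.ideal s⁻¹) :=
  h.apply_mem s⁻¹ (by rwa [InverseMonoid.inv_inv'])

theorem apply_apply_inv (s : S) {ξ : H} (hξ : ξ ∈ essSpace π (θ.ideal s)) :
    T s (T s⁻¹ ξ) = ξ :=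
  eq_of_mem_essSpace π (S := T s * T s⁻¹) (T := 1) (fun a ha ζ =>
    congrArg (fun R : H →L[ℂ] H => R ζ) (h.mul_inv s a ha)) hξ

theorem apply_inv_apply (s : S) {ξ : H} (hξ : ξ ∈ essSpace π (θ.ideal s⁻¹)) :
    T s⁻¹ (T s ξ) = ξ := by
  simpa only [InverseMonoid.inv_inv'] using h.apply_apply_inv s⁻¹ hξ

theorem norm_apply (s : S) {ξ : H} (hξ : ξ ∈ essSpace π (θ.ideal s⁻¹)) : ‖T s ξ‖ = ‖ξ‖ := by
  have h1 : ∀ s ζ, ‖T s ζ‖ ≤ ‖ζ‖ := fun s ζ => by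
    simpa using (T s).le_of_opNorm_le (h.norm_le s) ζ
  -- Two mutually inverse contractions are isometric.
  refine le_antisymm (h1 s ξ) ?_
  conv_lhs => rw [← h.apply_inv_apply s hξ]
  exact h1 _ _

theorem mem_essSpace_one (ξ : H) : ξ ∈ essSpace π (θ.ideal 1) := by
  have h1 : ∀ a, a ∈ (θ.ideal 1 : Set A) := fun a => by
    have := θ.isPartialAction.dom_one
    exact this.symm.subset trivial
  have h2 : (essSpace π (θ.ideal 1))ᗮ = ⊥ := by
    refine (Submodule.eq_bot_iff _).mpr fun ζ hζ => h.nondegenerate ζ fun a => ?_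
    exact (mem_orthogonal_essSpace_iff π).mp hζ a (h1 a)
  rw [Submodule.orthogonal_eq_bot_iff] at h2
  rw [h2]
  trivial

/-- The partial isometry given by `T s` on `π(A_{s⁻¹}) H`. -/
noncomputable def _root_.cutOff (θ : PartialAction S A) (π : A →⋆ₙₐ[ℂ] (H →L[ℂ] H))
    (T : S → H →L[ℂ] H) (s : S) : H →L[ℂ] H :=
  T s ∘L (essSpace π (θ.ideal s⁻¹)).starProjection

omit h in
theorem _root_.cutOff_apply (s : S) {ξ : H} (hξ : ξ ∈ essSpace π (θ.ideal s⁻¹)) :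
    cutOff θ π T s ξ = T s ξ := by
  rw [cutOff, ContinuousLinearMap.comp_apply, Submodule.starProjection_eq_self_iff.mpr hξ]

omit h in
theorem _root_.cutOff_inv_apply (s : S) {ξ : H} (hξ : ξ ∈ essSpace π (θ.ideal s)) :
    cutOff θ π T s⁻¹ ξ = T s⁻¹ ξ := cutOff_apply _ (by rwa [InverseMonoid.inv_inv'])

theorem apply_inv_mem_mul (s t : S) {ξ : H} (hs : ξ ∈ essSpace π (θ.ideal s))
    (ht : ξ ∈ essSpace π (θ.ideal t⁻¹)) : T s⁻¹ ξ ∈ essSpace π (θ.ideal (t * s)⁻¹) := by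
  refine map_mem_of_inter π (θ.mul_mem_right s) (θ.mul_mem_left t⁻¹) (isClosed_essSpace π _) _
    (fun a ha hat ζ => ?_) hs ht
  have ha' : a ∈ θ.ideal (s⁻¹)⁻¹ := by rwa [InverseMonoid.inv_inv']
  rw [← mul_apply_eq_comp, h.comm _ _ ha', InverseMonoid.mul_inv_rev']
  exact apply_mem_essSpace π (θ.act_mem_mul s⁻¹ t⁻¹ ha' hat) _

theorem map_mul_apply (s t : S) {ξ : H} (hs : ξ ∈ essSpace π (θ.ideal s))
    (ht : ξ ∈ essSpace π (θ.ideal t⁻¹)) : T (t * s) (T s⁻¹ ξ) = T t ξ := by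
  -- Choosing `K = ⊥` makes the membership statement an equality of operators on the intersection of
  -- the two essential spaces.
  have h1 := map_mem_of_inter π (θ.mul_mem_right s) (θ.mul_mem_left t⁻¹) (K := ⊥)
    isClosed_singleton (T (t * s) * T s⁻¹ - T t * T s * T s⁻¹) (fun a ha hat ζ => by
      have ha' : a ∈ θ.ideal (s⁻¹)⁻¹ := by rwa [InverseMonoid.inv_inv']
      have h2 : (T (t * s) * T s⁻¹ - T t * T s * T s⁻¹) * π a = 0 := by
        rw [sub_mul, sub_eq_zero, mul_assoc, mul_assoc, h.comm _ _ ha', ← mul_assoc, ← mul_assoc,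
          h.map_mul s t a ha hat]
      exact congrArg (fun R : H →L[ℂ] H => R ζ) h2) hs ht
  rw [Submodule.mem_bot, sub_apply, sub_eq_zero] at h1
  simp only [mul_apply_eq_comp] at h1
  rw [h1, h.apply_apply_inv s hs]

/-- The covariant representation attached to covariant data. -/
noncomputable def toCovariantRep : CovariantRep θ H where
  space s := essSpace π (θ.ideal s)
  isClosed s := isClosed_essSpace π _
  v := cutOff θ π T
  norm_map s ξ hξ := by rw [cutOff_apply s hξ, h.norm_apply s hξ]
  map_orthogonal s ξ hξ := by
    rw [cutOff, ContinuousLinearMap.comp_apply,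
      (Submodule.starProjection_apply_eq_zero_iff _).mpr hξ, map_zero]
  isPartialAction := by
    refine ⟨fun s => ⟨fun ξ hξ => ?_, fun ξ hξ η hη hξη => ?_, fun η hη => ?_⟩, ?_, fun ξ => ?_,
      fun s t => ?_, fun s t => ?_⟩
    · rw [cutOff_apply s hξ]
      exact h.apply_mem s hξ
    · simp only [cutOff_apply s hξ, cutOff_apply s hη] at hξη
      rw [← h.apply_inv_apply s hξ, hξη, h.apply_inv_apply s hη]
    · refine ⟨T s⁻¹ η, h.apply_inv_mem s hη, ?_⟩
      rw [cutOff_apply s (h.apply_inv_mem s hη), h.apply_apply_inv s hη]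
    · exact Set.eq_univ_of_forall h.mem_essSpace_one
    · rw [cutOff_apply 1 (by rw [InverseMonoid.inv_one']; exact h.mem_essSpace_one ξ)]
      exact eq_of_mem_essSpace π (S := T 1) (T := 1) (fun a _ ζ =>
        congrArg (fun R : H →L[ℂ] H => R ζ) (h.map_one a)) (h.mem_essSpace_one ξ)
    · rintro _ ⟨ξ, ⟨hs, ht⟩, rfl⟩
      rw [cutOff_inv_apply s hs]
      exact h.apply_inv_mem_mul s t hs ht
    · rintro _ ⟨ξ, ⟨hs, ht⟩, rfl⟩
      rw [cutOff_inv_apply s hs, cutOff_apply _ (h.apply_inv_mem_mul s t hs ht),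
        cutOff_apply s (h.apply_inv_mem s hs), h.apply_apply_inv s hs, cutOff_apply t ht,
        h.map_mul_apply s t hs ht]
  π := π
  closure_span s := rfl
  covariant s a := by
    ext1 ξ
    have hP : ((essSpace π (θ.ideal s)).starProjection ξ) ∈ essSpace π (θ.ideal s) :=
      (essSpace π (θ.ideal s)).starProjection_apply_mem ξ
    have h1 : cutOff θ π T s⁻¹ ξ = T s⁻¹ ((essSpace π (θ.ideal s)).starProjection ξ) := by
      simp only [cutOff, InverseMonoid.inv_inv', ContinuousLinearMap.comp_apply]
    rw [← θ.act_of_mem a.2, mul_apply_eq_comp, mul_apply_eq_comp, h1,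
      cutOff_apply s (apply_mem_essSpace π a.2 _), ← mul_apply_eq_comp (T s), h.comm s a a.2,
      mul_apply_eq_comp, h.apply_apply_inv s hP, apply_starProjection_essSpace π (θ.act_mem s a)]

theorem π_mul_T {s : S} {a : A} (ha : a ∈ θ.ideal s) : π a * T s = T s * π (θ.act s⁻¹ a) := by
  rw [h.comm s _ (θ.act_inv_mem s a), θ.act_act_inv s ha]

/-- Moving `π(a)` to the right of `T s` turns it into `π(θ_{s⁻¹}(a))`, which already absorbs the
projection. Hence integrated forms may be computed with the uncut operators `T s`. -/
theorem π_mul_cutOff {s : S} {a : A} (ha : a ∈ θ.ideal s) : π a * cutOff θ π T s = π a * T s := by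
  have h1 : cutOff θ π T s = T s * (essSpace π (θ.ideal s⁻¹)).starProjection := rfl
  rw [h1, ← mul_assoc, h.π_mul_T ha]
  ext1 ξ
  rw [mul_apply_eq_comp, mul_apply_eq_comp, mul_apply_eq_comp,
    apply_starProjection_essSpace π (θ.act_inv_mem s a)]

theorem integrated_toCovariantRep (f : FormalSum θ) :
    h.toCovariantRep.integrated f = f.coeff.sum fun s a => π a * T s :=
  Finset.sum_congr rfl fun s _ => h.π_mul_cutOff (f.coeff_mem s)

end CovariantData

end CovariantData

/-! ### Homomorphisms out of the crossed product -/

namespace CrossedProduct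

variable {S : Type v} [InverseMonoid S] {A : Type u} [NonUnitalCStarAlgebra A]
  {θ : PartialAction S A} {B : Type w} [NonUnitalCStarAlgebra B]

theorem norm_of_single_le (s : S) (a : θ.ideal s) : ‖single θ s a‖ ≤ ‖(a : A)‖ := by
  rw [single, LinearIsometry.norm_map, FormalSum.norm_def]
  refine Real.iSup_le (fun ρ => ?_) (norm_nonneg _)
  rw [CovariantRep.integrated_single]
  refine (norm_mul_le _ _).trans ((mul_le_mul (NonUnitalStarAlgHom.norm_apply_le ρ.rep.π _)
    (ρ.rep.norm_le_one s) (norm_nonneg _) (norm_nonneg _)).trans_eq (mul_one _))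

theorem _root_.FormalSum.eq_sum_single (f : FormalSum θ) :
    f = ∑ s ∈ f.coeff.support, FormalSum.single θ s ⟨f.coeff s, f.coeff_mem s⟩ := by
  refine Subtype.ext ?_
  refine Eq.trans ?_ (map_sum (formalSums θ).subtype _ _).symm
  exact (Finsupp.sum_single f.coeff).symm

/-- A contractive homomorphism on `C_c(S, A)` extends to `A ⋊ S`. -/
theorem exists_lift (F : FormalSum θ →ₗ[ℂ] B) (hmul : ∀ f g, F (f * g) = F f * F g)
    (hstar : ∀ f, F (star f) = star (F f)) (hnorm : ∀ f, ‖F f‖ ≤ ‖f‖) :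
    ∃ Ψ : CrossedProduct θ →⋆ₙₐ[ℂ] B, ∀ f, Ψ (of θ f) = F f := by
  let F' : FormalSum θ →L[ℂ] B := F.mkContinuous 1 fun f => by simpa using hnorm f
  let G : CrossedProduct θ →L[ℂ] B := F'.extend (of θ).toContinuousLinearMap
  have hG : ∀ f, G (of θ f) = F f := fun f =>
    ContinuousLinearMap.extend_eq (f := F') (e := (of θ).toContinuousLinearMap) denseRange_of
      (of θ).isometry.isUniformInducing f
  refine ⟨{ G with
    map_zero' := map_zero G
    map_mul' := fun x y => ?_
    map_star' := fun x => ?_ }, hG⟩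
  · change G (x * y) = G x * G y
    refine denseRange_of.induction_on₂ (p := fun x y => G (x * y) = G x * G y)
      (isClosed_eq (by fun_prop) (by fun_prop)) (fun f g => ?_) x y
    rw [← of_mul, hG, hG, hG, hmul]
  · change G (star x) = star (G x)
    refine denseRange_of.induction_on (p := fun x => G (star x) = star (G x)) x
      (isClosed_eq (by fun_prop) (by fun_prop)) (fun f => ?_)
    rw [← of_star, hG, hG, hstar]

/-- A linear map on `C_c(S, A)` which is contractive, and multiplicative and `⋆`-preserving on
elementary terms, extends to `A ⋊ S`. -/
theorem exists_lift_of_single (F : FormalSum θ →ₗ[ℂ] B)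
    (hmul : ∀ s t a b, F (FormalSum.single θ s a * FormalSum.single θ t b) =
      F (FormalSum.single θ s a) * F (FormalSum.single θ t b))
    (hstar : ∀ s a, F (star (FormalSum.single θ s a)) = star (F (FormalSum.single θ s a)))
    (hnorm : ∀ f, ‖F f‖ ≤ ‖f‖) :
    ∃ Ψ : CrossedProduct θ →⋆ₙₐ[ℂ] B, ∀ f, Ψ (of θ f) = F f := by
  have hF : ∀ f, F f = ∑ s ∈ f.coeff.support, F (FormalSum.single θ s ⟨f.coeff s, f.coeff_mem s⟩) :=
    fun f => by
      conv_lhs => rw [f.eq_sum_single]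
      rw [map_sum]
  refine exists_lift F (fun f g => ?_) (fun f => ?_) hnorm
  · rw [hF f, hF g, Finset.sum_mul_sum]
    change F (∑ s ∈ f.coeff.support, ∑ t ∈ g.coeff.support, _) = _
    simp only [map_sum]
    refine Finset.sum_congr rfl fun s _ => Finset.sum_congr rfl fun t _ => ?_
    rw [← hmul, FormalSum.single_mul_single]
  · rw [hF f, star_sum]
    change F (∑ s ∈ f.coeff.support, _) = _
    simp only [map_sum]
    refine Finset.sum_congr rfl fun s _ => ?_
    rw [← hstar, FormalSum.star_single]

theorem hom_ext {Ψ₁ Ψ₂ : CrossedProduct θ →⋆ₙₐ[ℂ] B}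
    (h : ∀ s a, Ψ₁ (single θ s a) = Ψ₂ (single θ s a)) (x : CrossedProduct θ) : Ψ₁ x = Ψ₂ x := by
  have hc : ∀ Ψ : CrossedProduct θ →⋆ₙₐ[ℂ] B, Continuous Ψ := fun Ψ =>
    (AddMonoidHomClass.lipschitz_of_bound Ψ 1 fun a => by
      simpa using NonUnitalStarAlgHom.norm_apply_le Ψ a).continuous
  refine denseRange_of.induction_on (p := fun x => Ψ₁ x = Ψ₂ x) x
    (isClosed_eq (hc _) (hc _)) (fun f => ?_)
  rw [f.eq_sum_single]
  simp only [map_sum]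
  exact Finset.sum_congr rfl fun s _ => h s _

end CrossedProduct

/-! ### The canonical homomorphism `A ⋊ S → A** ⋊ S` -/

section Compression

variable {H : Type w} [NormedAddCommGroup H] [InnerProductSpace ℂ H] [CompleteSpace H]
  (K : Submodule ℂ H) [CompleteSpace K]

/-- The compression of an operator to a closed subspace. -/
noncomputable def compress (R : H →L[ℂ] H) : K →L[ℂ] K := K.subtypeL.adjoint ∘L R ∘L K.subtypeL

theorem adjoint_subtypeL_of_mem {x : H} (hx : x ∈ K) : K.subtypeL.adjoint x = ⟨x, hx⟩ := by
  refine ext_inner_right ℂ fun y => ?_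
  rw [ContinuousLinearMap.adjoint_inner_left]
  rfl

theorem compress_apply (R : H →L[ℂ] H) (ξ : K) : compress K R ξ = K.subtypeL.adjoint (R ξ) := rfl

theorem norm_compress_le (R : H →L[ℂ] H) : ‖compress K R‖ ≤ ‖R‖ := by
  have h1 : ‖K.subtypeL.adjoint‖ ≤ 1 :=
    (LinearIsometryEquiv.norm_map _ _).trans_le (Submodule.norm_subtypeL_le K)
  refine ContinuousLinearMap.opNorm_le_bound _ (norm_nonneg R) fun ξ => ?_
  rw [compress_apply]
  refine (ContinuousLinearMap.le_of_opNorm_le _ h1 _).trans ?_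
  rw [one_mul]
  exact R.le_opNorm ξ

theorem star_compress (R : H →L[ℂ] H) : star (compress K R) = compress K (star R) := by
  simp only [ContinuousLinearMap.star_eq_adjoint, compress, ContinuousLinearMap.adjoint_comp,
    ContinuousLinearMap.adjoint_adjoint]
  rfl

/-- Compression is multiplicative once the projection between the factors can be absorbed: here by
the range of the right factor, in `mul_compress` by the range of the adjoint of the left factor. -/
theorem compress_mul {R T : H →L[ℂ] H} (hT : ∀ ξ, T ξ ∈ K) :
    compress K R * compress K T = compress K (R * T) := by
  ext1 ξ
  rw [mul_apply_eq_comp, compress_apply K T, adjoint_subtypeL_of_mem K (hT ξ)]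
  rfl

theorem apply_starProjection_of_star_mem {R : H →L[ℂ] H} (hR : ∀ ξ, star R ξ ∈ K) (ξ : H) :
    R (K.starProjection ξ) = R ξ := by
  refine ext_inner_left ℂ fun η => ?_
  rw [← sub_eq_zero, ← inner_sub_right, ← map_sub, ← ContinuousLinearMap.adjoint_inner_left,
    ← ContinuousLinearMap.star_eq_adjoint, ← neg_sub, inner_neg_right, neg_eq_zero]
  exact Submodule.inner_right_of_mem_orthogonal (hR η) (K.sub_starProjection_mem_orthogonal ξ)

theorem mul_compress {R T : H →L[ℂ] H} (hR : ∀ ξ, star R ξ ∈ K) :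
    compress K R * compress K T = compress K (R * T) := by
  ext1 ξ
  have h : compress K R (K.subtypeL.adjoint (T ξ)) =
      K.subtypeL.adjoint (R (K.starProjection (T ξ))) := by
    rw [Submodule.adjoint_subtypeL, compress_apply, Submodule.adjoint_subtypeL]
    rfl
  rw [mul_apply_eq_comp, compress_apply K T, h, apply_starProjection_of_star_mem K hR]
  rfl

/-- Such an operator vanishes on the orthogonal complement of `K` and maps `K` into `K`, so the
compression retains all of it. -/
theorem norm_le_norm_compress {R : H →L[ℂ] H} (hR : ∀ ξ, R ξ ∈ K) (hR' : ∀ ξ, star R ξ ∈ K) :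
    ‖R‖ ≤ ‖compress K R‖ := by
  refine ContinuousLinearMap.opNorm_le_bound _ (compress K R).opNorm_nonneg fun ξ => ?_
  have h1 := (compress K R).le_opNorm ⟨K.starProjection ξ, K.starProjection_apply_mem ξ⟩
  rw [compress_apply, adjoint_subtypeL_of_mem K (hR _)] at h1
  change ‖R (K.starProjection ξ)‖ ≤ _ * ‖K.starProjection ξ‖ at h1
  rw [apply_starProjection_of_star_mem K hR'] at h1
  exact h1.trans (mul_le_mul_of_nonneg_left (Submodule.norm_starProjection_apply_le K ξ)
    (compress K R).opNorm_nonneg)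

variable {A : Type u} [NonUnitalCStarAlgebra A]

/-- The compression of a representation to an invariant subspace containing its range. -/
noncomputable def compressHom (π : A →⋆ₙₐ[ℂ] (H →L[ℂ] H)) (h : ∀ a ξ, π a ξ ∈ K) :
    A →⋆ₙₐ[ℂ] (K →L[ℂ] K) where
  toFun a := compress K (π a)
  map_zero' := by ext ξ; simp [compress_apply]
  map_add' a b := by ext ξ; simp [compress_apply]
  map_smul' c a := by ext ξ; simp [compress_apply]
  map_mul' a b := by rw [compress_mul K (h b), map_mul]
  map_star' a := by rw [star_compress, map_star]

theorem compressHom_apply (π : A →⋆ₙₐ[ℂ] (H →L[ℂ] H)) (h : ∀ a ξ, π a ξ ∈ K) (a : A) :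
    compressHom K π h a = compress K (π a) := rfl

end Compression

/-! ### Restricting covariant representations of `A**` to `A`. -/

section Restriction

variable {S : Type v} [InverseMonoid S] {A : Type u} [NonUnitalCStarAlgebra A]
  {θ : PartialAction S A}

namespace PartialAction

theorem bidual_act_toBidual (θ : PartialAction S A) {s : S} {a : A} (ha : a ∈ θ.ideal s⁻¹) :
    θ.bidual.act s (toBidual a) = toBidual (θ.act s a) :=
  (θ.bidual_act (θ.toBidual_mem_bidualIdeal ha)).trans (θ.bidualHom_toBidual s ha)

theorem toBidual_mem_bidual (θ : PartialAction S A) {s : S} {a : A} (ha : a ∈ θ.ideal s) :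
    toBidual a ∈ θ.bidual.ideal s := θ.toBidual_mem_bidualIdeal ha

end PartialAction

/-- The formal sum in `C_c(S, A**)` defined by one in `C_c(S, A)`. -/
noncomputable def FormalSum.mapBidual (θ : PartialAction S A) :
    FormalSum θ →ₗ[ℂ] FormalSum θ.bidual where
  toFun f := ⟨f.coeff.mapRange toBidual (map_zero _), fun s => by
    rw [Finsupp.mapRange_apply]
    exact θ.toBidual_mem_bidual (f.coeff_mem s)⟩
  map_add' f g := Subtype.ext (Finsupp.mapRange_add (hf := map_zero _) (map_add _) f.coeff g.coeff)
  map_smul' c f := Subtype.ext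
    (Finsupp.mapRange_smul (hf := map_zero _) c f.coeff fun x => map_smul toBidual c x)

theorem FormalSum.mapBidual_single (s : S) (a : θ.ideal s) :
    FormalSum.mapBidual θ (FormalSum.single θ s a) =
      FormalSum.single θ.bidual s ⟨toBidual (a : A), θ.toBidual_mem_bidual a.2⟩ :=
  Subtype.ext (Finsupp.mapRange_single (f := toBidual) (hf := map_zero _))

theorem FormalSum.coeff_mapBidual (f : FormalSum θ) :
    (FormalSum.mapBidual θ f).coeff = f.coeff.mapRange toBidual (map_zero _) := rfl

namespace CovariantRep

variable {H : Type w} [NormedAddCommGroup H] [InnerProductSpace ℂ H] [CompleteSpace H]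
  (ρ : CovariantRep θ.bidual H)

/-- The restriction of a representation of `A**` to `A`. -/
noncomputable def restrict : A →⋆ₙₐ[ℂ] (H →L[ℂ] H) := ρ.π.comp toBidual

theorem restrict_apply (a : A) : ρ.restrict a = ρ.π (toBidual a) := rfl

theorem v_mul_restrict {s : S} {a : A} (ha : a ∈ θ.ideal s⁻¹) :
    ρ.v s * ρ.restrict a = ρ.restrict (θ.act s a) * ρ.v s := by
  rw [restrict_apply, restrict_apply, ← ρ.π_act_mul_v (θ.toBidual_mem_bidual ha),
    θ.bidual_act_toBidual ha]

/-- The space of the restriction of `ρ` to `A`. -/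
noncomputable abbrev restrictSpace : Submodule ℂ H := essSpace ρ.restrict ⊤

instance : CompleteSpace ρ.restrictSpace := (isClosed_essSpace _ _).completeSpace_coe

theorem restrict_mem (a : A) (ξ : H) : ρ.restrict a ξ ∈ ρ.restrictSpace :=
  apply_mem_essSpace ρ.restrict (I := ⊤) trivial ξ

theorem v_mul_restrict_mem {s : S} {a : A} (ha : a ∈ θ.ideal s⁻¹) (ξ : H) :
    (ρ.v s * ρ.restrict a) ξ ∈ ρ.restrictSpace := by
  rw [ρ.v_mul_restrict ha]
  exact ρ.restrict_mem _ _

theorem restrict_mul_v {s : S} {a : A} (ha : a ∈ θ.ideal s) :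
    ρ.restrict a * ρ.v s = ρ.v s * ρ.restrict (θ.act s⁻¹ a) := by
  rw [ρ.v_mul_restrict (θ.act_inv_mem s a), θ.act_act_inv s ha]

theorem v_mul_v_restrict {s t : S} {a : A} (ha : a ∈ θ.ideal s) (hat : a ∈ θ.ideal t⁻¹) :
    ρ.v (t * s) * ρ.restrict (θ.act s⁻¹ a) = ρ.v t * (ρ.v s * ρ.restrict (θ.act s⁻¹ a)) := by
  ext1 ζ
  -- This identity places the image under `v_s` in the space of `t⁻¹` as well as in that of `s`, so
  -- the composition axiom of the partial representation applies.
  have h1 : ρ.v s (ρ.restrict (θ.act s⁻¹ a) ζ) = ρ.restrict a (ρ.v s ζ) := by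
    rw [← mul_apply_eq_comp, ← ρ.restrict_mul_v ha, mul_apply_eq_comp]
  refine ρ.isPartialAction.map_mul s t _ ⟨ρ.v s (ρ.restrict (θ.act s⁻¹ a) ζ), ⟨?_, ?_⟩, ?_⟩
  · exact ρ.apply_mem s _
  · rw [h1]
    exact ρ.π_mem (θ.toBidual_mem_bidual hat) _
  · exact ρ.map_inv_map s (ρ.π_mem (θ.toBidual_mem_bidual (θ.act_inv_mem s a)) ζ)

theorem compress_restrict_mul (a : A) (R : H →L[ℂ] H) :
    compress ρ.restrictSpace (ρ.restrict a) * compress ρ.restrictSpace R =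
      compress ρ.restrictSpace (ρ.restrict a * R) :=
  mul_compress _ fun ξ => by rw [← map_star]; exact ρ.restrict_mem _ ξ

/-- Normality of the representation of `A**` is not assumed, so its restriction to `A` may be
degenerate and is compressed to the closed span of `π(A)H`. The operators `v_s` need not preserve
this space, but each relation involves them only next to some `π(a)`, where `v_s π(a) = π(θ_s(a))
v_s` keeps the range inside. -/
theorem covariantData_restrict : CovariantData θ (compressHom ρ.restrictSpace ρ.restrict
    ρ.restrict_mem) (fun s => compress ρ.restrictSpace (ρ.v s)) where
  norm_le s := (norm_compress_le _ _).trans (ρ.norm_le_one s)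
  map_one a := by
    have h1 : ρ.v 1 = 1 := ContinuousLinearMap.ext fun ξ => ρ.isPartialAction.map_one ξ
    rw [compressHom_apply, compress_mul _ (ρ.restrict_mem a), h1, one_mul]
  comm s a ha := by
    rw [compressHom_apply, compress_mul _ (ρ.restrict_mem a), compressHom_apply,
      compress_restrict_mul, ρ.v_mul_restrict ha]
  mul_inv s a ha := by
    have ha' : a ∈ θ.ideal (s⁻¹)⁻¹ := by rwa [InverseMonoid.inv_inv']
    have h1 := ρ.v_inv_v_π (θ.toBidual_mem_bidual ha')
    rw [InverseMonoid.inv_inv', mul_assoc] at h1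
    rw [compressHom_apply, mul_assoc, compress_mul _ (ρ.restrict_mem a),
      compress_mul _ (ρ.v_mul_restrict_mem ha'), restrict_apply, h1]
  map_mul s t a ha hat := by
    rw [compressHom_apply, mul_assoc, compress_mul _ (ρ.restrict_mem _),
      compress_mul _ (ρ.restrict_mem _), compress_mul _ (ρ.v_mul_restrict_mem (θ.act_inv_mem s a)),
      ρ.v_mul_v_restrict ha hat]
  nondegenerate ξ hξ := by
    have h1 : (ξ : H) ∈ ρ.restrictSpaceᗮ := (mem_orthogonal_essSpace_iff _).mpr fun a _ => by
      have h2 := hξ a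
      rw [compressHom_apply, compress_apply, adjoint_subtypeL_of_mem _ (ρ.restrict_mem a _)] at h2
      exact congrArg Subtype.val h2
    exact Subtype.ext (inner_self_eq_zero.mp (Submodule.inner_right_of_mem_orthogonal ξ.2 h1))

theorem integrated_mapBidual (f : FormalSum θ) : ρ.integrated (FormalSum.mapBidual θ f) =
    f.coeff.sum fun s a => ρ.restrict a * ρ.v s := by
  rw [integrated_apply, FormalSum.coeff_mapBidual]
  exact Finsupp.sum_mapRange_index (by simp)

theorem integrated_mapBidual_mem (f : FormalSum θ) (ξ : H) :
    ρ.integrated (FormalSum.mapBidual θ f) ξ ∈ ρ.restrictSpace := by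
  rw [integrated_mapBidual, Finsupp.sum, sum_apply]
  exact sum_mem fun s _ => ρ.restrict_mem _ _

theorem star_integrated_mapBidual_mem (f : FormalSum θ) (ξ : H) :
    star (ρ.integrated (FormalSum.mapBidual θ f)) ξ ∈ ρ.restrictSpace := by
  rw [integrated_mapBidual, Finsupp.sum, star_sum, sum_apply]
  refine sum_mem fun s _ => ?_
  rw [ρ.restrict_mul_v (f.coeff_mem s), star_mul, ← map_star]
  exact ρ.restrict_mem _ _

/-- With coefficients in `A`, the operator and its adjoint both map into the closed span of `π(A)H`,
so compression loses no norm. The compression is the integrated form of a covariant representation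
of `A`. -/
theorem norm_integrated_mapBidual_le (f : FormalSum θ) :
    ‖ρ.integrated (FormalSum.mapBidual θ f)‖ ≤
      ‖ρ.covariantData_restrict.toCovariantRep.integrated f‖ := by
  refine (norm_le_norm_compress ρ.restrictSpace (ρ.integrated_mapBidual_mem f)
    (ρ.star_integrated_mapBidual_mem f)).trans_eq (congrArg _ ?_)
  rw [CovariantData.integrated_toCovariantRep, integrated_mapBidual]
  simp only [compressHom_apply, compress_restrict_mul]
  ext1 ξ
  rw [compress_apply, Finsupp.sum, Finsupp.sum, sum_apply, sum_apply, map_sum]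
  rfl

end CovariantRep

theorem FormalSum.norm_integrated_le_norm (ρ : BundledCovariantRep.{u, v} θ) (f : FormalSum θ) :
    ‖ρ.rep.integrated f‖ ≤ ‖f‖ := by
  rw [FormalSum.norm_def]
  exact le_ciSup f.bddAbove_norm ρ

theorem FormalSum.norm_mapBidual_le (f : FormalSum θ) : ‖FormalSum.mapBidual θ f‖ ≤ ‖f‖ := by
  rw [FormalSum.norm_def]
  refine Real.iSup_le (fun ρ => ?_) (norm_nonneg _)
  exact (ρ.rep.norm_integrated_mapBidual_le f).trans
    (f.norm_integrated_le_norm ⟨_, ρ.rep.covariantData_restrict.toCovariantRep⟩)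

/-- The canonical homomorphism `A ⋊ S → A** ⋊ S`. -/
theorem CrossedProduct.exists_toBidual (θ : PartialAction S A) :
    ∃ ι : CrossedProduct θ →⋆ₙₐ[ℂ] CrossedProduct θ.bidual, ∀ (s : S) (a : θ.ideal s),
      ι (CrossedProduct.single θ s a) = CrossedProduct.single θ.bidual s
        ⟨toBidual (a : A), θ.toBidual_mem_bidual a.2⟩ := by
  have hmul : ∀ s t a b, CrossedProduct.of θ.bidual (FormalSum.mapBidual θ
      (FormalSum.single θ s a * FormalSum.single θ t b)) =
      CrossedProduct.of θ.bidual (FormalSum.mapBidual θ (FormalSum.single θ s a)) *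
      CrossedProduct.of θ.bidual (FormalSum.mapBidual θ (FormalSum.single θ t b)) := by
    intro s t a b
    rw [← CrossedProduct.of_mul]
    congr 1
    rw [FormalSum.single_mul_single, FormalSum.mapBidual_single, FormalSum.mapBidual_single,
      FormalSum.mapBidual_single, FormalSum.single_mul_single]
    refine FormalSum.single_congr ?_
    have ha : (a : A) ∈ θ.ideal (s⁻¹)⁻¹ := by rw [InverseMonoid.inv_inv']; exact a.2
    change _ = θ.bidual.act s (θ.bidual.act s⁻¹ (toBidual (a : A)) * toBidual (b : A))
    rw [θ.bidual_act_toBidual ha, ← map_mul,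
      θ.bidual_act_toBidual (θ.mul_mem_right _ _ _ (θ.act_inv_mem s _))]
  have hstar : ∀ s a, CrossedProduct.of θ.bidual (FormalSum.mapBidual θ
      (star (FormalSum.single θ s a))) =
      star (CrossedProduct.of θ.bidual (FormalSum.mapBidual θ (FormalSum.single θ s a))) := by
    intro s a
    rw [← CrossedProduct.of_star]
    congr 1
    rw [FormalSum.star_single, FormalSum.mapBidual_single, FormalSum.mapBidual_single,
      FormalSum.star_single]
    refine FormalSum.single_congr ?_
    have ha : star (a : A) ∈ θ.ideal (s⁻¹)⁻¹ := by
      rw [InverseMonoid.inv_inv']; exact star_mem a.2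
    change _ = θ.bidual.act s⁻¹ (star (toBidual (a : A)))
    rw [← map_star, θ.bidual_act_toBidual ha]
  obtain ⟨ι, hι⟩ := CrossedProduct.exists_lift_of_single
    ((CrossedProduct.of θ.bidual).toLinearMap ∘ₗ FormalSum.mapBidual θ) hmul hstar fun f =>
      ((CrossedProduct.of θ.bidual).norm_map _).trans_le (FormalSum.norm_mapBidual_le f)
  refine ⟨ι, fun s a => (hι _).trans ?_⟩
  rw [LinearMap.comp_apply, FormalSum.mapBidual_single]
  rfl

end Restriction

/-! ### The homomorphism `A** ⋊ S → (A ⋊ S)**` -/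

section LiftData

variable {S : Type v} [InverseMonoid S] {A : Type u} [NonUnitalCStarAlgebra A]
  {θ : PartialAction S A} {H : Type w} [NormedAddCommGroup H] [InnerProductSpace ℂ H]
  [CompleteSpace H] {π : A →⋆ₙₐ[ℂ] (H →L[ℂ] H)} {T : S → H →L[ℂ] H}

namespace Bidual

theorem continuous_inner_mul_liftRep (π : A →⋆ₙₐ[ℂ] (H →L[ℂ] H)) (L R : H →L[ℂ] H) (ξ η : H) :
    Continuous[Bidual.ultraweak A, inferInstance]
      fun x => inner ℂ ξ ((L * liftRep π x * R) η) := by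
  letI := Bidual.ultraweak A
  refine (continuous_inner_liftRep π (L.adjoint ξ) (R η)).congr fun x => ?_
  rw [mul_apply_eq_comp, mul_apply_eq_comp, ContinuousLinearMap.adjoint_inner_left]

/-- Identities between products with values of a normal representation pass to ultraweak closures. -/
theorem mul_liftRep_mul_eq (π : A →⋆ₙₐ[ℂ] (H →L[ℂ] H)) {L L' R R' : H →L[ℂ] H}
    {g g' : Bidual A → Bidual A} (hg : Continuous[Bidual.ultraweak A, Bidual.ultraweak A] g)
    (hg' : Continuous[Bidual.ultraweak A, Bidual.ultraweak A] g') {s : Set A}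
    (h : ∀ a ∈ s, L * liftRep π (g (toBidual a)) * R = L' * liftRep π (g' (toBidual a)) * R')
    {x : Bidual A} (hx : x ∈ closure[Bidual.ultraweak A] (toBidual '' s)) :
    L * liftRep π (g x) * R = L' * liftRep π (g' x) * R' := by
  refine ext_of_inner (f := fun x => L * liftRep π (g x) * R)
    (g := fun x => L' * liftRep π (g' x) * R') (fun ξ η => ?_) (fun ξ η => ?_) ?_ hx
  · exact @Continuous.comp _ _ _ (Bidual.ultraweak A) (Bidual.ultraweak A) _ _ _
      (continuous_inner_mul_liftRep π L R ξ η) hg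
  · exact @Continuous.comp _ _ _ (Bidual.ultraweak A) (Bidual.ultraweak A) _ _ _
      (continuous_inner_mul_liftRep π L' R' ξ η) hg'
  · rintro _ ⟨a, ha, rfl⟩
    exact h a ha

end Bidual

/-- Apart from the norm bound and nondegeneracy, each condition is an identity `L π(g x) R = L' π(g'
x) R'` with fixed operators and normal `g`, `g'`, so it extends from `A_s` to `(A**)_s` with `T`
unchanged. The composition rule uses the density of `A_s ∩ A_{t⁻¹}`; nondegeneracy already holds
over `A`. -/
theorem CovariantData.liftRep (h : CovariantData θ π T) :
    CovariantData θ.bidual (Bidual.liftRep π) T where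
  norm_le := h.norm_le
  map_one x := by
    letI := Bidual.ultraweak A
    have := Bidual.mul_liftRep_mul_eq π (L := T 1) (R := 1) (L' := 1) (R' := 1) (g := id) (g' := id)
      continuous_id continuous_id (s := Set.univ) (fun a _ => by
        rw [id, Bidual.liftRep_toBidual, h.map_one, one_mul]) (x := x)
        (by rw [Set.image_univ]; exact Bidual.dense_toBidual x)
    simpa using this
  comm s x hx := by
    letI := Bidual.ultraweak A
    have := Bidual.mul_liftRep_mul_eq π (L := T s) (R := 1) (L' := 1) (R' := T s) (g := id)
      (g' := θ.bidualHom s) continuous_id (θ.continuous_bidualHom s) (fun a ha => by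
        rw [id, θ.bidualHom_toBidual s ha, Bidual.liftRep_toBidual, Bidual.liftRep_toBidual,
          mul_one, one_mul, h.comm s a ha]) (θ.mem_bidualIdeal_iff.mp hx)
    rw [θ.bidual_act hx]
    simpa using this
  mul_inv s x hx := by
    letI := Bidual.ultraweak A
    have := Bidual.mul_liftRep_mul_eq π (L := T s * T s⁻¹) (R := 1) (L' := 1) (R' := 1) (g := id)
      (g' := id) continuous_id continuous_id (fun a ha => by
        rw [id, Bidual.liftRep_toBidual, h.mul_inv s a ha, one_mul]) (θ.mem_bidualIdeal_iff.mp hx)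
    simpa using this
  map_mul s t x hx hxt := by
    have hx' : x ∈ θ.bidualIdeal (s⁻¹)⁻¹ := by rw [InverseMonoid.inv_inv']; exact hx
    have := Bidual.mul_liftRep_mul_eq π (L := T (t * s)) (R := 1) (L' := T t * T s) (R' := 1)
      (g := θ.bidualHom s⁻¹) (g' := θ.bidualHom s⁻¹) (θ.continuous_bidualHom s⁻¹)
      (θ.continuous_bidualHom s⁻¹) (fun a ha => by
        have ha' : a ∈ θ.ideal (s⁻¹)⁻¹ := by rw [InverseMonoid.inv_inv']; exact ha.1
        rw [θ.bidualHom_toBidual s⁻¹ ha', Bidual.liftRep_toBidual, h.map_mul s t a ha.1 ha.2])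
      (θ.bidualIdeal_inter s t⁻¹ hx hxt)
    rw [θ.bidual_act hx']
    simpa using this
  nondegenerate ξ hξ := h.nondegenerate ξ fun a => by
    rw [← Bidual.liftRep_toBidual π]
    exact hξ _

end LiftData

/-! ### Elementary terms in the crossed product and the homomorphism from `A`. -/

namespace CrossedProduct

variable {S : Type v} [InverseMonoid S] {A : Type u} [NonUnitalCStarAlgebra A]
  (θ : PartialAction S A)

variable {θ} in
theorem single_congr {s t : S} {a : θ.ideal s} {b : θ.ideal t} (hst : s = t)
    (hab : (a : A) = b) : single θ s a = single θ t b := by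
  subst hst
  exact congrArg _ (Subtype.ext hab)

theorem single_mul_single (s t : S) (a : θ.ideal s) (b : θ.ideal t) :
    single θ s a * single θ t b = single θ (s * t) ⟨θ.act s (θ.act s⁻¹ a * b),
      θ.act_mem_mul s t (θ.mul_mem_right _ _ _ (θ.act_inv_mem s _))
        (θ.mul_mem_left _ _ _ b.2)⟩ := by
  rw [single, single, ← of_mul, FormalSum.single_mul_single]; rfl

theorem star_single (s : S) (a : θ.ideal s) :
    star (single θ s a) = single θ s⁻¹ ⟨θ.act s⁻¹ (star (a : A)), θ.act_mem _ _⟩ := by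
  rw [single, ← of_star, FormalSum.star_single]; rfl

theorem single_add (s : S) (a b : θ.ideal s) : single θ s (a + b) = single θ s a + single θ s b := by
  rw [single, single, single, ← map_add]
  exact congrArg _ (Subtype.ext (Finsupp.single_add s (a : A) b))

theorem single_smul (s : S) (c : ℂ) (a : θ.ideal s) : single θ s (c • a) = c • single θ s a := by
  rw [single, single, ← map_smul]
  exact congrArg _ (Subtype.ext (Finsupp.smul_single c s (a : A)).symm)

theorem _root_.PartialAction.mem_one (a : A) : a ∈ θ.ideal 1 :=
  θ.isPartialAction.dom_one.symm.subset (Set.mem_univ a)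

theorem _root_.PartialAction.act_one (a : A) : θ.act 1 a = a := θ.isPartialAction.map_one a

/-- In every covariant representation `v_e` is the identity on `π(A_e)H`. The two formal sums differ
in `C_c(S, A)` when `e ≠ 1` and `a ≠ 0`, so the identification appears only in the Hausdorff
completion. -/
theorem single_idem {e : S} (he : e * e = e) {a : A} (ha : a ∈ θ.ideal e) :
    single θ e ⟨a, ha⟩ = single θ 1 ⟨a, θ.mem_one a⟩ := by
  refine toProd_injective ?_
  rw [single, single, toProd_of, toProd_of]
  refine LinftyProd.ext fun ρ => ?_
  change ρ.rep.integrated _ = ρ.rep.integrated _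
  rw [CovariantRep.integrated_single, CovariantRep.integrated_single]
  have h1 : ρ.rep.v 1 = 1 := ContinuousLinearMap.ext fun ξ => ρ.rep.isPartialAction.map_one ξ
  have h2 : ρ.rep.v e * ρ.rep.π (star a) = ρ.rep.π (star a) := by
    ext1 ξ
    exact ρ.rep.isPartialAction.map_idem he (ρ.rep.π_mem (star_mem ha) ξ)
  have h3 := congrArg star h2
  rw [star_mul, ρ.rep.star_v, InverseMonoid.idem_inv he, map_star, star_star] at h3
  rw [h1, mul_one, h3]

theorem single_one_mul_single (s : S) (a : A) (b : θ.ideal s) :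
    single θ 1 ⟨a, θ.mem_one a⟩ * single θ s b = single θ s ⟨a * b, θ.mul_mem_left s a b b.2⟩ := by
  rw [single_mul_single]
  refine single_congr (one_mul s) ?_
  simp only [InverseMonoid.inv_one', θ.act_one]

/-- The canonical homomorphism `a ↦ a u_1`. -/
noncomputable def embed : A →⋆ₙₐ[ℂ] CrossedProduct θ where
  toFun a := single θ 1 ⟨a, θ.mem_one a⟩
  map_zero' := by
    rw [single, FormalSum.single_zero' 1 rfl, map_zero]
  map_add' a b := (single_congr rfl rfl).trans (single_add θ 1 ⟨a, θ.mem_one a⟩ ⟨b, θ.mem_one b⟩)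
  map_smul' c a := (single_congr rfl rfl).trans (single_smul θ 1 c ⟨a, θ.mem_one a⟩)
  map_mul' a b := (single_one_mul_single θ 1 a ⟨b, θ.mem_one b⟩).symm
  map_star' a := by
    rw [star_single]
    refine single_congr InverseMonoid.inv_one'.symm ?_
    simp only [InverseMonoid.inv_one', θ.act_one]

theorem embed_apply (a : A) : embed θ a = single θ 1 ⟨a, θ.mem_one a⟩ := rfl

theorem embed_mul_single (s : S) (a : A) (b : θ.ideal s) :
    embed θ a * single θ s b = single θ s ⟨a * b, θ.mul_mem_left s a b b.2⟩ :=
  single_one_mul_single θ s a b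

theorem _root_.PartialAction.act_mul {s : S} {a b : A} (ha : a ∈ θ.ideal s⁻¹) (hb : b ∈ θ.ideal s⁻¹) :
    θ.act s (a * b) = θ.act s a * θ.act s b := by
  rw [θ.act_of_mem ha, θ.act_of_mem hb, θ.act_of_mem (mul_mem ha hb)]
  exact congrArg Subtype.val (map_mul (θ.equiv s) ⟨a, ha⟩ ⟨b, hb⟩)

theorem _root_.PartialAction.norm_act_le {s : S} {a : A} (ha : a ∈ θ.ideal s⁻¹) :
    ‖θ.act s a‖ ≤ ‖a‖ := by
  rw [θ.act_of_mem ha]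
  exact NonUnitalStarAlgHom.norm_apply_le (θ.equiv s) (⟨a, ha⟩ : θ.ideal s⁻¹)

theorem single_act_mul_embed {s : S} {a : A} (ha : a ∈ θ.ideal s⁻¹) (b : A) :
    single θ s ⟨θ.act s a, θ.act_mem s a⟩ * embed θ b =
      single θ s ⟨θ.act s (a * b), θ.act_mem s _⟩ := by
  rw [embed_apply, single_mul_single]
  exact single_congr (mul_one s) (by simp only [θ.act_inv_act s ha])

/-- The map `a ↦ a u_s` as a linear map. -/
noncomputable def singleLinear (s : S) : θ.ideal s →ₗ[ℂ] CrossedProduct θ where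
  toFun := single θ s
  map_add' := single_add θ s
  map_smul' := single_smul θ s

end CrossedProduct

/-! ### Disintegration of representations of the crossed product. -/

namespace CrossedProduct

variable {S : Type v} [InverseMonoid S] {A : Type u} [NonUnitalCStarAlgebra A]
  {θ : PartialAction S A} {H : Type w} [NormedAddCommGroup H] [InnerProductSpace ℂ H]
  [CompleteSpace H] (U : CrossedProduct θ →⋆ₙₐ[ℂ] (H →L[ℂ] H))

theorem norm_hom_single_le (s : S) (a : θ.ideal s) : ‖U (single θ s a)‖ ≤ ‖(a : A)‖ :=
  (NonUnitalStarAlgHom.norm_apply_le U _).trans (norm_of_single_le s a)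

/-- The representation of `A` on the space of a representation of `A ⋊ S`. -/
noncomputable def embedRep : A →⋆ₙₐ[ℂ] (H →L[ℂ] H) := U.comp (embed θ)

theorem embedRep_apply (a : A) : embedRep U a = U (embed θ a) := rfl

/-- The map `a ↦ U(θ_s(a) u_s)` is a contractive right module map over `A_{s⁻¹}`. The operator
representing it as left multiplication is the desired `v_s`, and it vanishes where `A_{s⁻¹}` acts as
zero. -/
theorem exists_partialIsometry (s : S) :
    ∃ T : H →L[ℂ] H, ‖T‖ ≤ 1 ∧
      (∀ a ∈ θ.ideal s⁻¹, T * embedRep U a =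
        U (single θ s ⟨θ.act s a, θ.act_mem s a⟩)) ∧
      ∀ ξ, (∀ a ∈ θ.ideal s⁻¹, embedRep U a ξ = 0) → T ξ = 0 := by
  let L : θ.ideal s⁻¹ →ₗ[ℂ] (H →L[ℂ] H) :=
    (U : CrossedProduct θ →ₗ[ℂ] (H →L[ℂ] H)) ∘ₗ singleLinear θ s ∘ₗ
      (θ.equiv s : θ.ideal s⁻¹ →ₗ[ℂ] θ.ideal s)
  have hL : ∀ a : θ.ideal s⁻¹, L a =
      U (single θ s ⟨θ.act s a, θ.act_mem s a⟩) := fun a =>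
    congrArg _ (single_congr rfl (θ.act_of_mem a.2).symm)
  obtain ⟨T, hT1, hT2, hT3⟩ := exists_multiplier ((embedRep U).comp (θ.incl s⁻¹)) L zero_le_one
    (fun a => by
      rw [hL, one_mul]
      exact (norm_hom_single_le U s _).trans (θ.norm_act_le a.2))
    (fun a b => by
      rw [hL, hL, NonUnitalStarAlgHom.comp_apply, embedRep_apply U, ← map_mul, θ.incl_apply,
        single_act_mul_embed θ a.2]
      rfl)
  exact ⟨T, hT1, fun a ha => (hT2 ⟨a, ha⟩).trans (hL ⟨a, ha⟩), fun ξ hξ =>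
    hT3 ξ fun b => hξ b b.2⟩

/-- The partial isometry `v_s` on the space of a representation of `A ⋊ S`. -/
noncomputable def partialIsometry (s : S) :
    H →L[ℂ] H :=
  (exists_partialIsometry U s).choose

theorem norm_partialIsometry_le (s : S) : ‖partialIsometry U s‖ ≤ 1 :=
  (exists_partialIsometry U s).choose_spec.1

theorem partialIsometry_mul_embedRep (s : S) {a : A} (ha : a ∈ θ.ideal s⁻¹) :
    partialIsometry U s * embedRep U a =
      U (single θ s ⟨θ.act s a, θ.act_mem s a⟩) :=
  (exists_partialIsometry U s).choose_spec.2.1 a ha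

theorem partialIsometry_eq_zero (s : S) {ξ : H}
    (h : ∀ a ∈ θ.ideal s⁻¹, embedRep U a ξ = 0) : partialIsometry U s ξ = 0 :=
  (exists_partialIsometry U s).choose_spec.2.2 ξ h

/-- The extra factor `e ∈ A_{t⁻¹}` can be moved next to `v_t`, where the defining property applies:
`v_t π(e) = U(θ_t(e) u_t)`. -/
theorem partialIsometry_mul_single_mul (s t : S) {e a : A} (he : e ∈ θ.ideal t⁻¹)
    (ha : a ∈ θ.ideal s) : partialIsometry U t * U
      (single θ s ⟨e * a, θ.mul_mem_left s e a ha⟩) =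
      U (single θ (t * s) ⟨θ.act t (e * a), θ.act_mem_mul t s
        (θ.mul_mem_right _ _ _ he) (θ.mul_mem_left _ _ _ ha)⟩) := by
  rw [← embed_mul_single θ s e ⟨a, ha⟩, map_mul, ← embedRep_apply U, ← mul_assoc,
    partialIsometry_mul_embedRep U t he, ← map_mul, single_mul_single]
  exact congrArg _ (single_congr rfl (by simp only [θ.act_inv_act t he]))

/-- The factored case covers `e a` with `e ∈ A_{t⁻¹}`. The defect of the identity is additive and
norm continuous in `a`, so letting `e` run through an approximate unit of `A_{t⁻¹}` covers `a`
itself. -/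
theorem partialIsometry_mul_single (s t : S) {a : A} (ha : a ∈ θ.ideal s) (hat : a ∈ θ.ideal t⁻¹) :
    partialIsometry U t * U (single θ s ⟨a, ha⟩) =
      U (single θ (t * s) ⟨θ.act t a, θ.act_mem_mul t s hat ha⟩) := by
  let I : Submodule ℂ A :=
    { carrier := {a | a ∈ θ.ideal s ∧ a ∈ θ.ideal t⁻¹}
      add_mem' := fun h h' => ⟨add_mem h.1 h'.1, add_mem h.2 h'.2⟩
      zero_mem' := ⟨zero_mem _, zero_mem _⟩
      smul_mem' := fun c _ h => ⟨SMulMemClass.smul_mem c h.1, SMulMemClass.smul_mem c h.2⟩ }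
  let D : I → (H →L[ℂ] H) :=
    fun a => partialIsometry U t * U (single θ s ⟨a, a.2.1⟩) -
      U (single θ (t * s) ⟨θ.act t a, θ.act_mem_mul t s a.2.2 a.2.1⟩)
  have hact : ∀ a b : A, a ∈ θ.ideal t⁻¹ → b ∈ θ.ideal t⁻¹ →
      θ.act t (a - b) = θ.act t a - θ.act t b := fun a b ha hb => by
    rw [θ.act_of_mem ha, θ.act_of_mem hb, θ.act_of_mem (sub_mem ha hb)]
    exact congrArg Subtype.val (map_sub (θ.equiv t) ⟨a, ha⟩ ⟨b, hb⟩)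
  have hsingle : ∀ r (a b : θ.ideal r), single θ r (a - b) = single θ r a - single θ r b :=
    fun r a b => by
      rw [eq_sub_iff_add_eq, ← single_add, sub_add_cancel]
  have hsub : ∀ a b, D (a - b) = D a - D b := fun a b => by
    have h1 : single θ s ⟨(a - b : I), (a - b).2.1⟩ =
      single θ s ⟨a, a.2.1⟩ - single θ s ⟨b, b.2.1⟩ := by rw [← hsingle]; rfl
    have h2 : single θ (t * s) ⟨θ.act t (a - b : I), θ.act_mem_mul t s (a - b).2.2 (a - b).2.1⟩ =
        single θ (t * s) ⟨θ.act t a, θ.act_mem_mul t s a.2.2 a.2.1⟩ -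
        single θ (t * s) ⟨θ.act t b, θ.act_mem_mul t s b.2.2 b.2.1⟩ := by
      rw [← hsingle]
      exact single_congr rfl (hact a b a.2.2 b.2.2)
    simp only [D]
    rw [h1, h2, map_sub, map_sub, mul_sub]
    abel
  -- Each of the two terms of the defect has norm at most `‖a‖`, because `v_t`, `U` and `θ_t` are
  -- contractive.
  have hbd : ∀ a, ‖D a‖ ≤ 2 * ‖(a : A)‖ := fun a => by
    have h1 : ‖partialIsometry U t * U (single θ s ⟨a, a.2.1⟩)‖ ≤ ‖(a : A)‖ := by
      refine (norm_mul_le _ _).trans ((mul_le_mul (norm_partialIsometry_le U t)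
        (norm_hom_single_le U s _)
        (norm_nonneg _) zero_le_one).trans_eq (one_mul _))
    have h2 := (NonUnitalStarAlgHom.norm_apply_le U _).trans
      ((norm_of_single_le (t * s) ⟨θ.act t a, θ.act_mem_mul t s a.2.2 a.2.1⟩).trans
        (θ.norm_act_le a.2.2))
    refine (norm_sub_le _ _).trans ((add_le_add h1 h2).trans_eq (two_mul _).symm)
  have hzero : ∀ e : θ.ideal t⁻¹, D ⟨e * a, θ.mul_mem_left _ _ _ ha, θ.mul_mem_left _ _ _ hat⟩ = 0 :=
    fun e => sub_eq_zero.mpr (partialIsometry_mul_single_mul U s t e.2 ha)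
  have hle : ∀ e : θ.ideal t⁻¹, ‖D ⟨a, ha, hat⟩‖ ≤ 2 * ‖a - e * a‖ := fun e => by
    have h1 := hbd (⟨a, ha, hat⟩ - ⟨e * a, θ.mul_mem_left _ _ _ ha, θ.mul_mem_left _ _ _ hat⟩)
    rwa [hsub, hzero, sub_zero] at h1
  have hlim : Tendsto (fun e : θ.ideal t⁻¹ => 2 * ‖a - e * a‖) (approxUnit (θ.ideal t⁻¹)) (𝓝 0) := by
    have h1 := (continuous_subtype_val.tendsto _).comp
      (tendsto_approxUnit_mul (⟨a, hat⟩ : θ.ideal t⁻¹))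
    have h2 := ((tendsto_const_nhds (x := a)).sub h1).norm.const_mul 2
    simpa using h2
  exact sub_eq_zero.mp (norm_le_zero_iff.mp (ge_of_tendsto hlim (Eventually.of_forall hle)))

/-- A nondegenerate representation of `A ⋊ S` is the integrated form of covariant data. -/
theorem covariantData (hU : ∀ ξ, (∀ x, U x ξ = 0) → ξ = 0) :
    CovariantData θ (embedRep U) (partialIsometry U) where
  norm_le := norm_partialIsometry_le U
  map_one a := by
    rw [partialIsometry_mul_embedRep U 1 (by rw [InverseMonoid.inv_one']; exact θ.mem_one a)]
    exact congrArg _ (single_congr rfl (θ.act_one a))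
  comm s a ha := by
    ext1 ξ
    -- On the complement of the essential space of `A_{s⁻¹}` both sides vanish; on the essential
    -- space they are compared after right multiplication by `b ∈ A_{s⁻¹}`.
    obtain ⟨y, hy, z, hz, rfl⟩ :=
      (essSpace (embedRep U) (θ.ideal s⁻¹)).exists_add_mem_mem_orthogonal ξ
    have hz' := (mem_orthogonal_essSpace_iff (embedRep U)).mp hz
    have h1 : (embedRep U (θ.act s a) * partialIsometry U s) z = 0 := by
      rw [mul_apply_eq_comp, partialIsometry_eq_zero U s hz', map_zero]
    have h2 : (partialIsometry U s * embedRep U a) z = 0 := by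
      rw [mul_apply_eq_comp, hz' a ha, map_zero]
    rw [map_add, map_add, h1, h2, add_zero, add_zero]
    refine eq_of_mem_essSpace (embedRep U) (fun b hb ζ => ?_) hy
    have h3 : partialIsometry U s * embedRep U a * embedRep U b =
        embedRep U (θ.act s a) * partialIsometry U s * embedRep U b := by
      rw [mul_assoc, ← map_mul, partialIsometry_mul_embedRep U s (mul_mem ha hb), mul_assoc,
        partialIsometry_mul_embedRep U s hb, embedRep_apply U, ← map_mul, embed_mul_single]
      exact congrArg _ (single_congr rfl (θ.act_mul ha hb))
    exact congrArg (fun R : H →L[ℂ] H => R ζ) h3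
  mul_inv s a ha := by
    have ha' : a ∈ θ.ideal (s⁻¹)⁻¹ := by rwa [InverseMonoid.inv_inv']
    -- The product is `U(a u_{s s⁻¹})`, and `s s⁻¹` is idempotent, so `single_idem` turns it into
    -- `U(a u_1)`.
    rw [mul_assoc, partialIsometry_mul_embedRep U s⁻¹ ha',
      partialIsometry_mul_single U s⁻¹ s (θ.act_mem s⁻¹ a) (θ.act_inv_mem s a), embedRep_apply U,
      embed_apply, ← single_idem θ (InverseMonoid.idem_left s) (θ.isPartialAction.subset_idem s ha)]
    exact congrArg _ (single_congr rfl (θ.act_act_inv s ha))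
  map_mul s t a ha hat := by
    have ha' : a ∈ θ.ideal (s⁻¹)⁻¹ := by rwa [InverseMonoid.inv_inv']
    have hm : θ.act s⁻¹ a ∈ θ.ideal (t * s)⁻¹ := by
      rw [InverseMonoid.mul_inv_rev']
      exact θ.act_mem_mul s⁻¹ t⁻¹ ha' hat
    have h1 : single θ s ⟨θ.act s (θ.act s⁻¹ a), θ.act_mem s _⟩ = single θ s ⟨a, ha⟩ :=
      single_congr rfl (θ.act_act_inv s ha)
    rw [partialIsometry_mul_embedRep U _ hm, mul_assoc,
      partialIsometry_mul_embedRep U s (θ.act_inv_mem s a), h1,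
      partialIsometry_mul_single U s t ha hat]
    refine congrArg _ (single_congr rfl ?_)
    have h := θ.isPartialAction.map_mul s t (θ.act s⁻¹ a) ⟨a, ⟨ha, hat⟩, rfl⟩
    exact h.trans (congrArg (θ.act t) (θ.act_act_inv s ha))
  nondegenerate ξ hξ := by
    -- Writing `U(a u_s) = v_s π(θ_{s⁻¹}(a))`, a vector killed by the image of `A` is killed by all
    -- elementary terms, hence by density by all of `A ⋊ S`.
    have h1 : ∀ s a, U (single θ s a) ξ = 0 := fun s a => by
      have h2 := partialIsometry_mul_embedRep U s (θ.act_inv_mem s a)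
      have h3 : single θ s ⟨θ.act s (θ.act s⁻¹ a), θ.act_mem s _⟩ = single θ s a :=
        single_congr rfl (θ.act_act_inv s a.2)
      rw [h3] at h2
      rw [← h2, mul_apply_eq_comp, hξ, map_zero]
    refine hU ξ fun x => ?_
    refine denseRange_of.induction_on (p := fun x => U x ξ = 0) x
      (isClosed_eq ((continuous_hom _).clm_apply continuous_const) continuous_const) (fun f => ?_)
    rw [f.eq_sum_single, map_sum, map_sum, sum_apply]
    exact Finset.sum_eq_zero fun s _ => h1 s _

variable (hU : ∀ ξ, (∀ x, U x ξ = 0) → ξ = 0)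

include hU in
theorem embedRep_mul_partialIsometry (s : S) {a : A} (ha : a ∈ θ.ideal s) :
    embedRep U a * partialIsometry U s = U (single θ s ⟨a, ha⟩) := by
  rw [(covariantData U hU).π_mul_T ha, partialIsometry_mul_embedRep U s (θ.act_inv_mem s a)]
  exact congrArg _ (single_congr rfl (θ.act_act_inv s ha))

/-- The covariant representation of `A**` attached to a nondegenerate representation of `A ⋊ S`. -/
noncomputable def bidualCovariantRep :
    CovariantRep θ.bidual (H) :=
  (covariantData U hU).liftRep.toCovariantRep

/-- For `a ∈ A_s` the operator `π(a)v_s = U(a u_s)` commutes with `R`, and this relation for the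
whole product passes to coefficients in the ultraweak closure. Commutation of `R` with `v_s` alone
is not needed. -/
theorem integrated_bidualCovariantRep_comm (f : FormalSum θ.bidual)
    {R : H →L[ℂ] H}
    (hR : ∀ x, R * U x = U x * R) :
    R * (bidualCovariantRep U hU).integrated f = (bidualCovariantRep U hU).integrated f * R := by
  rw [bidualCovariantRep, CovariantData.integrated_toCovariantRep, Finsupp.sum, Finset.mul_sum,
    Finset.sum_mul]
  refine Finset.sum_congr rfl fun s _ => ?_
  letI := Bidual.ultraweak A
  have := Bidual.mul_liftRep_mul_eq (embedRep U) (L := R) (R := partialIsometry U s) (L' := 1)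
    (R' := partialIsometry U s * R) (g := id) (g' := id) continuous_id continuous_id
    (fun a ha => by
      rw [id, Bidual.liftRep_toBidual, one_mul, mul_assoc, ← mul_assoc (embedRep U a),
        embedRep_mul_partialIsometry U hU s ha, hR]) (θ.mem_bidualIdeal_iff.mp (f.coeff_mem s))
  rw [id, one_mul] at this
  rw [← mul_assoc, this, mul_assoc]

theorem integrated_bidualCovariantRep_single (s : S) (a : θ.ideal s) :
    (bidualCovariantRep U hU).integrated (FormalSum.single θ.bidual s ⟨toBidual (a : A),
      θ.toBidual_mem_bidual a.2⟩) = U (single θ s a) := by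
  rw [CovariantRep.integrated_single]
  refine ((covariantData U hU).liftRep.π_mul_cutOff (θ.toBidual_mem_bidual a.2)).trans ?_
  rw [Bidual.liftRep_toBidual, embedRep_mul_partialIsometry U hU s a.2]

end CrossedProduct

/-! ### Homomorphisms from `A** ⋊ S` into enveloping von Neumann algebras. -/

namespace CrossedProduct

variable {S : Type v} [InverseMonoid S] {A : Type u} [NonUnitalCStarAlgebra A]
  {θ : PartialAction S A} {H : Type (max u v)} [NormedAddCommGroup H] [InnerProductSpace ℂ H]
  [CompleteSpace H]

/-- A covariant representation on the universal space of `B` with values in the bicommutant defines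
a homomorphism into `B**`. -/
theorem exists_hom_to_bidual {B : Type (max u v)} [NonUnitalCStarAlgebra B]
    (ρ : CovariantRep θ (UniversalSpace B))
    (hρ : ∀ f R, (∀ b, R * universalRep B b = universalRep B b * R) →
      R * ρ.integrated f = ρ.integrated f * R)
    (hnorm : ∀ f, ‖ρ.integrated f‖ ≤ ‖f‖) :
    ∃ Φ : CrossedProduct θ →⋆ₙₐ[ℂ] Bidual B,
      ∀ f, Bidual.subtype B (Φ (of θ f)) = ρ.integrated f := by
  let G : FormalSum θ → Bidual B := fun f =>
    Bidual.ofCommute (ρ.integrated f) fun R hR => hρ f R hR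
  have hG : ∀ f, Bidual.subtype B (G f) = ρ.integrated f := fun f => rfl
  let F : FormalSum θ →ₗ[ℂ] Bidual B :=
    { toFun := G
      map_add' := fun f g => Bidual.subtype_injective (by
        rw [map_add (Bidual.subtype B), hG, hG, hG, map_add])
      map_smul' := fun c f => Bidual.subtype_injective (by
        rw [RingHom.id_apply, map_smul (Bidual.subtype B), hG, hG, map_smul]) }
  have hF : ∀ f, Bidual.subtype B (F f) = ρ.integrated f := hG
  obtain ⟨Φ, hΦ⟩ := exists_lift F
    (fun f g => Bidual.subtype_injective (by
      rw [map_mul (Bidual.subtype B), hF, hF, hF, ρ.integrated_mul]))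
    (fun f => Bidual.subtype_injective (by
      rw [map_star (Bidual.subtype B), hF, hF, ρ.integrated_star]))
    (fun f => by
      rw [← Bidual.norm_subtype, hF]
      exact hnorm f)
  exact ⟨Φ, fun f => by rw [hΦ, hF]⟩

theorem exists_bidualCovariantRep (U : CrossedProduct θ →⋆ₙₐ[ℂ] (H →L[ℂ] H))
    (hU : ∀ ξ, (∀ x, U x ξ = 0) → ξ = 0) : ∃ ρ : CovariantRep θ.bidual H,
      (∀ f R, (∀ x, R * U x = U x * R) → R * ρ.integrated f = ρ.integrated f * R) ∧
      (∀ f, ‖ρ.integrated f‖ ≤ ‖f‖) ∧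
      ∀ s (a : θ.ideal s), ρ.integrated (FormalSum.single θ.bidual s ⟨toBidual (a : A),
        θ.toBidual_mem_bidual a.2⟩) = U (single θ s a) :=
  ⟨bidualCovariantRep U hU, fun f _ hR => integrated_bidualCovariantRep_comm U hU f hR,
    -- The bound is immediate from the definition of the crossed product norm, since `H` lies in the
    -- universe over which its supremum is taken.
    fun f => f.norm_integrated_le_norm ⟨H, bidualCovariantRep U hU⟩,
    integrated_bidualCovariantRep_single U hU⟩

/-- The homomorphism from `A** ⋊ S` to `B**` attached to a surjection of `A ⋊ S` onto `B`. -/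
theorem exists_hom_bidual {B : Type (max u v)} [NonUnitalCStarAlgebra B]
    (q : CrossedProduct θ →⋆ₙₐ[ℂ] B) (hq : Function.Surjective q) :
    ∃ Φ : CrossedProduct θ.bidual →⋆ₙₐ[ℂ] Bidual B,
      ∀ (s : S) (a : θ.ideal s), Φ (single θ.bidual s ⟨toBidual (a : A),
        θ.toBidual_mem_bidual a.2⟩) = toBidual (q (single θ s a)) := by
  -- Surjectivity of `q` transfers nondegeneracy from the universal representation of `B` to its
  -- pullback to `A ⋊ S`.
  have hU : ∀ ξ, (∀ x, (universalRep B).comp q x ξ = 0) → ξ = 0 := fun ξ hξ =>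
    eq_zero_of_universalRep fun b => by
      obtain ⟨x, rfl⟩ := hq b
      exact hξ x
  obtain ⟨ρ, hρ, hnorm, hsingle⟩ := exists_bidualCovariantRep _ hU
  obtain ⟨Φ, hΦ⟩ := exists_hom_to_bidual ρ (fun f R hR => hρ f R fun x => hR (q x)) hnorm
  refine ⟨Φ, fun s a => Bidual.subtype_injective ?_⟩
  rw [Bidual.subtype_toBidual]
  exact (hΦ _).trans (hsingle s a)

end CrossedProduct

theorem mainTheorem4 {S : Type v} [InverseMonoid S] {A : Type u} [NonUnitalCStarAlgebra A]
    (θ : PartialAction S A) :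
    ∃ (θ'' : PartialAction S (Bidual A)) (h : IsBidualAction θ θ''),
      (∀ θ' : PartialAction S (Bidual A), IsBidualAction θ θ' → θ' = θ'') ∧
      ∃ (ι : CrossedProduct θ →⋆ₙₐ[ℂ] CrossedProduct θ'')
        (Φ : CrossedProduct θ'' →⋆ₙₐ[ℂ] Bidual (CrossedProduct θ)),
        (∀ (s : S) (a : θ.ideal s), ι (CrossedProduct.single θ s a) =
          CrossedProduct.single θ'' s ⟨toBidual (a : A), h.toBidual_mem a⟩) ∧
        ∀ x : CrossedProduct θ, Φ (ι x) = toBidual x := by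
  obtain ⟨ι, hι⟩ := CrossedProduct.exists_toBidual θ
  obtain ⟨Φ, hΦ⟩ := CrossedProduct.exists_hom_bidual
    (NonUnitalStarAlgHom.id ℂ (CrossedProduct θ)) Function.surjective_id
  refine ⟨θ.bidual, θ.isBidualAction_bidual, fun θ' h => θ.eq_bidual h, ι, Φ, hι, ?_⟩
  exact CrossedProduct.hom_ext (Ψ₁ := Φ.comp ι) fun s a => by
    rw [NonUnitalStarAlgHom.comp_apply, hι, hΦ]; rfl
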